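/- **Model.** Two agents have private signals $s_1,s_2\in[k]=\{1,\dots,k\}$, $k\ge 1$, and positive value functions $v_i:[k]^2\to\mathbb R_{>0}$ (allocating a good) or positive cost functions $c_i:[k]^2\to\mathbb R_{>0}$ (allocating a chore); for a chore put $v_i=1/c_i$. Let $\rho_i(s)=v_i(s)/\max_j v_j(s)\in(0,1]$. An allocation rule $x=(x_1,x_2)$ with $x_i:[k]^2\to[0,1]$ and $x_1+x_2=1$ is *truthful* (monotone) if, for each agent $i$ and each fixed signal of the other agent, $v_i(s_i,s_{-i})<v_i(s_i',s_{-i})$ implies $x_i(s_i,s_{-i})\le x_i(s_i',s_{-i})$; it is *deterministic* if all $x_i(s)\in\{0,1\}$. Its approximation ratios are $R_V(x)=\max_s 1/\sum_i x_i(s)\rho_i(s)$ for a good and $R_C(x)=\max_s\sum_i x_i(s)/\rho_i(s)$ for a chore. The problem Val (resp. Cst) asks for a truthful rule minimizing $R_V$ (resp. $R_C$), with minimum $R_V^*$ (resp. $R_C^*$). The problem Det asks for a deterministic truthful rule minimizing $R_V$ (good) or $R_C$ (chore); these two have the same minimum $R_D^*$ over deterministic truthful rules. **Theorem.** (1) Let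 the constraint digraph on $[k]^2$ have an arc $(s_1,s_2)\to(s_1',s_2)$ whenever $v_1(s_1,s_2)<v_1(s_1',s_2)$, and an arc $(s_1,s_2)\to(s_1,s_2')$ whenever $v_2(s_1,s_2')<v_2(s_1,s_2)$, and write $s\preceq s'$ if there is a directed path, possibly empty, from $s$ to $s'$. Let $f(1,1)=1$ and $f(u,w)=\frac{uw-1}{u+w-2}$ otherwise. The minima above exist, and $$R_V^*=\max_{s\preceq s'}\frac1{f(\rho_2(s),\rho_1(s'))},\qquad R_C^*=\max_{s\preceq s'}f\Bigl(\frac1{\rho_2(s)},\frac1{\rho_1(s')}\Bigr),\qquad R_D^*=\max_{s\preceq s'}\min\Bigl(\frac1{\rho_2(s)},\frac1{\rho_1(s')}\Bigr).$$ (2) Each of Val (given value functions), Cst (given cost functions) and Det (given value functions, or given cost functions) can be solved in $O(N\log N)$ time, where $N=2k^2b$: there are an absolute constant $C$ and, for each of these four tasks, one random access machine program which, given $k\ge1$ and for every agent and profile the numerator and denominator of a positive rational number written with at most $b$ bits in total, outputs in time at most $C\,N\log N$ the optimal ratio and an optimal allocation rule (as fractions). Time is measured by the logarithmic cost criterion: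 each instruction (addition, truncated subtraction, multiplication, memory access, test) on natural numbers costs one plus the number of bits of its operands and addresses. -/

import Mathlib

namespace TwoAgents

noncomputable section

/-! ### Allocation rules, truthfulness and approximation ratios (`n` agents, `k` signals) -/

/-- Signal profiles: agent `i` holds the signal `s i`. -/
abbrev Profile (n k : ℕ) := Fin n → Fin k

/-- A family of functions of the signal profile, one for each agent: value functions, cost
functions, performance ratios and allocation rules all have this type. -/
abbrev Family (n k : ℕ) := Fin n → Profile n k → ℝ

/-- Performance ratios `ρ_i(s) = v_i(s) / max_j v_j(s)`. -/
def rho {n k : ℕ} (v : Family n k) : Family n k :=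
  fun i s => v i s / ⨆ j, v j s

/-- The truthful polytope: randomized allocation rules in which the probability that `i` is
selected does not decrease when the signal of `i` (and nothing else) changes in such a way that
the value of `i` strictly increases. -/
def Truthful {n k : ℕ} (v : Family n k) : Set (Family n k) :=
  {x | (∀ i s, 0 ≤ x i s) ∧ (∀ s, ∑ i, x i s = 1) ∧
    ∀ (i : Fin n) (s : Profile n k) (t : Fin k),
      v i s < v i (Function.update s i t) → x i s ≤ x i (Function.update s i t)}

/-- The deterministic rules of the truthful polytope. -/
def TruthfulDet {n k : ℕ} (v : Family n k) : Set (Family n k) :=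
  {x | x ∈ Truthful v ∧ ∀ i s, x i s = 0 ∨ x i s = 1}

/-- Approximation ratio for a good. -/
def RV {n k : ℕ} (v x : Family n k) : ℝ :=
  ⨆ s, 1 / ∑ i, x i s * rho v i s

/-- Approximation ratio for a chore; the costs are the inverses of `v`. -/
def RC {n k : ℕ} (v x : Family n k) : ℝ :=
  ⨆ s, ∑ i, x i s * (1 / rho v i s)

/-- `x` minimizes the measure `R` over the feasible set `F`, and the minimum is `r`. -/
def IsOptimal {n k : ℕ} (F : Set (Family n k)) (R : Family n k → ℝ)
    (x : Family n k) (r : ℝ) : Prop :=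
  x ∈ F ∧ R x = r ∧ ∀ y ∈ F, R x ≤ R y

/-- The problem of the randomized setting for a good, with value functions `v`. -/
def Val {n k : ℕ} (v x : Family n k) (r : ℝ) : Prop :=
  IsOptimal (Truthful v) (RV v) x r

/-- The problem of the randomized setting for a chore, with cost functions `c`. -/
def Cst {n k : ℕ} (c x : Family n k) (r : ℝ) : Prop :=
  IsOptimal (Truthful fun i s => (c i s)⁻¹) (RC fun i s => (c i s)⁻¹) x r

/-- The problem of the deterministic setting for a good, with value functions `v`. -/
def DetVal {n k : ℕ} (v x : Family n k) (r : ℝ) : Prop :=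
  IsOptimal (TruthfulDet v) (RV v) x r

/-- The problem of the deterministic setting for a chore, with cost functions `c`. -/
def DetCst {n k : ℕ} (c x : Family n k) (r : ℝ) : Prop :=
  IsOptimal (TruthfulDet fun i s => (c i s)⁻¹) (RC fun i s => (c i s)⁻¹) x r

/-! ### Conflicting pairs (two agents; agent 1 is `0 : Fin 2`, agent 2 is `1 : Fin 2`) -/

/-- Arcs `s → s'` of the constraint digraph: the inequalities `x₁ s ≤ x₁ s'` that monotonicity
of `x₁`, respectively of `x₂ = 1 - x₁`, imposes. -/
def Arc {k : ℕ} (v : Family 2 k) (s s' : Profile 2 k) : Prop :=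
  (∃ t, s' = Function.update s 0 t ∧ v 0 s < v 0 s') ∨
  (∃ t, s' = Function.update s 1 t ∧ v 1 s' < v 1 s)

/-- Reachability by a (possibly empty) directed path in the constraint digraph. -/
def Reach {k : ℕ} (v : Family 2 k) : Profile 2 k → Profile 2 k → Prop :=
  Relation.ReflTransGen (Arc v)

/-- The conflict function. -/
def conflict (a b : ℝ) : ℝ :=
  if a = 1 ∧ b = 1 then 1 else (a * b - 1) / (a + b - 2)

/-- The numbers `g (ρ₂(s)) (ρ₁(s'))` over all pairs such that `s'` is reachable from `s`. -/
def conflictValues {k : ℕ} (v : Family 2 k) (g : ℝ → ℝ → ℝ) : Set ℝ :=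
  {r | ∃ s s', Reach v s s' ∧ r = g (rho v 1 s) (rho v 0 s')}

end

/-! ### Random access machines under the logarithmic cost criterion -/

/-- Registers and memory of a random access machine; both hold natural numbers. -/
structure State where
  reg : ℕ → ℕ
  mem : ℕ → ℕ

/-- Random access machine programs, in structured form. Registers are addressed by constants of
the program, memory cells by the contents of registers. -/
inductive Prog where
  /-- `reg d := c` -/
  | const (d c : ℕ)
  /-- `reg d := reg a + reg b` -/
  | add (d a b : ℕ)
  /-- `reg d := reg a - reg b`, which is `0` if `reg a ≤ reg b` -/
  | sub (d a b : ℕ)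
  /-- `reg d := reg a * reg b` -/
  | mul (d a b : ℕ)
  /-- `reg d := mem (reg a)` -/
  | load (d a : ℕ)
  /-- `mem (reg a) := reg b` -/
  | store (a b : ℕ)
  /-- `p`, then `q` -/
  | seq (p q : Prog)
  /-- `p` if `reg a = 0`, and `q` otherwise -/
  | branch (a : ℕ) (p q : Prog)
  /-- repeat `p` as long as `reg a ≠ 0` -/
  | loop (a : ℕ) (p : Prog)

/-- Assignment to a register. -/
def State.setReg (σ : State) (d x : ℕ) : State :=
  { σ with reg := Function.update σ.reg d x }

/-- Assignment to a memory cell. -/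
def State.setMem (σ : State) (a x : ℕ) : State :=
  { σ with mem := Function.update σ.mem a x }

/-- `Exec p σ t τ`: the program `p`, started in the state `σ`, halts in the state `τ` after time
`t`. Every instruction and every test costs one plus the number of bits of all the operands
and memory addresses that it handles. -/
inductive Exec : Prog → State → ℕ → State → Prop
  | const (σ : State) (d c : ℕ) :
      Exec (.const d c) σ (1 + c.size) (σ.setReg d c)
  | add (σ : State) (d a b : ℕ) :
      Exec (.add d a b) σ (1 + (σ.reg a).size + (σ.reg b).size)
        (σ.setReg d (σ.reg a + σ.reg b))
  | sub (σ : State) (d a b : ℕ) :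
      Exec (.sub d a b) σ (1 + (σ.reg a).size + (σ.reg b).size)
        (σ.setReg d (σ.reg a - σ.reg b))
  | mul (σ : State) (d a b : ℕ) :
      Exec (.mul d a b) σ (1 + (σ.reg a).size + (σ.reg b).size)
        (σ.setReg d (σ.reg a * σ.reg b))
  | load (σ : State) (d a : ℕ) :
      Exec (.load d a) σ (1 + (σ.reg a).size + (σ.mem (σ.reg a)).size)
        (σ.setReg d (σ.mem (σ.reg a)))
  | store (σ : State) (a b : ℕ) :
      Exec (.store a b) σ (1 + (σ.reg a).size + (σ.reg b).size)
        (σ.setMem (σ.reg a) (σ.reg b))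
  | seq {p q : Prog} {σ₁ σ₂ σ₃ : State} {t₁ t₂ : ℕ} :
      Exec p σ₁ t₁ σ₂ → Exec q σ₂ t₂ σ₃ → Exec (.seq p q) σ₁ (t₁ + t₂) σ₃
  | branchZero {a : ℕ} {p q : Prog} {σ τ : State} {t : ℕ} :
      σ.reg a = 0 → Exec p σ t τ → Exec (.branch a p q) σ (1 + (σ.reg a).size + t) τ
  | branchPos {a : ℕ} {p q : Prog} {σ τ : State} {t : ℕ} :
      σ.reg a ≠ 0 → Exec q σ t τ → Exec (.branch a p q) σ (1 + (σ.reg a).size + t) τ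
  | loopDone {a : ℕ} {p : Prog} {σ : State} :
      σ.reg a = 0 → Exec (.loop a p) σ (1 + (σ.reg a).size) σ
  | loopStep {a : ℕ} {p : Prog} {σ₁ σ₂ σ₃ : State} {t₁ t₂ : ℕ} :
      σ₁.reg a ≠ 0 → Exec p σ₁ t₁ σ₂ → Exec (.loop a p) σ₂ t₂ σ₃ →
        Exec (.loop a p) σ₁ (1 + (σ₁.reg a).size + t₁ + t₂) σ₃

/-- The machine is deterministic, so that its result and its running time are well defined. -/
theorem Exec.deterministic {p : Prog} {σ τ τ' : State} {t t' : ℕ}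
    (h : Exec p σ t τ) (h' : Exec p σ t' τ') : t = t' ∧ τ = τ' := by
  induction h generalizing t' τ' with
  | const | add | sub | mul | load | store => cases h'; exact ⟨rfl, rfl⟩
  | seq _ _ ih₁ ih₂ =>
    cases h' with
    | seq a b =>
      obtain ⟨rfl, rfl⟩ := ih₁ a
      obtain ⟨rfl, rfl⟩ := ih₂ b
      exact ⟨rfl, rfl⟩
  | branchZero h0 _ ih =>
    cases h' with
    | branchZero _ b => obtain ⟨rfl, rfl⟩ := ih b; exact ⟨rfl, rfl⟩
    | branchPos h1 _ => exact absurd h0 h1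
  | branchPos h0 _ ih =>
    cases h' with
    | branchPos _ b => obtain ⟨rfl, rfl⟩ := ih b; exact ⟨rfl, rfl⟩
    | branchZero h1 _ => exact absurd h1 h0
  | loopDone h0 =>
    cases h' with
    | loopDone => exact ⟨rfl, rfl⟩
    | loopStep h1 => exact absurd h0 h1
  | loopStep h0 _ _ ih₁ ih₂ =>
    cases h' with
    | loopDone h1 => exact absurd h1 h0
    | loopStep _ a b =>
      obtain ⟨rfl, rfl⟩ := ih₁ a
      obtain ⟨rfl, rfl⟩ := ih₂ b
      exact ⟨rfl, rfl⟩

/-! ### Solving a problem for two agents in quasilinear time -/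

/-- Position of the entry with index `(i, s)` in a table of `2 k²` entries. -/
def pos {k : ℕ} (i : Fin 2) (s : Profile 2 k) : ℕ :=
  ((i : ℕ) * k + (s 0 : ℕ)) * k + (s 1 : ℕ)

/-- The rational number `num i s / den i s` for every agent `i` and every profile `s`. -/
noncomputable def fractions {k : ℕ} (num den : Fin 2 → Profile 2 k → ℕ) : Family 2 k :=
  fun i s => (num i s : ℝ) / (den i s : ℝ)

/-- The initial state: all registers are `0`; the memory holds `k`, then the numerator and the
denominator of each entry of the input table, then zeros. -/
structure IsInput {k : ℕ} (num den : Fin 2 → Profile 2 k → ℕ) (σ : State) : Prop where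
  reg_eq : ∀ j, σ.reg j = 0
  signals : σ.mem 0 = k
  num_eq : ∀ i s, σ.mem (1 + 2 * pos i s) = num i s
  den_eq : ∀ i s, σ.mem (2 + 2 * pos i s) = den i s
  rest : ∀ j, 4 * k ^ 2 < j → σ.mem j = 0

/-- The memory starts with numerator and denominator of `r`, followed by numerator and
denominator of each entry of the table `x`. -/
structure IsOutput {k : ℕ} (x : Family 2 k) (r : ℝ) (τ : State) : Prop where
  ratio_den : τ.mem 1 ≠ 0
  ratio_eq : r = (τ.mem 0 : ℝ) / (τ.mem 1 : ℝ)
  rule_den : ∀ (i : Fin 2) (s : Profile 2 k), τ.mem (3 + 2 * pos i s) ≠ 0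
  rule_eq : ∀ (i : Fin 2) (s : Profile 2 k), x i s = (τ.mem (2 + 2 * pos i s) : ℝ) / (τ.mem (3 + 2 * pos i s) : ℝ)

/-- One fixed program outputs, for every number `k ≥ 1` of signals and every table of positive
rational numbers given by fractions of at most `b` bits each, a rule `x` and a ratio `r` that
solve the problem `P`, in time `O(N log N)` where `N = n kⁿ b` with `n = 2`. -/
def SolvableInQuasilinearTime
    (P : ∀ {k : ℕ}, Family 2 k → Family 2 k → ℝ → Prop) : Prop :=
  ∃ (p : Prog) (C : ℝ), ∀ (k b : ℕ) (num den : Fin 2 → Profile 2 k → ℕ), 1 ≤ k →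
    (∀ i s, 0 < num i s) → (∀ i s, 0 < den i s) →
    (∀ i s, (num i s).size + (den i s).size ≤ b) →
    ∀ σ, IsInput num den σ →
      ∃ (t : ℕ) (τ : State) (x : Family 2 k) (r : ℝ),
        Exec p σ t τ ∧
        (t : ℝ) ≤ C * ((2 * k ^ 2 * b : ℕ) : ℝ) * Real.log ((2 * k ^ 2 * b : ℕ) : ℝ) ∧
        IsOutput x r τ ∧ P (fractions num den) x r

end TwoAgents

/-!
# Optimal truthful rules for two agents

Since `x₂ = 1 - x₁`, truthfulness says that `x₁` does not decrease along the arcs of the constraint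
digraph. Write `loss v i s = 1 / ρ_i(s) ≥ 1`; at each profile one of the two losses is `1`. If `s'`
is reachable from `s`, then `x₁ s ≤ x₁ s'`, and this alone forces the ratio at `s` or at `s'` to be
at least a conflict value `g (loss v 1 s) (loss v 0 s')`, where `g` depends on the problem. This
bound is tight: let the label of `s` be a profile of maximal loss of agent 2 among those from which
`s` is reachable (`IsLabel`), let `r` be the largest conflict value of a label with its profile, and
let `x₁ s` be the least probability of agent 1 that keeps the ratio at the label at most `r`. Labels
have monotone losses along arcs, whence truthfulness, and no ratio exceeds `r`
(`Variant.optimal`). The formulas for the optimal ratios follow with any choice of labels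
(`optimal_ratios`).

The program computes such labels. The digraph has up to `k³` arcs, but it is given by the `2 k`
lines of the table, in which arcs lead to larger keys. Each line is sorted by keys, and the profiles
are sorted by the loss of agent 2. A depth-first search with the profiles as sources, in the order of
decreasing loss, gives every profile the first source that reaches it. The top of the stack looks
only at the heads of its two lines, and a head that it reaches is removed from its list for good;
so the search makes `O(k²)` steps (`Lines.searchCmd_spec`).

In the logarithmic cost model, sorting is the bottleneck. With `w = O(b + log k)` bits for all
numbers, `k² log k` comparisons would cost `k² log k (b + log k)`, which is too much for small `b`.
However, fractions of `b` bits take only `2 ^ O(b)` values: the merge sort joins nodes with equal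
keys into classes that are moved as a whole, so that a run never has more classes than there are
keys, and the sorting takes `O(k² min (log k, b))` steps (`sortCmd_spec`). Now
`min (log k, b) (b + log k) = O(b log k)`, whence the total time `O(N log N)` (`solvable_of_wp`).

Programs are written in a small language with variables and arrays (`Cmd`). It is compiled to the
random access machine with a constant number of instructions for each step (`Run.takes_code`), and
its programs are verified with weakest preconditions that keep account of time credits (`wp`). The
numbers that occur are bounded by a fixed power of `64 * 2 ^ b * (k + 1)`, and the exponent is read
off from the text of the program (`Cmd.ok`).
-/

namespace TwoAgents

/-! ### A small imperative language with arrays -/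

/-- Expressions over variables and arrays of natural numbers. -/
inductive Ex where
  | num (c : ℕ)
  | var (x : ℕ)
  | add (e f : Ex)
  | sub (e f : Ex)
  | mul (e f : Ex)
  /-- the entry of the array `j` at the index `e` -/
  | get (j : ℕ) (e : Ex)

/-- States of the language: variables, infinite arrays, and the part `io` of the machine memory in
which the input is found and the output is left. -/
structure Store where
  var : ℕ → ℕ
  arr : ℕ → ℕ → ℕ
  io : ℕ → ℕ

def Store.setVar (σ : Store) (x v : ℕ) : Store :=
  { σ with var := Function.update σ.var x v }

def Store.setArr (σ : Store) (j i v : ℕ) : Store :=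
  { σ with arr := Function.update σ.arr j (Function.update (σ.arr j) i v) }

def Store.setIo (σ : Store) (i v : ℕ) : Store :=
  { σ with io := Function.update σ.io i v }

def Ex.eval (σ : Store) : Ex → ℕ
  | num c => c
  | var x => σ.var x
  | add e f => e.eval σ + f.eval σ
  | sub e f => e.eval σ - f.eval σ
  | mul e f => e.eval σ * f.eval σ
  | get j e => σ.arr j (e.eval σ)

/-- Commands. -/
inductive Cmd where
  /-- assignment to a variable -/
  | set (x : ℕ) (e : Ex)
  /-- `put j e f` assigns `f` to the entry of the array `j` at the index `e` -/
  | put (j : ℕ) (e f : Ex)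
  /-- `inp x e` reads the cell `e` of the input into the variable `x` -/
  | inp (x : ℕ) (e : Ex)
  /-- `out e f` writes `f` to the cell `e` of the output -/
  | out (e f : Ex)
  | seq (p q : Cmd)
  /-- `p` if `e ≠ 0`, and `q` otherwise -/
  | ite (e : Ex) (p q : Cmd)
  /-- repeat `p` as long as `e ≠ 0` -/
  | loop (e : Ex) (p : Cmd)

infixr:60 " ;; " => Cmd.seq

/-- `Run lim bd c σ n τ`: the command `c` leads from `σ` to `τ` in `n` steps, where assignments
and tests count as one step each. The addresses used for input and output lie below `lim`, and
the numbers read are at most `bd`. -/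
inductive Run (lim bd : ℕ) : Cmd → Store → ℕ → Store → Prop
  | set (σ : Store) (x : ℕ) (e : Ex) : Run lim bd (.set x e) σ 1 (σ.setVar x (e.eval σ))
  | put (σ : Store) (j : ℕ) (e f : Ex) :
      Run lim bd (.put j e f) σ 1 (σ.setArr j (e.eval σ) (f.eval σ))
  | inp {σ : Store} {x : ℕ} {e : Ex} : e.eval σ < lim → σ.io (e.eval σ) ≤ bd →
      Run lim bd (.inp x e) σ 1 (σ.setVar x (σ.io (e.eval σ)))
  | out {σ : Store} {e f : Ex} : e.eval σ < lim →
      Run lim bd (.out e f) σ 1 (σ.setIo (e.eval σ) (f.eval σ))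
  | seq {p q : Cmd} {σ₁ σ₂ σ₃ : Store} {m n : ℕ} :
      Run lim bd p σ₁ m σ₂ → Run lim bd q σ₂ n σ₃ → Run lim bd (.seq p q) σ₁ (m + n) σ₃
  | iteTrue {e : Ex} {p q : Cmd} {σ τ : Store} {n : ℕ} :
      e.eval σ ≠ 0 → Run lim bd p σ n τ → Run lim bd (.ite e p q) σ (1 + n) τ
  | iteFalse {e : Ex} {p q : Cmd} {σ τ : Store} {n : ℕ} :
      e.eval σ = 0 → Run lim bd q σ n τ → Run lim bd (.ite e p q) σ (1 + n) τ
  | loopDone {e : Ex} {p : Cmd} {σ : Store} : e.eval σ = 0 → Run lim bd (.loop e p) σ 1 σ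
  | loopStep {e : Ex} {p : Cmd} {σ₁ σ₂ σ₃ : Store} {m n : ℕ} :
      e.eval σ₁ ≠ 0 → Run lim bd p σ₁ m σ₂ → Run lim bd (.loop e p) σ₂ n σ₃ →
        Run lim bd (.loop e p) σ₁ (1 + m + n) σ₃

/-! ### Weakest preconditions with time credits -/

/-- Started in `σ` with `n` time credits, the command `c` halts in a state `τ` with `m` credits
left such that `Q τ m`. -/
def wp (lim bd : ℕ) (c : Cmd) (Q : Store → ℕ → Prop) (σ : Store) (n : ℕ) : Prop :=
  ∃ m τ, Run lim bd c σ m τ ∧ m ≤ n ∧ Q τ (n - m)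

def Cmd.writesVar (x : ℕ) : Cmd → Bool
  | set y _ => y == x
  | put _ _ _ => false
  | inp y _ => y == x
  | out _ _ => false
  | seq p q => p.writesVar x || q.writesVar x
  | ite _ p q => p.writesVar x || q.writesVar x
  | loop _ p => p.writesVar x

def Cmd.writesArr (j : ℕ) : Cmd → Bool
  | set _ _ => false
  | put i _ _ => i == j
  | inp _ _ => false
  | out _ _ => false
  | seq p q => p.writesArr j || q.writesArr j
  | ite _ p q => p.writesArr j || q.writesArr j
  | loop _ p => p.writesArr j

def Cmd.writesIo : Cmd → Bool
  | set _ _ => false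
  | put _ _ _ => false
  | inp _ _ => false
  | out _ _ => true
  | seq p q => p.writesIo || q.writesIo
  | ite _ p q => p.writesIo || q.writesIo
  | loop _ p => p.writesIo

/-- `σ` and `τ` agree on everything that the text of the command `c` does not assign to. -/
structure Frame (c : Cmd) (σ τ : Store) : Prop where
  var : ∀ x, c.writesVar x = false → τ.var x = σ.var x
  arr : ∀ j, c.writesArr j = false → τ.arr j = σ.arr j
  io : c.writesIo = false → τ.io = σ.io

theorem Frame.refl (c : Cmd) (σ : Store) : Frame c σ σ :=
  ⟨fun _ _ => rfl, fun _ _ => rfl, fun _ => rfl⟩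

theorem Frame.trans {c : Cmd} {σ τ υ : Store} (h : Frame c σ τ) (h' : Frame c τ υ) : Frame c σ υ :=
  ⟨fun x hx => (h'.var x hx).trans (h.var x hx), fun j hj => (h'.arr j hj).trans (h.arr j hj),
    fun hi => (h'.io hi).trans (h.io hi)⟩

theorem Run.frame {lim bd : ℕ} {c : Cmd} {σ τ : Store} {n : ℕ} (h : Run lim bd c σ n τ) :
    Frame c σ τ := by
  induction h with
  | set σ x e =>
    refine ⟨fun y hy => ?_, fun _ _ => rfl, fun _ => rfl⟩
    have : y ≠ x := by rintro rfl; simp [Cmd.writesVar] at hy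
    simp [Store.setVar, this]
  | put σ j e f =>
    refine ⟨fun _ _ => rfl, fun i hi => ?_, fun _ => rfl⟩
    have : i ≠ j := by rintro rfl; simp [Cmd.writesArr] at hi
    simp [Store.setArr, this]
  | @inp σ x e _ _ =>
    refine ⟨fun y hy => ?_, fun _ _ => rfl, fun _ => rfl⟩
    have : y ≠ x := by rintro rfl; simp [Cmd.writesVar] at hy
    simp [Store.setVar, this]
  | out _ => exact ⟨fun _ _ => rfl, fun _ _ => rfl, fun hi => by simp [Cmd.writesIo] at hi⟩
  | seq _ _ h₁ h₂ =>
    refine ⟨fun x hx => ?_, fun j hj => ?_, fun hi => ?_⟩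
    · simp only [Cmd.writesVar, Bool.or_eq_false_iff] at hx
      exact (h₂.var x hx.2).trans (h₁.var x hx.1)
    · simp only [Cmd.writesArr, Bool.or_eq_false_iff] at hj
      exact (h₂.arr j hj.2).trans (h₁.arr j hj.1)
    · simp only [Cmd.writesIo, Bool.or_eq_false_iff] at hi
      exact (h₂.io hi.2).trans (h₁.io hi.1)
  | iteTrue _ _ h =>
    refine ⟨fun x hx => ?_, fun j hj => ?_, fun hi => ?_⟩
    · simp only [Cmd.writesVar, Bool.or_eq_false_iff] at hx
      exact h.var x hx.1
    · simp only [Cmd.writesArr, Bool.or_eq_false_iff] at hj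
      exact h.arr j hj.1
    · simp only [Cmd.writesIo, Bool.or_eq_false_iff] at hi
      exact h.io hi.1
  | iteFalse _ _ h =>
    refine ⟨fun x hx => ?_, fun j hj => ?_, fun hi => ?_⟩
    · simp only [Cmd.writesVar, Bool.or_eq_false_iff] at hx
      exact h.var x hx.2
    · simp only [Cmd.writesArr, Bool.or_eq_false_iff] at hj
      exact h.arr j hj.2
    · simp only [Cmd.writesIo, Bool.or_eq_false_iff] at hi
      exact h.io hi.2
  | loopDone _ => exact Frame.refl _ _
  | loopStep _ _ _ h₁ h₂ => exact Frame.trans (c := .loop _ _) ⟨h₁.var, h₁.arr, h₁.io⟩ h₂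

section wp

variable {lim bd : ℕ} {p q : Cmd} {Q Q' : Store → ℕ → Prop} {σ : Store} {n : ℕ}

theorem wp_set {x : ℕ} {e : Ex} :
    wp lim bd (.set x e) Q σ n ↔ 1 ≤ n ∧ Q (σ.setVar x (e.eval σ)) (n - 1) := by
  constructor
  · rintro ⟨m, τ, h, hm, hQ⟩
    cases h
    exact ⟨hm, hQ⟩
  · rintro ⟨hm, hQ⟩
    exact ⟨1, _, .set _ _ _, hm, hQ⟩

theorem wp_put {j : ℕ} {e f : Ex} :
    wp lim bd (.put j e f) Q σ n ↔ 1 ≤ n ∧ Q (σ.setArr j (e.eval σ) (f.eval σ)) (n - 1) := by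
  constructor
  · rintro ⟨m, τ, h, hm, hQ⟩
    cases h
    exact ⟨hm, hQ⟩
  · rintro ⟨hm, hQ⟩
    exact ⟨1, _, .put _ _ _ _, hm, hQ⟩

theorem wp_inp {x : ℕ} {e : Ex} :
    wp lim bd (.inp x e) Q σ n ↔ e.eval σ < lim ∧ σ.io (e.eval σ) ≤ bd ∧
      1 ≤ n ∧ Q (σ.setVar x (σ.io (e.eval σ))) (n - 1) := by
  constructor
  · rintro ⟨m, τ, h, hm, hQ⟩
    cases h with
    | inp h₁ h₂ => exact ⟨h₁, h₂, hm, hQ⟩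
  · rintro ⟨h₁, h₂, hm, hQ⟩
    exact ⟨1, _, .inp h₁ h₂, hm, hQ⟩

theorem wp_out {e f : Ex} :
    wp lim bd (.out e f) Q σ n ↔ e.eval σ < lim ∧
      1 ≤ n ∧ Q (σ.setIo (e.eval σ) (f.eval σ)) (n - 1) := by
  constructor
  · rintro ⟨m, τ, h, hm, hQ⟩
    cases h with
    | out h₁ => exact ⟨h₁, hm, hQ⟩
  · rintro ⟨h₁, hm, hQ⟩
    exact ⟨1, _, .out h₁, hm, hQ⟩

theorem wp_seq : wp lim bd (p ;; q) Q σ n ↔ wp lim bd p (wp lim bd q Q) σ n := by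
  constructor
  · rintro ⟨m, τ, h, hm, hQ⟩
    cases h with
    | @seq _ _ _ _ _ m₁ m₂ h₁ h₂ =>
      exact ⟨_, _, h₁, by omega, _, _, h₂, by omega, by rwa [Nat.sub_sub]⟩
  · rintro ⟨m₁, _, h₁, hm₁, m₂, _, h₂, hm₂, hQ⟩
    exact ⟨_, _, .seq h₁ h₂, by omega, by rwa [← Nat.sub_sub]⟩

theorem wp_ite {e : Ex} :
    wp lim bd (.ite e p q) Q σ n ↔ 1 ≤ n ∧ (e.eval σ ≠ 0 → wp lim bd p Q σ (n - 1)) ∧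
      (e.eval σ = 0 → wp lim bd q Q σ (n - 1)) := by
  constructor
  · rintro ⟨m, τ, h, hm, hQ⟩
    cases h with
    | iteTrue h₀ h₁ =>
      exact ⟨by omega, fun _ => ⟨_, _, h₁, by omega, by rwa [Nat.sub_sub]⟩, fun h => absurd h h₀⟩
    | iteFalse h₀ h₁ =>
      exact ⟨by omega, fun h => absurd h₀ h, fun _ => ⟨_, _, h₁, by omega, by rwa [Nat.sub_sub]⟩⟩
  · rintro ⟨hn, h₁, h₂⟩
    by_cases h : e.eval σ = 0
    · obtain ⟨m, τ, hr, hm, hQ⟩ := h₂ h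
      exact ⟨_, _, .iteFalse h hr, by omega, by rwa [← Nat.sub_sub]⟩
    · obtain ⟨m, τ, hr, hm, hQ⟩ := h₁ h
      exact ⟨_, _, .iteTrue h hr, by omega, by rwa [← Nat.sub_sub]⟩

/-- Consequence rule; the state after the execution agrees with the state before it where the
command has no assignments. -/
theorem wp.mono (h : wp lim bd p Q σ n) (hQ : ∀ τ m, m ≤ n → Frame p σ τ → Q τ m → Q' τ m) :
    wp lim bd p Q' σ n := by
  obtain ⟨m, τ, hr, hm, h⟩ := h
  exact ⟨m, τ, hr, hm, hQ _ _ (Nat.sub_le _ _) hr.frame h⟩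

/-- Loop rule: since every test uses up a credit, an invariant that speaks of the credits left
gives termination and running time. -/
theorem wp_loop {e : Ex} (I : Store → ℕ → Prop) (h₀ : I σ n)
    (step : ∀ τ m, I τ m → Frame p σ τ → 1 ≤ m ∧ (e.eval τ = 0 → Q τ (m - 1)) ∧
      (e.eval τ ≠ 0 → wp lim bd p I τ (m - 1))) :
    wp lim bd (.loop e p) Q σ n := by
  have key : ∀ N n τ, n ≤ N → I τ n → Frame p σ τ → wp lim bd (.loop e p) Q τ n := by
    intro N
    induction N with
    | zero => intro n τ hn hI hF; have := (step τ n hI hF).1; omega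
    | succ N ih =>
      intro n τ hn hI hF
      obtain ⟨h1, h2, h3⟩ := step τ n hI hF
      by_cases h : e.eval τ = 0
      · exact ⟨1, τ, .loopDone h, h1, h2 h⟩
      · obtain ⟨m, υ, hr, hm, hI'⟩ := h3 h
        obtain ⟨m', ω, hr', hm', hQ⟩ := ih _ υ (by omega) hI' (hF.trans hr.frame)
        refine ⟨_, ω, .loopStep h hr hr', by omega, ?_⟩
        rwa [Nat.sub_sub, Nat.sub_sub, ← add_assoc] at hQ
  exact key n n σ le_rfl h₀ (Frame.refl _ _)

end wp

/-! ### Static bounds for the numbers that a command handles -/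

/-- If every variable `x` is at most `B ^ dv x`, and every entry of every array `j` is at most
`B ^ da j`, then the value of `e` is at most `B ^ e.deg dv da`. -/
def Ex.deg (dv da : ℕ → ℕ) : Ex → ℕ
  | num _ => 1
  | var x => dv x
  | add e f => max (e.deg dv da) (f.deg dv da) + 1
  | sub e _ => e.deg dv da
  | mul e f => e.deg dv da + f.deg dv da
  | get j _ => da j

/-- The constants, variables and arrays of `e` are in the range that the compiler supports, and
all numbers that occur in its evaluation have degree at most `D`. -/
def Ex.ok (dv da : ℕ → ℕ) (D : ℕ) : Ex → Bool
  | num c => c ≤ 64 && 1 ≤ D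
  | var x => x < 32 && dv x ≤ D
  | add e f => e.ok dv da D && f.ok dv da D && (Ex.add e f).deg dv da ≤ D
  | sub e f => e.ok dv da D && f.ok dv da D
  | mul e f => e.ok dv da D && f.ok dv da D && (Ex.mul e f).deg dv da ≤ D
  | get j e => e.ok dv da D && j < 32 && e.deg dv da + 6 ≤ D && da j ≤ D

/-- The number of machine instructions in the code for `e`. -/
def Ex.ops : Ex → ℕ
  | num _ => 1
  | var _ => 2
  | add e f => e.ops + f.ops + 1
  | sub e f => e.ops + f.ops + 1
  | mul e f => e.ops + f.ops + 1
  | get _ e => e.ops + 6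

/-- The command is in the range that the compiler supports, it keeps the variables and arrays
below the bounds given by `dv` and `da`, and each of its steps needs at most `K` machine
instructions on numbers of degree at most `D`. -/
def Cmd.ok (dv da : ℕ → ℕ) (D K : ℕ) : Cmd → Bool
  | set x e => e.ok dv da D && x < 32 && e.deg dv da ≤ dv x && e.ops + 3 ≤ K
  | put j e f => e.ok dv da D && f.ok dv da D && j < 32 && e.deg dv da + 6 ≤ D &&
      f.deg dv da ≤ da j && e.ops + f.ops + 6 ≤ K
  | inp x e => e.ok dv da D && x < 32 && 1 ≤ dv x && dv x ≤ D && e.ops + 1 ≤ K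
  | out e f => e.ok dv da D && f.ok dv da D && e.ops + f.ops + 1 ≤ K
  | seq p q => p.ok dv da D K && q.ok dv da D K
  | ite e p q => e.ok dv da D && p.ok dv da D K && q.ok dv da D K && e.ops + 1 ≤ K
  | loop e p => e.ok dv da D && p.ok dv da D K && e.ops + 1 ≤ K

structure Store.Bounded (dv da : ℕ → ℕ) (B : ℕ) (σ : Store) : Prop where
  var : ∀ x, σ.var x ≤ B ^ dv x
  arr : ∀ j i, σ.arr j i ≤ B ^ da j

theorem Ex.eval_le {dv da : ℕ → ℕ} {B D : ℕ} (hB : 64 ≤ B) {σ : Store} (hσ : σ.Bounded dv da B) :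
    ∀ {e : Ex}, e.ok dv da D → e.eval σ ≤ B ^ e.deg dv da
  | num c, h => by
    simp only [Ex.ok, Bool.and_eq_true, decide_eq_true_eq] at h
    simpa [Ex.deg, Ex.eval] using h.1.trans hB
  | var x, _ => hσ.var x
  | add e f, h => by
    simp only [Ex.ok, Bool.and_eq_true] at h
    have he := Ex.eval_le hB hσ h.1.1
    have hf := Ex.eval_le hB hσ h.1.2
    have h1 : B ^ e.deg dv da ≤ B ^ max (e.deg dv da) (f.deg dv da) :=
      Nat.pow_le_pow_right (by omega) (le_max_left _ _)
    have h2 : B ^ f.deg dv da ≤ B ^ max (e.deg dv da) (f.deg dv da) :=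
      Nat.pow_le_pow_right (by omega) (le_max_right _ _)
    simp only [Ex.deg, Ex.eval, pow_succ]
    nlinarith
  | sub e f, h => by
    simp only [Ex.ok, Bool.and_eq_true] at h
    exact (Nat.sub_le _ _).trans (Ex.eval_le hB hσ h.1)
  | mul e f, h => by
    simp only [Ex.ok, Bool.and_eq_true] at h
    simp only [Ex.deg, Ex.eval, pow_add]
    exact Nat.mul_le_mul (Ex.eval_le hB hσ h.1.1) (Ex.eval_le hB hσ h.1.2)
  | get j e, _ => hσ.arr j _

theorem Ex.deg_le {dv da : ℕ → ℕ} {D : ℕ} : ∀ {e : Ex}, e.ok dv da D → e.deg dv da ≤ D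
  | num c, h => by simp only [Ex.ok, Bool.and_eq_true, decide_eq_true_eq] at h; exact h.2
  | var x, h => by simp only [Ex.ok, Bool.and_eq_true, decide_eq_true_eq] at h; exact h.2
  | add e f, h => by simp only [Ex.ok, Bool.and_eq_true, decide_eq_true_eq] at h; exact h.2
  | sub e f, h => by simp only [Ex.ok, Bool.and_eq_true] at h; exact Ex.deg_le (e := e) h.1
  | mul e f, h => by simp only [Ex.ok, Bool.and_eq_true, decide_eq_true_eq] at h; exact h.2
  | get j e, h => by simp only [Ex.ok, Bool.and_eq_true, decide_eq_true_eq] at h; exact h.2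

theorem Store.Bounded.setVar {dv da : ℕ → ℕ} {B : ℕ} {σ : Store} (hσ : σ.Bounded dv da B)
    {x v : ℕ} (hv : v ≤ B ^ dv x) : (σ.setVar x v).Bounded dv da B := by
  refine ⟨fun y => ?_, hσ.arr⟩
  simp only [Store.setVar, Function.update_apply]
  split_ifs with h
  · exact h ▸ hv
  · exact hσ.var y

theorem Store.Bounded.setArr {dv da : ℕ → ℕ} {B : ℕ} {σ : Store} (hσ : σ.Bounded dv da B)
    {j i v : ℕ} (hv : v ≤ B ^ da j) : (σ.setArr j i v).Bounded dv da B := by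
  refine ⟨hσ.var, fun l m => ?_⟩
  simp only [Store.setArr, Function.update_apply]
  split_ifs with h
  · subst h
    rw [Function.update_apply]
    split_ifs
    · exact hv
    · exact hσ.arr _ m
  · exact hσ.arr l m

theorem Run.bounded {lim bd : ℕ} {dv da : ℕ → ℕ} {B D K : ℕ} (hB : 64 ≤ B) (hbd : bd ≤ B)
    {c : Cmd} {σ τ : Store} {n : ℕ} (h : Run lim bd c σ n τ) (hc : c.ok dv da D K)
    (hσ : σ.Bounded dv da B) : τ.Bounded dv da B := by
  have hpow : ∀ {a b : ℕ}, a ≤ b → B ^ a ≤ B ^ b := fun h => Nat.pow_le_pow_right (by omega) h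
  induction h with
  | set σ x e =>
    simp only [Cmd.ok, Bool.and_eq_true, decide_eq_true_eq] at hc
    exact hσ.setVar ((Ex.eval_le hB hσ hc.1.1.1).trans (hpow hc.1.2))
  | put σ j e f =>
    simp only [Cmd.ok, Bool.and_eq_true, decide_eq_true_eq] at hc
    exact hσ.setArr ((Ex.eval_le hB hσ hc.1.1.1.1.2).trans (hpow hc.1.2))
  | inp h₁ h₂ =>
    simp only [Cmd.ok, Bool.and_eq_true, decide_eq_true_eq] at hc
    exact hσ.setVar ((h₂.trans hbd).trans (by simpa using hpow hc.1.1.2))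
  | out _ => exact ⟨hσ.var, hσ.arr⟩
  | seq _ _ h₁ h₂ =>
    simp only [Cmd.ok, Bool.and_eq_true] at hc
    exact h₂ hc.2 (h₁ hc.1 hσ)
  | iteTrue _ _ h =>
    simp only [Cmd.ok, Bool.and_eq_true] at hc
    exact h hc.1.1.2 hσ
  | iteFalse _ _ h =>
    simp only [Cmd.ok, Bool.and_eq_true] at hc
    exact h hc.1.2 hσ
  | loopDone _ => exact hσ
  | loopStep _ _ _ h₁ h₂ =>
    have hc' := hc
    simp only [Cmd.ok, Bool.and_eq_true] at hc'
    exact h₂ hc (h₁ hc'.1.2 hσ)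

/-! ### Compilation to the random access machine -/

/-- `p` leads from `σ` to `τ` in time at most that of `N` instructions on operands of `w` bits. -/
def Takes (w : ℕ) (p : Prog) (σ : State) (N : ℕ) (τ : State) : Prop :=
  ∃ t, Exec p σ t τ ∧ t ≤ N * (1 + 2 * w)

section Takes

variable {w : ℕ} {p q : Prog} {σ τ υ : State} {M N : ℕ}

theorem Takes.mono (h : Takes w p σ M τ) (hMN : M ≤ N) : Takes w p σ N τ := by
  obtain ⟨t, ht, hle⟩ := h
  exact ⟨t, ht, hle.trans (Nat.mul_le_mul_right _ hMN)⟩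

theorem Takes.seq (h : Takes w p σ M τ) (h' : Takes w q τ N υ) :
    Takes w (.seq p q) σ (M + N) υ := by
  obtain ⟨t, ht, hle⟩ := h
  obtain ⟨t', ht', hle'⟩ := h'
  exact ⟨_, .seq ht ht', by rw [add_mul]; omega⟩

theorem takes_const {d c : ℕ} (hc : c.size ≤ w) : Takes w (.const d c) σ 1 (σ.setReg d c) :=
  ⟨_, .const _ _ _, by omega⟩

theorem takes_add {d a b : ℕ} (ha : (σ.reg a).size ≤ w) (hb : (σ.reg b).size ≤ w) :
    Takes w (.add d a b) σ 1 (σ.setReg d (σ.reg a + σ.reg b)) :=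
  ⟨_, .add _ _ _ _, by omega⟩

theorem takes_sub {d a b : ℕ} (ha : (σ.reg a).size ≤ w) (hb : (σ.reg b).size ≤ w) :
    Takes w (.sub d a b) σ 1 (σ.setReg d (σ.reg a - σ.reg b)) :=
  ⟨_, .sub _ _ _ _, by omega⟩

theorem takes_mul {d a b : ℕ} (ha : (σ.reg a).size ≤ w) (hb : (σ.reg b).size ≤ w) :
    Takes w (.mul d a b) σ 1 (σ.setReg d (σ.reg a * σ.reg b)) :=
  ⟨_, .mul _ _ _ _, by omega⟩

theorem takes_load {d a : ℕ} (ha : (σ.reg a).size ≤ w) (hb : (σ.mem (σ.reg a)).size ≤ w) :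
    Takes w (.load d a) σ 1 (σ.setReg d (σ.mem (σ.reg a))) :=
  ⟨_, .load _ _ _, by omega⟩

theorem takes_store {a b : ℕ} (ha : (σ.reg a).size ≤ w) (hb : (σ.reg b).size ≤ w) :
    Takes w (.store a b) σ 1 (σ.setMem (σ.reg a) (σ.reg b)) :=
  ⟨_, .store _ _ _, by omega⟩

end Takes

/-- Turns an index of the array `j`, held in register `d`, into the address of the entry. Register
`32` holds the number of memory cells in front of the arrays. -/
def addrCode (j d : ℕ) : Prog :=
  .seq (.const (d + 1) 32) <| .seq (.mul d d (d + 1)) <| .seq (.const (d + 1) j) <|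
    .seq (.add d d (d + 1)) (.add d d 32)

/-- Code that leaves the value of the expression in register `d`. -/
def Ex.code : Ex → ℕ → Prog
  | num c, d => .const d c
  | var x, d => .seq (.const d 0) (.add d d x)
  | add e f, d => .seq (e.code d) (.seq (f.code (d + 1)) (.add d d (d + 1)))
  | sub e f, d => .seq (e.code d) (.seq (f.code (d + 1)) (.sub d d (d + 1)))
  | mul e f, d => .seq (e.code d) (.seq (f.code (d + 1)) (.mul d d (d + 1)))
  | get j e, d => .seq (e.code d) (.seq (addrCode j d) (.load d d))

/-- Variable `x` lives in register `x < 32`; the registers from `33` on are scratch space. -/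
def Cmd.code : Cmd → Prog
  | set x e => .seq (e.code 33) (.seq (.const x 0) (.add x x 33))
  | put j e f => .seq (e.code 33) (.seq (addrCode j 33) (.seq (f.code 34) (.store 33 34)))
  | inp x e => .seq (e.code 33) (.load x 33)
  | out e f => .seq (e.code 33) (.seq (f.code 34) (.store 33 34))
  | seq p q => .seq p.code q.code
  | ite e p q => .seq (e.code 33) (.branch 33 q.code p.code)
  | loop e p => .seq (e.code 33) (.loop 33 (.seq p.code (e.code 33)))

/-- The machine state `ρ` represents `σ`: the cells below `lim` hold `σ.io`, and the arrays, of
which there are at most `32`, are interleaved in the cells from `lim` on. -/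
structure Represents (lim : ℕ) (σ : Store) (ρ : State) : Prop where
  var : ∀ x < 32, ρ.reg x = σ.var x
  lim_eq : ρ.reg 32 = lim
  arr : ∀ j < 32, ∀ i, ρ.mem (lim + 32 * i + j) = σ.arr j i
  io : ∀ a < lim, ρ.mem a = σ.io a

/-- `ρ'` differs from `ρ` at most in the registers from `d` on. -/
structure SameBelow (d : ℕ) (ρ ρ' : State) : Prop where
  reg : ∀ r < d, ρ'.reg r = ρ.reg r
  mem : ρ'.mem = ρ.mem

theorem SameBelow.trans {d : ℕ} {ρ ρ' ρ'' : State} (h : SameBelow d ρ ρ')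
    (h' : SameBelow d ρ' ρ'') : SameBelow d ρ ρ'' :=
  ⟨fun r hr => (h'.reg r hr).trans (h.reg r hr), h'.mem.trans h.mem⟩

theorem SameBelow.mono {d d' : ℕ} {ρ ρ' : State} (h : SameBelow d ρ ρ') (hd : d' ≤ d) :
    SameBelow d' ρ ρ' :=
  ⟨fun r hr => h.reg r (by omega), h.mem⟩

theorem SameBelow.setReg {d d' : ℕ} {ρ ρ' : State} (h : SameBelow d ρ ρ') (hd : d ≤ d') (v : ℕ) :
    SameBelow d ρ (ρ'.setReg d' v) := by
  refine ⟨fun r hr => ?_, h.mem⟩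
  have : r ≠ d' := by omega
  simpa [State.setReg, this] using h.reg r hr

theorem SameBelow.represents {lim d : ℕ} {σ : Store} {ρ ρ' : State} (h : SameBelow d ρ ρ')
    (hd : 33 ≤ d) (hr : Represents lim σ ρ) : Represents lim σ ρ' :=
  ⟨fun x hx => (h.reg x (by omega)).trans (hr.var x hx),
    (h.reg 32 (by omega)).trans hr.lim_eq,
    fun j hj i => by rw [h.mem]; exact hr.arr j hj i, fun a ha => by rw [h.mem]; exact hr.io a ha⟩

theorem SameBelow.refl (d : ℕ) (ρ : State) : SameBelow d ρ ρ := ⟨fun _ _ => rfl, rfl⟩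

section simulation

variable {lim B D : ℕ} {dv da : ℕ → ℕ}

theorem addr_le {j i n : ℕ} (hB : 64 ≤ B) (hlim : lim ≤ B ^ 4) (hj : j < 32) (hi : i ≤ B ^ n)
    (hn : n + 6 ≤ D) : lim + 32 * i + j ≤ B ^ D := by
  have h1 : B ^ (n + 6) ≤ B ^ D := Nat.pow_le_pow_right (by omega) hn
  have h2 : B ^ (n + 6) = B ^ n * B ^ 4 * (B * B) := by ring
  have h3 : 1 ≤ B ^ n := Nat.one_le_pow _ _ (by omega)
  have h4 : 1 ≤ B ^ 4 := Nat.one_le_pow _ _ (by omega)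
  have h5 : 4096 ≤ B * B := by nlinarith
  have h6 : B ^ 4 ≤ B ^ n * B ^ 4 := Nat.le_mul_of_pos_left _ h3
  have h7 : B ^ n ≤ B ^ n * B ^ 4 := Nat.le_mul_of_pos_right _ h4
  have h8 : B ^ n * B ^ 4 * 4096 ≤ B ^ n * B ^ 4 * (B * B) := Nat.mul_le_mul_left _ h5
  omega

theorem takes_addrCode {w j d i n : ℕ} {ρ : State} (hw : (B ^ D).size ≤ w) (hB : 64 ≤ B)
    (hlim : lim ≤ B ^ 4) (hj : j < 32) (hi : i ≤ B ^ n) (hn : n + 6 ≤ D) (hd : 33 ≤ d)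
    (h32 : ρ.reg 32 = lim) (hρ : ρ.reg d = i) :
    ∃ ρ', Takes w (addrCode j d) ρ 5 ρ' ∧ SameBelow d ρ ρ' ∧ ρ'.reg d = lim + 32 * i + j := by
  have hsz : ∀ {x : ℕ}, x ≤ lim + 32 * i + j → x.size ≤ w := fun h =>
    (Nat.size_le_size (h.trans (addr_le hB hlim hj hi hn))).trans hw
  have hB1 : B ≤ B ^ D := Nat.le_self_pow (by omega) B
  have hsz' : ∀ {x : ℕ}, x ≤ 64 → x.size ≤ w := fun h =>
    (Nat.size_le_size ((h.trans hB).trans hB1)).trans hw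
  have e1 : d ≠ d + 1 := by omega
  have e2 : 32 ≠ d := by omega
  have e3 : 32 ≠ d + 1 := by omega
  refine ⟨_, Takes.seq (takes_const (hsz' (by omega))) <| Takes.seq (takes_mul ?_ ?_) <|
    Takes.seq (takes_const (hsz' (by omega))) <| Takes.seq (takes_add ?_ ?_) (takes_add ?_ ?_),
    ?_, ?_⟩
  · apply hsz; simp [State.setReg, hρ]; omega
  · apply hsz'; simp [State.setReg]
  · apply hsz; simp [State.setReg, hρ]; omega
  · apply hsz; simp [State.setReg]
  · apply hsz; simp [State.setReg, hρ]; omega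
  · apply hsz; simp [State.setReg, e2, e3, h32]; omega
  · exact (((((SameBelow.refl d ρ).setReg (by omega) _).setReg le_rfl _).setReg (by omega) _).setReg
      le_rfl _).setReg le_rfl _
  · simp [State.setReg, e2, e3, hρ, h32]; ring

theorem Ex.takes_code {w : ℕ} (hw : (B ^ D).size ≤ w) (hB : 64 ≤ B) (hlim : lim ≤ B ^ 4)
    {σ : Store} (hσ : σ.Bounded dv da B) (e : Ex) :
    ∀ (d : ℕ) (ρ : State), 33 ≤ d → Represents lim σ ρ → e.ok dv da D →
      ∃ ρ', Takes w (e.code d) ρ e.ops ρ' ∧ SameBelow d ρ ρ' ∧ ρ'.reg d = e.eval σ := by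
  have hle : ∀ {e : Ex}, e.ok dv da D → (e.eval σ).size ≤ w := fun {e} he =>
    (Nat.size_le_size ((Ex.eval_le hB hσ he).trans
      (Nat.pow_le_pow_right (by omega) (Ex.deg_le he)))).trans hw
  have binary : ∀ {e f : Ex} {d : ℕ} {ρ ρ₁ ρ₂ : State}, SameBelow d ρ ρ₁ →
      ρ₁.reg d = e.eval σ → SameBelow (d + 1) ρ₁ ρ₂ → ρ₂.reg (d + 1) = f.eval σ →
      ρ₂.reg d = e.eval σ ∧ SameBelow d ρ ρ₂ := fun s₁ v₁ s₂ v₂ =>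
    ⟨(s₂.reg _ (by omega)).trans v₁, s₁.trans (s₂.mono (by omega))⟩
  induction e with
  | num c =>
    intro d ρ hd hρ he
    exact ⟨_, takes_const (hle (e := .num c) he), (SameBelow.refl d ρ).setReg le_rfl _,
      by simp [State.setReg, Ex.eval]⟩
  | var x =>
    intro d ρ hd hρ he
    have he' := he
    simp only [Ex.ok, Bool.and_eq_true, decide_eq_true_eq] at he'
    have hx : x ≠ d := by omega
    refine ⟨_, Takes.seq (takes_const (by simp)) (takes_add ?_ ?_),
      ((SameBelow.refl d ρ).setReg le_rfl _).setReg le_rfl _, ?_⟩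
    · simp [State.setReg]
    · simpa [State.setReg, hx, hρ.var x he'.1, Ex.eval] using hle (e := .var x) he
    · simp [State.setReg, hx, hρ.var x he'.1, Ex.eval]
  | add e f ihe ihf =>
    intro d ρ hd hρ he
    simp only [Ex.ok, Bool.and_eq_true] at he
    obtain ⟨ρ₁, t₁, s₁, v₁⟩ := ihe d ρ hd hρ he.1.1
    obtain ⟨ρ₂, t₂, s₂, v₂⟩ := ihf (d + 1) ρ₁ (by omega) (s₁.represents hd hρ) he.1.2
    obtain ⟨v₃, s₃⟩ := binary s₁ v₁ s₂ v₂
    refine ⟨_, (t₁.seq (t₂.seq (takes_add ?_ ?_))).mono ?_, s₃.setReg le_rfl _, ?_⟩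
    · rw [v₃]; exact hle he.1.1
    · rw [v₂]; exact hle he.1.2
    · simp only [Ex.ops]; omega
    · simp [State.setReg, v₂, v₃, Ex.eval]
  | sub e f ihe ihf =>
    intro d ρ hd hρ he
    simp only [Ex.ok, Bool.and_eq_true] at he
    obtain ⟨ρ₁, t₁, s₁, v₁⟩ := ihe d ρ hd hρ he.1
    obtain ⟨ρ₂, t₂, s₂, v₂⟩ := ihf (d + 1) ρ₁ (by omega) (s₁.represents hd hρ) he.2
    obtain ⟨v₃, s₃⟩ := binary s₁ v₁ s₂ v₂
    refine ⟨_, (t₁.seq (t₂.seq (takes_sub ?_ ?_))).mono ?_, s₃.setReg le_rfl _, ?_⟩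
    · rw [v₃]; exact hle he.1
    · rw [v₂]; exact hle he.2
    · simp only [Ex.ops]; omega
    · simp [State.setReg, v₂, v₃, Ex.eval]
  | mul e f ihe ihf =>
    intro d ρ hd hρ he
    simp only [Ex.ok, Bool.and_eq_true] at he
    obtain ⟨ρ₁, t₁, s₁, v₁⟩ := ihe d ρ hd hρ he.1.1
    obtain ⟨ρ₂, t₂, s₂, v₂⟩ := ihf (d + 1) ρ₁ (by omega) (s₁.represents hd hρ) he.1.2
    obtain ⟨v₃, s₃⟩ := binary s₁ v₁ s₂ v₂
    refine ⟨_, (t₁.seq (t₂.seq (takes_mul ?_ ?_))).mono ?_, s₃.setReg le_rfl _, ?_⟩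
    · rw [v₃]; exact hle he.1.1
    · rw [v₂]; exact hle he.1.2
    · simp only [Ex.ops]; omega
    · simp [State.setReg, v₂, v₃, Ex.eval]
  | get j e ihe =>
    intro d ρ hd hρ he
    have he' := he
    simp only [Ex.ok, Bool.and_eq_true, decide_eq_true_eq] at he'
    obtain ⟨⟨⟨he₁, hj⟩, hD⟩, -⟩ := he'
    obtain ⟨ρ₁, t₁, s₁, v₁⟩ := ihe d ρ hd hρ he₁
    have hρ₁ := s₁.represents hd hρ
    obtain ⟨ρ₂, t₂, s₂, v₂⟩ := takes_addrCode (ρ := ρ₁) hw hB hlim hj (Ex.eval_le hB hσ he₁) hD hd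
      hρ₁.lim_eq v₁
    have hmem : ρ₂.mem (ρ₂.reg d) = (Ex.get j e).eval σ := by
      rw [v₂, s₂.mem, hρ₁.arr j hj]; rfl
    refine ⟨_, (t₁.seq (t₂.seq (takes_load ?_ ?_))).mono ?_, (s₁.trans s₂).setReg le_rfl _, ?_⟩
    · rw [v₂]
      exact (Nat.size_le_size (addr_le hB hlim hj (Ex.eval_le hB hσ he₁) hD)).trans hw
    · rw [hmem]; exact hle he
    · simp only [Ex.ops]; omega
    · rw [← hmem]; simp [State.setReg]

theorem Represents.setVar {σ : Store} {ρ : State} (hρ : Represents lim σ ρ) {x v : ℕ}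
    (hx : x < 32) : Represents lim (σ.setVar x v) (ρ.setReg x v) := by
  refine ⟨fun y hy => ?_, ?_, hρ.arr, hρ.io⟩
  · simp only [Store.setVar, State.setReg, Function.update_apply]
    split_ifs with h
    · rfl
    · exact hρ.var y hy
  · have : 32 ≠ x := by omega
    simpa [State.setReg, this] using hρ.lim_eq

theorem Represents.setArr {σ : Store} {ρ : State} (hρ : Represents lim σ ρ) {j i v : ℕ}
    (hj : j < 32) : Represents lim (σ.setArr j i v) (ρ.setMem (lim + 32 * i + j) v) := by
  refine ⟨hρ.var, hρ.lim_eq, fun l hl m => ?_, fun a ha => ?_⟩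
  · simp only [Store.setArr, State.setMem, Function.update_apply]
    by_cases h : l = j
    · subst h
      by_cases h' : m = i
      · subst h'; simp
      · have : lim + 32 * m + l ≠ lim + 32 * i + l := by omega
        simpa [this, h'] using hρ.arr l hl m
    · have : lim + 32 * m + l ≠ lim + 32 * i + j := by omega
      simpa [this, h] using hρ.arr l hl m
  · have : a ≠ lim + 32 * i + j := by omega
    simpa [Store.setArr, State.setMem, this] using hρ.io a ha

theorem Represents.setIo {σ : Store} {ρ : State} (hρ : Represents lim σ ρ) {i v : ℕ}
    (hi : i < lim) : Represents lim (σ.setIo i v) (ρ.setMem i v) := by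
  refine ⟨hρ.var, hρ.lim_eq, fun l hl m => ?_, fun a ha => ?_⟩
  · have : lim + 32 * m + l ≠ i := by omega
    simpa [Store.setIo, State.setMem, this] using hρ.arr l hl m
  · simp only [Store.setIo, State.setMem, Function.update_apply]
    split_ifs
    · rfl
    · exact hρ.io a ha

/-- The compiled code simulates the command, and its running time is, up to a constant factor,
the number of steps times the number of bits of the largest number that can occur. -/
theorem Run.takes_code {bd w K : ℕ} (hw : (B ^ D).size ≤ w) (hB : 64 ≤ B) (hlim : lim ≤ B ^ 4)
    (hlimD : 4 ≤ D) (hbd : bd ≤ B) {c : Cmd} {σ τ : Store} {n : ℕ} (h : Run lim bd c σ n τ) :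
    ∀ ρ : State, c.ok dv da D K → σ.Bounded dv da B → Represents lim σ ρ →
      ∃ ρ', Takes w c.code ρ (n * K) ρ' ∧ Represents lim τ ρ' := by
  have hsz : ∀ {x m : ℕ}, x ≤ B ^ m → m ≤ D → x.size ≤ w := fun h h' =>
    (Nat.size_le_size (h.trans (Nat.pow_le_pow_right (by omega) h'))).trans hw
  have hle : ∀ {e : Ex} {σ : Store}, σ.Bounded dv da B → e.ok dv da D → (e.eval σ).size ≤ w :=
    fun {e σ} hσ he => hsz (Ex.eval_le hB hσ he) (Ex.deg_le he)
  have test : ∀ {e : Ex} {σ : Store} {ρ : State}, σ.Bounded dv da B → e.ok dv da D →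
      Represents lim σ ρ → ∃ ρ', Takes w (e.code 33) ρ e.ops ρ' ∧ Represents lim σ ρ' ∧
        ρ'.reg 33 = e.eval σ ∧ (ρ'.reg 33).size ≤ w := by
    intro e σ ρ hσ he hρ
    obtain ⟨ρ', t, s, v⟩ := e.takes_code hw hB hlim hσ 33 ρ le_rfl hρ he
    exact ⟨ρ', t, s.represents le_rfl hρ, v, by rw [v]; exact hle hσ he⟩
  induction h with
  | set σ x e =>
    intro ρ hc hσ hρ
    simp only [Cmd.ok, Bool.and_eq_true, decide_eq_true_eq] at hc
    obtain ⟨⟨⟨he, hx⟩, -⟩, hK⟩ := hc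
    obtain ⟨ρ₁, t₁, r₁, v₁, z₁⟩ := test hσ he hρ
    have hx' : 33 ≠ x := by omega
    refine ⟨_, (t₁.seq ((takes_const (d := x) (c := 0) (by simp)).seq
      (takes_add (d := x) (a := x) (b := 33) ?_ ?_))).mono (by omega), ?_⟩
    · simp [State.setReg]
    · simpa [State.setReg, hx'] using z₁
    · have := (r₁.setVar (v := 0) hx).setVar (v := e.eval σ) hx
      simpa [State.setReg, Store.setVar, hx', v₁] using this
  | put σ j e f =>
    intro ρ hc hσ hρ
    simp only [Cmd.ok, Bool.and_eq_true, decide_eq_true_eq] at hc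
    obtain ⟨⟨⟨⟨⟨he, hf⟩, hj⟩, hD⟩, -⟩, hK⟩ := hc
    obtain ⟨ρ₁, t₁, r₁, v₁, z₁⟩ := test hσ he hρ
    obtain ⟨ρ₂, t₂, s₂, v₂⟩ := takes_addrCode (ρ := ρ₁) hw hB hlim hj (Ex.eval_le hB hσ he) hD
      le_rfl r₁.lim_eq v₁
    have r₂ := s₂.represents le_rfl r₁
    obtain ⟨ρ₃, t₃, s₃, v₃⟩ := f.takes_code hw hB hlim hσ 34 ρ₂ (by omega) r₂ hf
    have r₃ := s₃.represents (by omega) r₂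
    have v₂' : ρ₃.reg 33 = lim + 32 * e.eval σ + j := (s₃.reg 33 (by omega)).trans v₂
    refine ⟨_, (t₁.seq (t₂.seq (t₃.seq (takes_store ?_ ?_)))).mono (by omega), ?_⟩
    · rw [v₂']
      exact (Nat.size_le_size (addr_le hB hlim hj (Ex.eval_le hB hσ he) hD)).trans hw
    · rw [v₃]; exact hle hσ hf
    · rw [v₂', v₃]; exact r₃.setArr hj
  | @inp σ x e h₁ h₂ =>
    intro ρ hc hσ hρ
    simp only [Cmd.ok, Bool.and_eq_true, decide_eq_true_eq] at hc
    obtain ⟨⟨⟨⟨he, hx⟩, hx1⟩, hxD⟩, hK⟩ := hc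
    obtain ⟨ρ₁, t₁, r₁, v₁, z₁⟩ := test hσ he hρ
    have hm : ρ₁.mem (ρ₁.reg 33) = σ.io (e.eval σ) := by rw [v₁, r₁.io _ h₁]
    refine ⟨_, (t₁.seq (takes_load (d := x) z₁ ?_)).mono (by omega), ?_⟩
    · rw [hm]
      exact hsz (m := 1) (by simpa using h₂.trans hbd) (by omega)
    · rw [hm]; exact r₁.setVar hx
  | @out σ e f h₁ =>
    intro ρ hc hσ hρ
    simp only [Cmd.ok, Bool.and_eq_true, decide_eq_true_eq] at hc
    obtain ⟨⟨he, hf⟩, hK⟩ := hc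
    obtain ⟨ρ₁, t₁, r₁, v₁, z₁⟩ := test hσ he hρ
    obtain ⟨ρ₃, t₃, s₃, v₃⟩ := f.takes_code hw hB hlim hσ 34 ρ₁ (by omega) r₁ hf
    have r₃ := s₃.represents (by omega) r₁
    have v₂' : ρ₃.reg 33 = e.eval σ := (s₃.reg 33 (by omega)).trans v₁
    refine ⟨_, (t₁.seq (t₃.seq (takes_store ?_ ?_))).mono (by omega), ?_⟩
    · rw [v₂']; exact hle hσ he
    · rw [v₃]; exact hle hσ hf
    · rw [v₂', v₃]; exact r₃.setIo h₁
  | seq h₁ _ ih₁ ih₂ =>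
    intro ρ hc hσ hρ
    simp only [Cmd.ok, Bool.and_eq_true] at hc
    obtain ⟨ρ₁, t₁, r₁⟩ := ih₁ ρ hc.1 hσ hρ
    obtain ⟨ρ₂, t₂, r₂⟩ := ih₂ ρ₁ hc.2 (h₁.bounded hB hbd hc.1 hσ) r₁
    exact ⟨ρ₂, by rw [add_mul]; exact t₁.seq t₂, r₂⟩
  | @iteTrue e p q σ τ n h₀ _ ih =>
    intro ρ hc hσ hρ
    simp only [Cmd.ok, Bool.and_eq_true, decide_eq_true_eq] at hc
    obtain ⟨⟨⟨he, hp⟩, -⟩, hK⟩ := hc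
    obtain ⟨ρ₁, t₁, r₁, v₁, z₁⟩ := test hσ he hρ
    obtain ⟨ρ₂, ⟨t, hx, ht⟩, r₂⟩ := ih ρ₁ hp hσ r₁
    refine ⟨ρ₂, (t₁.seq (N := 1 + n * K) ⟨_, .branchPos (by rwa [v₁]) hx, ?_⟩).mono ?_, r₂⟩
    · rw [add_mul]; omega
    · rw [add_mul]; omega
  | @iteFalse e p q σ τ n h₀ _ ih =>
    intro ρ hc hσ hρ
    simp only [Cmd.ok, Bool.and_eq_true, decide_eq_true_eq] at hc
    obtain ⟨⟨⟨he, -⟩, hq⟩, hK⟩ := hc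
    obtain ⟨ρ₁, t₁, r₁, v₁, z₁⟩ := test hσ he hρ
    obtain ⟨ρ₂, ⟨t, hx, ht⟩, r₂⟩ := ih ρ₁ hq hσ r₁
    refine ⟨ρ₂, (t₁.seq (N := 1 + n * K) ⟨_, .branchZero (by rwa [v₁]) hx, ?_⟩).mono ?_, r₂⟩
    · rw [add_mul]; omega
    · rw [add_mul]; omega
  | loopDone h₀ =>
    intro ρ hc hσ hρ
    simp only [Cmd.ok, Bool.and_eq_true, decide_eq_true_eq] at hc
    obtain ⟨ρ₁, t₁, r₁, v₁, z₁⟩ := test hσ hc.1.1 hρ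
    refine ⟨ρ₁, (t₁.seq (N := 1) ⟨_, .loopDone (by rwa [v₁]), ?_⟩).mono (by omega), r₁⟩
    omega
  | @loopStep e p σ₁ σ₂ σ₃ m n h₀ h₁ _ ih₁ ih₂ =>
    intro ρ hc hσ hρ
    have hc' := hc
    simp only [Cmd.ok, Bool.and_eq_true, decide_eq_true_eq] at hc'
    obtain ⟨⟨he, hp⟩, hK⟩ := hc'
    obtain ⟨ρ₁, t₁, r₁, v₁, z₁⟩ := test hσ he hρ
    obtain ⟨ρ₂, ⟨t₂, x₂, le₂⟩, r₂⟩ := ih₁ ρ₁ hp hσ r₁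
    obtain ⟨ρ₃, ⟨t₃, x₃, le₃⟩, r₃⟩ := ih₂ ρ₂ hc (h₁.bounded hB hbd hp hσ) r₂
    cases x₃ with
    | seq x₄ x₅ =>
      refine ⟨ρ₃, (t₁.seq (N := 1 + m * K + n * K)
        ⟨_, .loopStep (by rwa [v₁]) (.seq x₂ x₄) x₅, ?_⟩).mono ?_, r₃⟩
      · simp only [add_mul] at le₃ ⊢; omega
      · simp only [add_mul]; omega

end simulation

/-! ### From step counts to quasilinear time -/

theorem pos_lt {k : ℕ} (i : Fin 2) (s : Profile 2 k) : pos i s < 2 * k ^ 2 := by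
  have h0 := (s 0).isLt
  have h1 := (s 1).isLt
  have hi : (i : ℕ) ≤ 1 := by omega
  have : (i : ℕ) * k + (s 0 : ℕ) + 1 ≤ 2 * k := by nlinarith
  have := Nat.mul_le_mul_right k this
  simp only [pos, pow_two]
  nlinarith

theorem IsOutput.congr {k : ℕ} {x : Family 2 k} {r : ℝ} {ρ τ : State} (h : IsOutput x r ρ)
    (hm : ∀ a < 4 * k ^ 2 + 4, τ.mem a = ρ.mem a) : IsOutput x r τ := by
  have hp : ∀ (i : Fin 2) (s : Profile 2 k), pos i s < 2 * k ^ 2 := pos_lt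
  refine ⟨?_, ?_, fun i s => ?_, fun i s => ?_⟩
  · rw [hm 1 (by omega)]; exact h.ratio_den
  · rw [hm 0 (by omega), hm 1 (by omega)]; exact h.ratio_eq
  · rw [hm _ (by have := hp i s; omega)]; exact h.rule_den i s
  · rw [hm _ (by have := hp i s; omega), hm _ (by have := hp i s; omega)]; exact h.rule_eq i s

/-- The bound for all numbers of the input: `64 * 2 ^ b * (k + 1)`. -/
def inputBound (k b : ℕ) : ℕ := 64 * 2 ^ b * (k + 1)

theorem size_inputBound_le (k b : ℕ) : (inputBound k b).size ≤ 7 + b + (k ^ 2).size := by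
  rw [Nat.size_le]
  have h1 : k ^ 2 < 2 ^ (k ^ 2).size := Nat.lt_size_self _
  have h2 : k ≤ k ^ 2 := Nat.le_self_pow (by norm_num) k
  have h3 : k + 1 ≤ 2 ^ (k ^ 2).size := by omega
  have h4 : inputBound k b ≤ 64 * 2 ^ b * 2 ^ (k ^ 2).size := Nat.mul_le_mul_left _ h3
  have h5 : 2 ^ (7 + b + (k ^ 2).size) = 2 * (64 * 2 ^ b * 2 ^ (k ^ 2).size) := by ring
  have h6 : 0 < 64 * 2 ^ b * 2 ^ (k ^ 2).size := by positivity
  omega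

theorem size_pow_le (B D : ℕ) (hD : D ≠ 0) : (B ^ D).size ≤ D * B.size := by
  rw [Nat.size_le, mul_comm, pow_mul]
  exact Nat.pow_lt_pow_left (Nat.lt_size_self B) hD

theorem time_bound {k b : ℕ} (hk : 1 ≤ k) (hb : 1 ≤ b) :
    ((min (k ^ 2).size (4 * b) + 1 : ℕ) : ℝ) * ((7 + b + (k ^ 2).size : ℕ) : ℝ) ≤
      42 * b * Real.log ((2 * k ^ 2 * b : ℕ) : ℝ) := by
  have hk2 : 0 < k ^ 2 := by positivity
  set l := (k ^ 2).size with hl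
  have hl1 : 1 ≤ l := Nat.size_pos.2 hk2
  have hm : (min l (4 * b) + 1) * (7 + b + l) ≤ 21 * b * l := by
    have h1 : min l (4 * b) ≤ l := min_le_left _ _
    have h2 : min l (4 * b) ≤ 4 * b := min_le_right _ _
    have h3 : l ≤ b * l := Nat.le_mul_of_pos_left _ hb
    have h4 : b ≤ b * l := Nat.le_mul_of_pos_right _ hl1
    have h5 := Nat.mul_le_mul_right b h1
    have h6 := Nat.mul_le_mul_right l h2
    have h7 : 1 ≤ b * l := hl1.trans h3
    nlinarith
  have hlog : (l : ℝ) ≤ 2 * Real.log ((2 * k ^ 2 * b : ℕ) : ℝ) := by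
    have h1 : 2 ^ (l - 1) ≤ k ^ 2 := Nat.lt_size.1 (by omega)
    have h2 : 2 ^ l ≤ 2 * k ^ 2 * b := by
      calc 2 ^ l = 2 * 2 ^ (l - 1) := by rw [← pow_succ']; congr 1; omega
        _ ≤ 2 * k ^ 2 := by omega
        _ ≤ 2 * k ^ 2 * b := Nat.le_mul_of_pos_right _ hb
    have h3 : Real.log ((2 ^ l : ℕ) : ℝ) ≤ Real.log ((2 * k ^ 2 * b : ℕ) : ℝ) :=
      Real.log_le_log (by positivity) (by exact_mod_cast h2)
    rw [Nat.cast_pow, Real.log_pow] at h3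
    have h4 : (1 : ℝ) / 2 ≤ Real.log 2 := by have := Real.log_two_gt_d9; linarith
    have h5 : (0 : ℝ) ≤ l := by positivity
    push_cast at h3 ⊢
    nlinarith
  calc ((min l (4 * b) + 1 : ℕ) : ℝ) * ((7 + b + l : ℕ) : ℝ) ≤ ((21 * b * l : ℕ) : ℝ) := by
        exact_mod_cast hm
    _ = 21 * b * (l : ℝ) := by push_cast; ring
    _ ≤ 21 * b * (2 * Real.log ((2 * k ^ 2 * b : ℕ) : ℝ)) := by gcongr
    _ = _ := by ring

/-- The table of the input, as it is found in the memory. -/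
structure Holds {k : ℕ} (num den : Fin 2 → Profile 2 k → ℕ) (io : ℕ → ℕ) : Prop where
  signals : io 0 = k
  num_eq : ∀ i s, io (1 + 2 * pos i s) = num i s
  den_eq : ∀ i s, io (2 + 2 * pos i s) = den i s

/-- Code that initializes register `32`, which keeps the number of cells in front of the arrays. -/
def prologue : Prog :=
  .seq (.load 32 0) <| .seq (.mul 32 32 32) <| .seq (.const 33 4) <|
    .seq (.mul 32 32 33) (.add 32 32 33)

/-- It suffices to bound the number of steps of a command by `k² * (min (log k²) (4 b) + 1)`, up to
a constant factor: the numbers handled have `O(b + log k)` bits, and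
`min (log k) b * (log k + b) = O(b log k)`. -/
theorem solvable_of_wp (P : ∀ {k : ℕ}, Family 2 k → Family 2 k → ℝ → Prop) (c : Cmd)
    (dv da : ℕ → ℕ) (D K A : ℕ) (hD : 8 ≤ D) (hc : c.ok dv da D K)
    (h : ∀ (k b : ℕ) (num den : Fin 2 → Profile 2 k → ℕ), 1 ≤ k →
      (∀ i s, 0 < num i s) → (∀ i s, 0 < den i s) →
      (∀ i s, (num i s).size + (den i s).size ≤ b) →
      ∀ io, Holds num den io →
        wp (4 * k ^ 2 + 4) (inputBound k b) c
          (fun τ _ => ∃ x r, IsOutput x r ⟨0, τ.io⟩ ∧ P (fractions num den) x r)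
          ⟨0, 0, io⟩ (A * (k ^ 2 * (min (k ^ 2).size (4 * b) + 1)))) :
    SolvableInQuasilinearTime P := by
  refine ⟨.seq prologue c.code, (5 + K * A) * (1 + 2 * D) * 21, ?_⟩
  intro k b num den hk hnum hden hsize σ hσ
  have hb : 1 ≤ b := by
    let s : Profile 2 k := fun _ => ⟨0, hk⟩
    have h1 := Nat.size_pos.2 (hnum 0 s)
    have h2 := hsize 0 s
    omega
  have hk2 : 0 < k ^ 2 := by positivity
  set B := inputBound k b with hBdef
  set lim := 4 * k ^ 2 + 4 with hlim
  set w := (B ^ D).size with hw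
  have hB : 64 * (k + 1) ≤ B := by
    have : 1 ≤ 2 ^ b := Nat.one_le_two_pow
    calc 64 * (k + 1) = 64 * 1 * (k + 1) := by ring
      _ ≤ 64 * 2 ^ b * (k + 1) := by gcongr
  have hB64 : 64 ≤ B := by omega
  have hB2 : lim ≤ B ^ 2 := by
    have := Nat.pow_le_pow_left hB 2
    nlinarith
  have hlim4 : lim ≤ B ^ 4 := hB2.trans (Nat.pow_le_pow_right (by omega) (by omega))
  have hsz : ∀ {x : ℕ}, x ≤ lim → x.size ≤ w := fun hx =>
    Nat.size_le_size (hx.trans (hlim4.trans (Nat.pow_le_pow_right (by omega) (by omega))))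
  have hkk : k ≤ k * k := Nat.le_mul_of_pos_left _ hk
  have hpro : ∃ ρ, Takes w prologue σ 5 ρ ∧ Represents lim ⟨0, 0, σ.mem⟩ ρ := by
    refine ⟨_, Takes.seq (takes_load ?_ ?_) <| Takes.seq (takes_mul ?_ ?_) <|
      Takes.seq (takes_const ?_) <| Takes.seq (takes_mul ?_ ?_) (takes_add ?_ ?_), ?_⟩
    · simp [hσ.reg_eq]
    · rw [hσ.reg_eq, hσ.signals]; exact hsz (by nlinarith)
    all_goals try
      · apply hsz
        simp [State.setReg, hσ.reg_eq, hσ.signals, hlim]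
        try nlinarith
    refine ⟨fun x hx => ?_, ?_, fun j hj i => ?_, fun a ha => rfl⟩
    · have h1 : x ≠ 32 := by omega
      have h2 : x ≠ 33 := by omega
      simp [State.setReg, hσ.reg_eq, h1, h2]
    · simp [State.setReg, hσ.reg_eq, hσ.signals, hlim]; ring
    · exact hσ.rest _ (by omega)
  obtain ⟨ρ, ⟨t₁, x₁, le₁⟩, r₁⟩ := hpro
  obtain ⟨n, τ, hr, hn, x, r, hout, hP⟩ := h k b num den hk hnum hden hsize σ.mem
    ⟨hσ.signals, hσ.num_eq, hσ.den_eq⟩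
  obtain ⟨ρ', ⟨t₂, x₂, le₂⟩, r₂⟩ := hr.takes_code (w := w) (dv := dv) (da := da) (D := D) (K := K)
    le_rfl hB64 hlim4 (by omega) le_rfl ρ hc ⟨fun _ => Nat.zero_le _, fun _ _ => Nat.zero_le _⟩ r₁
  refine ⟨t₁ + t₂, ρ', x, r, .seq x₁ x₂, ?_, hout.congr fun a ha => r₂.io a ha, hP⟩
  have hwle : w ≤ D * (7 + b + (k ^ 2).size) :=
    (size_pow_le _ _ (by omega)).trans (Nat.mul_le_mul_left _ (size_inputBound_le k b))
  set l := min (k ^ 2).size (4 * b) + 1 with hl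
  set s := 7 + b + (k ^ 2).size with hs
  have hnat : t₁ + t₂ ≤ (5 + K * A) * (1 + 2 * D) * (k ^ 2 * (l * s)) := by
    have hkl : 1 ≤ k ^ 2 * l := Nat.mul_pos hk2 (by omega)
    have hs1 : 1 ≤ s := by omega
    calc t₁ + t₂ ≤ 5 * (1 + 2 * w) + A * (k ^ 2 * l) * K * (1 + 2 * w) := by
          refine add_le_add le₁ (le₂.trans ?_)
          gcongr
      _ = (5 * 1 + K * A * (k ^ 2 * l)) * (1 + 2 * w) := by ring
      _ ≤ (5 * (k ^ 2 * l) + K * A * (k ^ 2 * l)) * (1 * s + 2 * (D * s)) := by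
          gcongr
          omega
      _ = _ := by ring
  calc ((t₁ + t₂ : ℕ) : ℝ) ≤ (((5 + K * A) * (1 + 2 * D) * (k ^ 2 * (l * s)) : ℕ) : ℝ) := by
        exact_mod_cast hnat
    _ = (5 + K * A) * (1 + 2 * D) * ((k : ℝ) ^ 2 * ((l : ℝ) * (s : ℝ))) := by push_cast; ring
    _ ≤ (5 + K * A) * (1 + 2 * D) *
        ((k : ℝ) ^ 2 * (42 * b * Real.log ((2 * k ^ 2 * b : ℕ) : ℝ))) := by
        exact mul_le_mul_of_nonneg_left (mul_le_mul_of_nonneg_left (time_bound hk hb)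
          (by positivity)) (by positivity)
    _ = _ := by push_cast; ring

/-! ### Optimal rules from labels of maximal demand -/

section optimal

variable {k : ℕ} {v : Family 2 k}

theorem rho_eq (v : Family 2 k) (i : Fin 2) (s : Profile 2 k) :
    rho v i s = v i s / max (v 0 s) (v 1 s) := by
  have : ⨆ j, v j s = max (v 0 s) (v 1 s) := by
    refine le_antisymm (ciSup_le fun j => ?_) (max_le ?_ ?_)
    · fin_cases j
      · exact le_max_left _ _
      · exact le_max_right _ _
    · exact le_ciSup (f := fun j => v j s) (Set.finite_range _).bddAbove 0
    · exact le_ciSup (f := fun j => v j s) (Set.finite_range _).bddAbove 1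
  rw [rho, this]

/-- `1 / ρ_i(s)`: what is lost at `s` when the item goes to agent `i`. -/
noncomputable def loss (v : Family 2 k) (i : Fin 2) (s : Profile 2 k) : ℝ := 1 / rho v i s

theorem loss_eq (v : Family 2 k) (i : Fin 2) (s : Profile 2 k) :
    loss v i s = max (v 0 s) (v 1 s) / v i s := by
  rw [loss, rho_eq, one_div_div]

theorem one_le_loss (hv : ∀ i s, 0 < v i s) (i : Fin 2) (s : Profile 2 k) : 1 ≤ loss v i s := by
  rw [loss_eq, one_le_div (hv i s)]
  fin_cases i
  · exact le_max_left _ _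
  · exact le_max_right _ _

theorem loss_eq_one (hv : ∀ i s, 0 < v i s) (s : Profile 2 k) :
    loss v 1 s = 1 ∨ loss v 0 s = 1 := by
  simp only [loss_eq]
  rcases le_total (v 0 s) (v 1 s) with h | h
  · left; rw [max_eq_right h, div_self (hv 1 s).ne']
  · right; rw [max_eq_left h, div_self (hv 0 s).ne']

/-- Each profile `s` carries the label of a profile from which `s` is reachable, and the loss of
agent 2 at the label is the largest over all these profiles. -/
structure IsLabel (v : Family 2 k) (lab : Profile 2 k → Profile 2 k) : Prop where
  reach : ∀ s, Reach v (lab s) s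
  mono : ∀ s s', Arc v s s' → loss v 1 (lab s) ≤ loss v 1 (lab s')
  le : ∀ s, loss v 1 s ≤ loss v 1 (lab s)

theorem exists_isLabel (v : Family 2 k) : ∃ lab, IsLabel v lab := by
  have h : ∀ s, ∃ s', Reach v s' s ∧ ∀ s'', Reach v s'' s → loss v 1 s'' ≤ loss v 1 s' := by
    intro s
    obtain ⟨s', hs', hmax⟩ := (Set.toFinite {s' | Reach v s' s}).exists_maximalFor (loss v 1) _
      ⟨s, Relation.ReflTransGen.refl⟩
    refine ⟨s', hs', fun s'' hs'' => ?_⟩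
    by_contra! hlt
    exact absurd (hmax hs'' hlt.le) (not_le.2 hlt)
  choose lab h₁ h₂ using h
  exact ⟨lab, h₁, fun s s' ha => h₂ _ _ ((h₁ s).tail ha),
    fun s => h₂ _ _ Relation.ReflTransGen.refl⟩

/-- The rule that selects agent 1 with probability `p s`. -/
noncomputable def ruleOf (p : Profile 2 k → ℝ) : Family 2 k :=
  fun i s => if i = 0 then p s else 1 - p s

/-- What the optimality proof needs to know about a variant of the problem: `ok` describes the
probabilities that are allowed, `h p a b` is the ratio at a profile with losses `b` and `a` of
agents 1 and 2 when agent 1 is selected with probability `p`, `g` is the conflict value of two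
losses, and `F a r` is the least probability that keeps the ratio at a profile where agent 2 has
loss `a` below `r`. -/
structure Variant (ok : ℝ → Prop) (h : ℝ → ℝ → ℝ → ℝ) (g F : ℝ → ℝ → ℝ) : Prop where
  ok_nonneg : ∀ p, ok p → 0 ≤ p
  ok_le_one : ∀ p, ok p → p ≤ 1
  ok_F : ∀ a r, 1 ≤ a → 1 ≤ r → ok (F a r)
  F_mono : ∀ a a' r, 1 ≤ a → a ≤ a' → 1 ≤ r → F a r ≤ F a' r
  g_left : ∀ b, 1 ≤ b → g 1 b = 1
  g_right : ∀ a, 1 ≤ a → g a 1 = 1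
  lower : ∀ p q a b a' b', ok p → ok q → p ≤ q → 1 ≤ a → 1 ≤ b → 1 ≤ a' → 1 ≤ b' →
    (a = 1 ∨ b = 1) → (a' = 1 ∨ b' = 1) → g a b' ≤ max (h p a b) (h q a' b')
  upper : ∀ a A b r, 1 ≤ a → a ≤ A → 1 ≤ b → 1 ≤ r → (a = 1 ∨ b = 1) → g A b ≤ r →
    h (F A r) a b ≤ r

theorem Truthful.arc {x : Family 2 k} (hx : x ∈ Truthful v) {s s' : Profile 2 k}
    (h : Arc v s s') : x 0 s ≤ x 0 s' := by
  obtain ⟨-, hsum, hmono⟩ := hx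
  rcases h with ⟨t, rfl, h⟩ | ⟨t, rfl, h⟩
  · exact hmono 0 s t h
  · have h1 := hsum s
    have h2 := hsum (Function.update s 1 t)
    rw [Fin.sum_univ_two] at h1 h2
    have h3 := hmono 1 (Function.update s 1 t) (s 1)
    rw [Function.update_idem, Function.update_eq_self] at h3
    linarith [h3 h]

theorem Truthful.reach {x : Family 2 k} (hx : x ∈ Truthful v) {s s' : Profile 2 k}
    (h : Reach v s s') : x 0 s ≤ x 0 s' := by
  induction h with
  | refl => exact le_rfl
  | tail _ h ih => exact ih.trans (Truthful.arc hx h)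

theorem ruleOf_mem_truthful {p : Profile 2 k → ℝ} (h0 : ∀ s, 0 ≤ p s) (h1 : ∀ s, p s ≤ 1)
    (hp : ∀ s s', Arc v s s' → p s ≤ p s') : ruleOf p ∈ Truthful v := by
  refine ⟨fun i s => ?_, fun s => ?_, fun i s t hlt => ?_⟩
  · fin_cases i
    · exact h0 s
    · simpa [ruleOf] using h1 s
  · simp [Fin.sum_univ_two, ruleOf]
  · fin_cases i
    · exact hp _ _ (Or.inl ⟨t, rfl, hlt⟩)
    · have := hp (Function.update s 1 t) s (Or.inr ⟨s 1, by simp, hlt⟩)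
      simp only [ruleOf, Fin.mk_one, one_ne_zero, if_false]
      linarith

/-- The rule `F` of the labels is optimal. The optimal ratio is attained by a pair of conflicting
profiles, and no pair of profiles has a larger conflict value. -/
theorem Variant.optimal {ok : ℝ → Prop} {h : ℝ → ℝ → ℝ → ℝ} {g F : ℝ → ℝ → ℝ}
    (V : Variant ok h g F) (hk : 1 ≤ k) (hv : ∀ i s, 0 < v i s) {lab : Profile 2 k → Profile 2 k}
    (hlab : IsLabel v lab) {S : Set (Family 2 k)} {R : Family 2 k → ℝ}
    (hS : ∀ x, x ∈ S ↔ x ∈ Truthful v ∧ ∀ s, ok (x 0 s))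
    (hR : ∀ x ∈ S, R x = ⨆ s, h (x 0 s) (loss v 1 s) (loss v 0 s)) {r : ℝ} (hr : 1 ≤ r)
    (hle : ∀ s, g (loss v 1 (lab s)) (loss v 0 s) ≤ r)
    (hex : r = 1 ∨ ∃ s, r = g (loss v 1 (lab s)) (loss v 0 s)) :
    IsOptimal S R (ruleOf fun s => F (loss v 1 (lab s)) r) r ∧
      IsGreatest {r | ∃ s s', Reach v s s' ∧ r = g (loss v 1 s) (loss v 0 s')} r := by
  let s₀ : Profile 2 k := fun _ => ⟨0, hk⟩
  have : Nonempty (Profile 2 k) := ⟨s₀⟩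
  have hl := one_le_loss hv
  set x := ruleOf fun s => F (loss v 1 (lab s)) r with hx
  have hok : ∀ s, ok (F (loss v 1 (lab s)) r) := fun s => V.ok_F _ _ (hl _ _) hr
  have hxS : x ∈ S := (hS x).2 ⟨ruleOf_mem_truthful (fun s => V.ok_nonneg _ (hok s))
    (fun s => V.ok_le_one _ (hok s))
    (fun s s' ha => V.F_mono _ _ _ (hl _ _) (hlab.mono _ _ ha) hr), fun s => by
      simpa [hx, ruleOf] using hok s⟩
  have hxr : R x ≤ r := by
    rw [hR x hxS]
    refine ciSup_le fun s => ?_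
    simpa [hx, ruleOf] using
      V.upper _ _ _ _ (hl _ _) (hlab.le s) (hl _ _) hr (loss_eq_one hv s) (hle s)
  have hlow : ∀ y ∈ S, ∀ s s', Reach v s s' → g (loss v 1 s) (loss v 0 s') ≤ R y := by
    intro y hy s s' hs
    rw [hR y hy]
    have hb : BddAbove (Set.range fun s => h (y 0 s) (loss v 1 s) (loss v 0 s)) :=
      (Set.finite_range _).bddAbove
    refine (V.lower (y 0 s) (y 0 s') _ (loss v 0 s) (loss v 1 s') _ (((hS y).1 hy).2 s)
      (((hS y).1 hy).2 s') (Truthful.reach ((hS y).1 hy).1 hs) (hl _ _) (hl _ _) (hl _ _) (hl _ _)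
      (loss_eq_one hv s) (loss_eq_one hv s')).trans (max_le ?_ ?_)
    · exact le_ciSup hb s
    · exact le_ciSup hb s'
  have hmem : ∃ s s', Reach v s s' ∧ r = g (loss v 1 s) (loss v 0 s') := by
    rcases hex with rfl | ⟨s, hs⟩
    · refine ⟨s₀, s₀, Relation.ReflTransGen.refl, ?_⟩
      rcases loss_eq_one hv s₀ with h | h
      · rw [h, V.g_left _ (hl _ _)]
      · rw [h, V.g_right _ (hl _ _)]
    · exact ⟨lab s, s, hlab.reach s, hs⟩
  have hry : ∀ y ∈ S, r ≤ R y := by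
    obtain ⟨s, s', hs, rfl⟩ := hmem
    exact fun y hy => hlow y hy s s' hs
  refine ⟨⟨hxS, le_antisymm hxr (hry x hxS), fun y hy => hxr.trans (hry y hy)⟩, hmem, ?_⟩
  rintro _ ⟨s, s', hs, rfl⟩
  exact (hlow x hxS s s' hs).trans hxr

theorem exists_max (g : ℝ → ℝ → ℝ) (a b : Profile 2 k → ℝ) :
    ∃ r, 1 ≤ r ∧ (∀ s, g (a s) (b s) ≤ r) ∧ (r = 1 ∨ ∃ s, r = g (a s) (b s)) := by
  classical
  obtain ⟨r, hr, hmax⟩ := (insert 1 (Finset.univ.image fun s => g (a s) (b s))).exists_maximal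
    ⟨1, by simp⟩
  refine ⟨r, ?_, fun s => ?_, ?_⟩
  · by_contra! h; exact absurd (hmax (by simp) h.le) (not_le.2 h)
  · by_contra! h
    exact absurd (hmax (y := g (a s) (b s)) (by simp) h.le) (not_le.2 h)
  · simpa [eq_comm] using hr

/-! ### The variants of the problem -/

/-- Conflict value for a good, in terms of the losses. -/
noncomputable def goodValue (a b : ℝ) : ℝ := 1 / conflict (1 / a) (1 / b)

theorem conflict_eq {a b : ℝ} (h : ¬(a = 1 ∧ b = 1)) : conflict a b = (a * b - 1) / (a + b - 2) :=
  if_neg h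

theorem goodValue_eq {a b : ℝ} (ha : 1 ≤ a) (hb : 1 ≤ b) (h : ¬(a = 1 ∧ b = 1)) :
    goodValue a b = (2 * a * b - a - b) / (a * b - 1) := by
  have hc : ¬(1 / a = 1 ∧ 1 / b = 1) := by
    simpa [div_eq_iff (zero_lt_one.trans_le ha).ne', div_eq_iff (zero_lt_one.trans_le hb).ne',
      eq_comm] using h
  have h0 : a ≠ 0 := by linarith
  have h1 : b ≠ 0 := by linarith
  have h2 : 0 < a * b - 1 := by
    by_contra! h'
    exact h ⟨by nlinarith, by nlinarith⟩
  rw [goodValue, conflict_eq hc, one_div_div]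
  have h3 : 1 / a * (1 / b) - 1 ≠ 0 := by
    have : 1 / a * (1 / b) - 1 = -(a * b - 1) / (a * b) := by field_simp; ring
    rw [this]
    exact div_ne_zero (by linarith) (mul_ne_zero h0 h1)
  rw [div_eq_div_iff h3 h2.ne']
  field_simp
  ring

theorem conflict_left {b : ℝ} : conflict 1 b = 1 := by
  by_cases h : b = 1
  · simp [conflict, h]
  · rw [conflict_eq (by tauto), one_mul]
    have : b - 1 ≠ 0 := sub_ne_zero.2 h
    rw [div_eq_one_iff_eq]
    · ring
    · contrapose! this; linarith

theorem conflict_comm (a b : ℝ) : conflict a b = conflict b a := by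
  simp only [conflict, and_comm, mul_comm a b, add_comm a b]

/-- The least probability of agent 1 for a chore; it is `0` if `a = 1`. -/
noncomputable def choreRule (a r : ℝ) : ℝ := max 0 (a - r) / (a - 1)

/-- The least probability of agent 1 for a good; it is `0` if `a = 1`. -/
noncomputable def goodRule (a r : ℝ) : ℝ := max 0 (a - r) / (r * (a - 1))

open Classical in
/-- The least probability of agent 1 for a deterministic rule. -/
noncomputable def detRule (a r : ℝ) : ℝ := if r < a then 1 else 0

theorem choreRule_of_le {a r : ℝ} (h : a ≤ r) : choreRule a r = 0 := by
  simp [choreRule, h]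

theorem choreRule_of_lt {a r : ℝ} (h : r < a) : choreRule a r = (a - r) / (a - 1) := by
  rw [choreRule, max_eq_right (by linarith)]

theorem choreRule_mem {a r : ℝ} (hr : 1 ≤ r) :
    0 ≤ choreRule a r ∧ choreRule a r ≤ 1 := by
  rcases le_or_gt a r with h | h
  · simp [choreRule_of_le h]
  · rw [choreRule_of_lt h]
    have : 0 < a - 1 := by linarith
    exact ⟨div_nonneg (by linarith) this.le, (div_le_one this).2 (by linarith)⟩

theorem choreRule_mono {a a' r : ℝ} (h : a ≤ a') (hr : 1 ≤ r) :
    choreRule a r ≤ choreRule a' r := by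
  rcases le_or_gt a r with h' | h'
  · rw [choreRule_of_le h']; exact (choreRule_mem hr).1
  · rw [choreRule_of_lt h', choreRule_of_lt (h'.trans_le h),
      div_le_div_iff₀ (by linarith) (by linarith)]
    nlinarith

theorem goodRule_eq (a r : ℝ) : goodRule a r = choreRule a r / r := by
  rw [goodRule, choreRule, div_div, mul_comm]

theorem chore_variant : Variant (fun p => 0 ≤ p ∧ p ≤ 1) (fun p a b => p * b + (1 - p) * a)
    conflict choreRule where
  ok_nonneg _ h := h.1
  ok_le_one _ h := h.2
  ok_F _ _ _ hr := choreRule_mem hr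
  F_mono _ _ _ _ h hr := choreRule_mono h hr
  g_left _ _ := conflict_left
  g_right _ _ := by rw [conflict_comm]; exact conflict_left
  lower p q a b a' b' hp hq hpq ha hb ha' hb' h h' := by
    rw [le_max_iff]
    rcases ha.eq_or_lt with rfl | ha₁
    · left; rw [conflict_left]; nlinarith
    rcases hb'.eq_or_lt with rfl | hb₁
    · right; rw [conflict_comm, conflict_left]; nlinarith
    obtain rfl : b = 1 := h.resolve_left ha₁.ne'
    obtain rfl : a' = 1 := h'.resolve_right hb₁.ne'
    by_contra! hc
    rw [conflict_eq (fun h => ha₁.ne' h.1), lt_div_iff₀ (by linarith),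
      lt_div_iff₀ (by linarith)] at hc
    nlinarith [mul_nonneg (sub_nonneg.2 hpq) (mul_nonneg (sub_nonneg.2 ha) (sub_nonneg.2 hb')),
      mul_pos (sub_pos.2 ha₁) (sub_pos.2 hb₁)]
  upper a A b r ha haA hb hr h hg := by
    have hp := choreRule_mem (a := A) hr
    rcases le_or_gt A r with hA | hA
    · rw [choreRule_of_le hA]; linarith
    rw [choreRule_of_lt hA] at hp ⊢
    set p := (A - r) / (A - 1) with hpdef
    have hpA : p * (A - 1) = A - r := div_mul_cancel₀ _ (by linarith)
    rcases h with rfl | rfl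
    · rw [conflict_eq (fun h => by linarith [h.1]), div_le_iff₀ (by linarith)] at hg
      have : (A - 1) * (p * (b - 1)) ≤ (A - 1) * (r - 1) := by nlinarith
      have := le_of_mul_le_mul_left this (by linarith)
      linarith
    · nlinarith

theorem good_variant : Variant (fun p => 0 ≤ p ∧ p ≤ 1)
    (fun p a b => 1 / (p * (1 / b) + (1 - p) * (1 / a)))
    goodValue goodRule where
  ok_nonneg _ h := h.1
  ok_le_one _ h := h.2
  ok_F a r _ hr := by
    have := choreRule_mem (a := a) hr
    rw [goodRule_eq]
    exact ⟨div_nonneg this.1 (by linarith), (div_le_one (by linarith)).2 (by linarith)⟩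
  F_mono a a' r _ h hr := by
    rw [goodRule_eq, goodRule_eq]
    exact div_le_div_of_nonneg_right (choreRule_mono h hr) (by linarith)
  g_left b _ := by simp [goodValue, conflict_left]
  g_right b _ := by simp [goodValue, conflict_comm _ 1, conflict_left]
  lower p q a b a' b' hp hq hpq ha hb ha' hb' h h' := by
    have hpos : ∀ {p a b : ℝ}, 0 ≤ p ∧ p ≤ 1 → 1 ≤ a → 1 ≤ b →
        0 < p * (1 / b) + (1 - p) * (1 / a) := by
      intro p a b hp ha hb
      have h1 : 0 < 1 / a := by positivity
      have h2 : 0 < 1 / b := by positivity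
      rcases hp.1.eq_or_lt with rfl | h
      · simpa using h1
      · have := mul_pos h h2
        have := mul_nonneg (sub_nonneg.2 hp.2) h1.le
        linarith
    have hone : ∀ {p a b : ℝ}, 0 ≤ p ∧ p ≤ 1 → 1 ≤ a → 1 ≤ b →
        1 ≤ 1 / (p * (1 / b) + (1 - p) * (1 / a)) := by
      intro p a b hp ha hb
      rw [le_div_iff₀ (hpos hp ha hb)]
      have h1 : 1 / a ≤ 1 := (div_le_one (by linarith)).2 ha
      have h2 : 1 / b ≤ 1 := (div_le_one (by linarith)).2 hb
      nlinarith
    rw [le_max_iff]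
    rcases ha.eq_or_lt with rfl | ha₁
    · left; simpa [goodValue, conflict_left] using hone hp ha hb
    rcases hb'.eq_or_lt with rfl | hb₁
    · right; simpa [goodValue, conflict_comm _ 1, conflict_left] using hone hq ha' hb'
    obtain rfl : b = 1 := h.resolve_left ha₁.ne'
    obtain rfl : a' = 1 := h'.resolve_right hb₁.ne'
    by_contra! hc
    have hab : 0 < a * b' - 1 := by nlinarith
    have h0 : a ≠ 0 := by linarith
    have h1 : b' ≠ 0 := by linarith
    rw [goodValue_eq ha hb' (fun h => ha₁.ne' h.1)] at hc
    set m := (2 * a * b' - a - b') / (a * b' - 1) with hm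
    have hm' : m * (a * b' - 1) = 2 * a * b' - a - b' := div_mul_cancel₀ _ hab.ne'
    obtain ⟨hc₁, hc₂⟩ := hc
    rw [div_lt_iff₀ (hpos hp ha hb)] at hc₁
    rw [div_lt_iff₀ (hpos hq ha' hb')] at hc₂
    have e1 : a < m * (p * a + (1 - p)) := by
      have : m * (p * (1 / 1) + (1 - p) * (1 / a)) * a = m * (p * a + (1 - p)) := by field_simp
      rw [← this]; nlinarith
    have e2 : b' < m * (q + (1 - q) * b') := by
      have : m * (q * (1 / b') + (1 - q) * (1 / 1)) * b' = m * (q + (1 - q) * b') := by field_simp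
      rw [← this]; nlinarith
    have hm0 : 0 < m := div_pos (by nlinarith) hab
    have e3 : m * (q + (1 - q) * b') ≤ m * (p + (1 - p) * b') :=
      mul_le_mul_of_nonneg_left (by nlinarith) hm0.le
    nlinarith [mul_pos (sub_pos.2 e1) (sub_pos.2 hb₁),
      mul_pos (sub_pos.2 (e2.trans_le e3)) (sub_pos.2 ha₁)]
  upper a A b r ha haA hb hr h hg := by
    have hc := choreRule_mem (a := A) hr
    have hr0 : 0 < r := by linarith
    have ha0 : 0 < a := by linarith
    have hb0 : 0 < b := by linarith
    rw [goodRule_eq]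
    set c := choreRule A r with hcdef
    have hpos : r * (a * b) ≤ r * (c * a + (r - c) * b) →
        1 / (c / r * (1 / b) + (1 - c / r) * (1 / a)) ≤ r := by
      intro hle
      have e : c / r * (1 / b) + (1 - c / r) * (1 / a) = (c * a + (r - c) * b) / (r * (a * b)) := by
        field_simp
      have hab : 0 < r * (a * b) := by positivity
      have hd : 0 < c * a + (r - c) * b := pos_of_mul_pos_right (hab.trans_le hle) hr0.le
      rw [e, one_div_div, div_le_iff₀ hd]
      exact hle
    apply hpos
    refine mul_le_mul_of_nonneg_left ?_ hr0.le
    rcases le_or_gt A r with hA | hA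
    · rw [hcdef, choreRule_of_le hA]; nlinarith
    have hcA : c * (A - 1) = A - r := by
      rw [hcdef, choreRule_of_lt hA]; exact div_mul_cancel₀ _ (by linarith)
    rcases h with rfl | rfl
    · rw [goodValue_eq haA hb (fun h => by linarith [h.1]), div_le_iff₀ (by nlinarith)] at hg
      have : (A - 1) * (1 * b) ≤ (A - 1) * (c * 1 + (r - c) * b) := by nlinarith
      exact le_of_mul_le_mul_left this (by linarith)
    · nlinarith

theorem det_variant {h : ℝ → ℝ → ℝ → ℝ} (h0 : ∀ a b, h 0 a b = a) (h1 : ∀ a b, h 1 a b = b) :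
    Variant (fun p => p = 0 ∨ p = 1) h min detRule where
  ok_nonneg p hp := by rcases hp with rfl | rfl <;> norm_num
  ok_le_one p hp := by rcases hp with rfl | rfl <;> norm_num
  ok_F a r _ _ := by simp only [detRule]; split_ifs <;> simp
  F_mono a a' r _ h _ := by
    simp only [detRule]
    split_ifs with h₁ h₂
    · exact le_rfl
    · exact absurd (h₁.trans_le h) h₂
    · norm_num
    · exact le_rfl
  g_left _ hb := min_eq_left hb
  g_right _ ha := min_eq_right ha
  lower p q a b a' b' hp hq hpq _ _ _ _ _ _ := by
    rw [le_max_iff]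
    rcases hp with rfl | rfl
    · left; rw [h0]; exact min_le_left _ _
    · rcases hq with rfl | rfl
      · norm_num at hpq
      · right; rw [h1]; exact min_le_right _ _
  upper a A b r _ haA _ _ _ hg := by
    simp only [detRule]
    split_ifs with hA
    · rw [h1]
      exact (min_le_iff.1 hg).resolve_left (not_le.2 hA)
    · rw [h0]; linarith

theorem mem_truthful_iff {x : Family 2 k} :
    x ∈ Truthful v ↔ x ∈ Truthful v ∧ ∀ s, 0 ≤ x 0 s ∧ x 0 s ≤ 1 := by
  refine ⟨fun hx => ⟨hx, fun s => ⟨hx.1 0 s, ?_⟩⟩, And.left⟩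
  have h1 := hx.2.1 s
  rw [Fin.sum_univ_two] at h1
  linarith [hx.1 1 s]

theorem Truthful.apply_one {x : Family 2 k} (hx : x ∈ Truthful v) (s : Profile 2 k) :
    x 1 s = 1 - x 0 s := by
  have h1 := hx.2.1 s
  rw [Fin.sum_univ_two] at h1
  linarith

theorem mem_truthfulDet_iff {x : Family 2 k} :
    x ∈ TruthfulDet v ↔ x ∈ Truthful v ∧ ∀ s, x 0 s = 0 ∨ x 0 s = 1 := by
  refine ⟨fun hx => ⟨hx.1, hx.2 0⟩, fun hx => ⟨hx.1, fun i s => ?_⟩⟩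
  fin_cases i
  · exact hx.2 s
  · have := Truthful.apply_one hx.1 s
    rcases hx.2 s with h | h
    · right; simp [this, h]
    · left; simp [this, h]

theorem RV_eq {x : Family 2 k} (hx : x ∈ Truthful v) :
    RV v x = ⨆ s, 1 / (x 0 s * (1 / loss v 0 s) + (1 - x 0 s) * (1 / loss v 1 s)) := by
  simp only [RV, Fin.sum_univ_two, Truthful.apply_one hx, loss, one_div_one_div]

theorem RC_eq {x : Family 2 k} (hx : x ∈ Truthful v) :
    RC v x = ⨆ s, (x 0 s * loss v 0 s + (1 - x 0 s) * loss v 1 s) := by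
  simp only [RC, Fin.sum_univ_two, Truthful.apply_one hx, loss]

section

variable (hk : 1 ≤ k) (hv : ∀ i s, 0 < v i s) {lab : Profile 2 k → Profile 2 k}
  (hlab : IsLabel v lab) {r : ℝ} (hr : 1 ≤ r)
include hk hv hlab hr

theorem good_optimal (hle : ∀ s, goodValue (loss v 1 (lab s)) (loss v 0 s) ≤ r)
    (hex : r = 1 ∨ ∃ s, r = goodValue (loss v 1 (lab s)) (loss v 0 s)) :
    IsOptimal (Truthful v) (RV v) (ruleOf fun s => goodRule (loss v 1 (lab s)) r) r ∧
      IsGreatest {r | ∃ s s', Reach v s s' ∧ r = goodValue (loss v 1 s) (loss v 0 s')} r :=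
  good_variant.optimal hk hv hlab (fun _ => mem_truthful_iff) (fun _ => RV_eq) hr hle hex

theorem chore_optimal (hle : ∀ s, conflict (loss v 1 (lab s)) (loss v 0 s) ≤ r)
    (hex : r = 1 ∨ ∃ s, r = conflict (loss v 1 (lab s)) (loss v 0 s)) :
    IsOptimal (Truthful v) (RC v) (ruleOf fun s => choreRule (loss v 1 (lab s)) r) r ∧
      IsGreatest {r | ∃ s s', Reach v s s' ∧ r = conflict (loss v 1 s) (loss v 0 s')} r :=
  chore_variant.optimal hk hv hlab (fun _ => mem_truthful_iff) (fun _ => RC_eq) hr hle hex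

theorem detGood_optimal (hle : ∀ s, min (loss v 1 (lab s)) (loss v 0 s) ≤ r)
    (hex : r = 1 ∨ ∃ s, r = min (loss v 1 (lab s)) (loss v 0 s)) :
    IsOptimal (TruthfulDet v) (RV v) (ruleOf fun s => detRule (loss v 1 (lab s)) r) r ∧
      IsGreatest {r | ∃ s s', Reach v s s' ∧ r = min (loss v 1 s) (loss v 0 s')} r :=
  (det_variant (h := fun p a b => 1 / (p * (1 / b) + (1 - p) * (1 / a))) (by simp)
    (by simp)).optimal hk hv hlab (fun _ => mem_truthfulDet_iff) (fun _ h => RV_eq h.1) hr hle hex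

theorem detChore_optimal (hle : ∀ s, min (loss v 1 (lab s)) (loss v 0 s) ≤ r)
    (hex : r = 1 ∨ ∃ s, r = min (loss v 1 (lab s)) (loss v 0 s)) :
    IsOptimal (TruthfulDet v) (RC v) (ruleOf fun s => detRule (loss v 1 (lab s)) r) r ∧
      IsGreatest {r | ∃ s s', Reach v s s' ∧ r = min (loss v 1 s) (loss v 0 s')} r :=
  (det_variant (h := fun p a b => p * b + (1 - p) * a) (by simp) (by simp)).optimal
    hk hv hlab (fun _ => mem_truthfulDet_iff) (fun _ h => RC_eq h.1) hr hle hex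

end

theorem IsOptimal.isLeast {S : Set (Family 2 k)} {R : Family 2 k → ℝ} {x : Family 2 k} {r : ℝ}
    (h : IsOptimal S R x r) : IsLeast (R '' S) r := by
  obtain ⟨hx, rfl, hy⟩ := h
  exact ⟨⟨x, hx, rfl⟩, by rintro _ ⟨y, hyS, rfl⟩; exact hy y hyS⟩

theorem optimal_ratios (hk : 1 ≤ k) (hv : ∀ i s, 0 < v i s) :
    (∃ r : ℝ, IsLeast (RV v '' Truthful v) r ∧
      IsGreatest (conflictValues v fun a b => 1 / conflict a b) r) ∧
    (∃ r : ℝ, IsLeast (RC v '' Truthful v) r ∧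
      IsGreatest (conflictValues v fun a b => conflict (1 / a) (1 / b)) r) ∧
    (∃ r : ℝ, IsLeast (RV v '' TruthfulDet v) r ∧ IsLeast (RC v '' TruthfulDet v) r ∧
      IsGreatest (conflictValues v fun a b => min (1 / a) (1 / b)) r) := by
  obtain ⟨lab, hlab⟩ := exists_isLabel v
  refine ⟨?_, ?_, ?_⟩
  · obtain ⟨r, hr, hle, hex⟩ := exists_max goodValue (fun s => loss v 1 (lab s)) (loss v 0)
    have := good_optimal hk hv hlab hr hle hex
    exact ⟨r, this.1.isLeast, by simpa [conflictValues, loss, goodValue] using this.2⟩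
  · obtain ⟨r, hr, hle, hex⟩ := exists_max conflict (fun s => loss v 1 (lab s)) (loss v 0)
    have := chore_optimal hk hv hlab hr hle hex
    exact ⟨r, this.1.isLeast, this.2⟩
  · obtain ⟨r, hr, hle, hex⟩ := exists_max min (fun s => loss v 1 (lab s)) (loss v 0)
    have h1 := detGood_optimal hk hv hlab hr hle hex
    have h2 := detChore_optimal hk hv hlab hr hle hex
    exact ⟨r, h1.1.isLeast, h2.1.isLeast, h2.2⟩

end optimal

/-! ### Merge sort with classes of equal keys -/

/-- The first element, or `0`. -/
def first (c : List ℕ) : ℕ := c.headD 0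

/-- The last element, or `0`. -/
def last (c : List ℕ) : ℕ := c.getLastD 0

section merge

variable (key : ℕ → ℚ)

/-- Merges two runs. A run is a list of classes, and a class is a list of nodes with the same key;
classes with the same key are joined. -/
def merge : List (List ℕ) → List (List ℕ) → List (List ℕ)
  | [], bs => bs
  | a :: as, [] => a :: as
  | a :: as, b :: bs =>
    if key (first a) < key (first b) then a :: merge as (b :: bs)
    else if key (first b) < key (first a) then b :: merge (a :: as) bs
    else merge ((a ++ b) :: as) bs
termination_by as bs => as.length + bs.length

/-- Merges the runs of a list in pairs, accumulating the results. -/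
def mergePairs : List (List (List ℕ)) → List (List (List ℕ)) → List (List (List ℕ))
  | [], z => z
  | [a], z => merge key a [] :: z
  | a :: b :: rs, z => mergePairs rs (merge key a b :: z)

/-- Non-empty classes of nodes with the same key, in strictly increasing order. -/
structure IsRun (r : List (List ℕ)) : Prop where
  ne_nil : ∀ c ∈ r, c ≠ []
  key_eq : ∀ c ∈ r, ∀ x ∈ c, key x = key (first c)
  sorted : r.Pairwise fun c d => key (first c) < key (first d)

theorem merge_nil (r : List (List ℕ)) : merge key r [] = r := by
  cases r <;> simp [merge]

theorem merge_perm (as bs : List (List ℕ)) :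
    (merge key as bs).flatten.Perm (as.flatten ++ bs.flatten) := by
  induction as, bs using merge.induct key with
  | case1 bs => simp [merge]
  | case2 a as => simp [merge]
  | case3 a as b bs h ih =>
    rw [merge, if_pos h]
    simpa [List.append_assoc] using ih.append_left a
  | case4 a as b bs h h' ih =>
    rw [merge, if_neg h, if_pos h', List.flatten_cons]
    refine (ih.append_left b).trans ?_
    simpa [List.append_assoc] using
      (List.perm_append_comm (l₁ := b) (l₂ := (a :: as).flatten)).append_right bs.flatten
  | case5 a as b bs h h' ih =>
    rw [merge, if_neg h, if_neg h']
    refine ih.trans ?_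
    simpa [List.append_assoc] using
      ((List.perm_append_comm (l₁ := b) (l₂ := as.flatten)).append_right bs.flatten).append_left a

theorem first_append {a b : List ℕ} (ha : a ≠ []) : first (a ++ b) = first a := by
  cases a with
  | nil => exact absurd rfl ha
  | cons => rfl

theorem merge_key {as bs : List (List ℕ)} (ha : ∀ c ∈ as, c ≠ []) (c : List ℕ)
    (hc : c ∈ merge key as bs) : ∃ d, (d ∈ as ∨ d ∈ bs) ∧ key (first c) = key (first d) := by
  induction as, bs using merge.induct key with
  | case1 bs => exact ⟨c, Or.inr (by simpa [merge] using hc), rfl⟩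
  | case2 a as => exact ⟨c, Or.inl (by simpa [merge] using hc), rfl⟩
  | case3 a as b bs h ih =>
    rw [merge, if_pos h] at hc
    rcases List.mem_cons.1 hc with rfl | hc
    · exact ⟨c, by simp, rfl⟩
    · obtain ⟨d, hd, e⟩ := ih (fun c hc => ha c (List.mem_cons_of_mem _ hc)) hc
      exact ⟨d, hd.imp_left (List.mem_cons_of_mem _), e⟩
  | case4 a as b bs h h' ih =>
    rw [merge, if_neg h, if_pos h'] at hc
    rcases List.mem_cons.1 hc with rfl | hc
    · exact ⟨c, by simp, rfl⟩
    · obtain ⟨d, hd, e⟩ := ih ha hc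
      exact ⟨d, hd.imp_right (List.mem_cons_of_mem _), e⟩
  | case5 a as b bs h h' ih =>
    rw [merge, if_neg h, if_neg h'] at hc
    have ha' : ∀ c ∈ (a ++ b) :: as, c ≠ [] := by
      intro c hc
      rcases List.mem_cons.1 hc with rfl | hc
      · exact List.append_ne_nil_of_left_ne_nil (ha a (by simp)) _
      · exact ha c (List.mem_cons_of_mem _ hc)
    obtain ⟨d, hd | hd, e⟩ := ih ha' hc
    · rcases List.mem_cons.1 hd with rfl | hd
      · rw [first_append (ha a (by simp))] at e
        exact ⟨a, by simp, e⟩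
      · exact ⟨d, Or.inl (List.mem_cons_of_mem _ hd), e⟩
    · exact ⟨d, Or.inr (List.mem_cons_of_mem _ hd), e⟩

variable {key}

theorem IsRun.tail {c : List ℕ} {r : List (List ℕ)} (h : IsRun key (c :: r)) : IsRun key r :=
  ⟨fun d hd => h.ne_nil d (List.mem_cons_of_mem _ hd),
    fun d hd => h.key_eq d (List.mem_cons_of_mem _ hd), h.sorted.of_cons⟩

theorem IsRun.cons {c : List ℕ} {r : List (List ℕ)} (h : IsRun key r) (h₁ : c ≠ [])
    (h₂ : ∀ x ∈ c, key x = key (first c)) (h₃ : ∀ d ∈ r, key (first c) < key (first d)) :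
    IsRun key (c :: r) :=
  ⟨List.forall_mem_cons.2 ⟨h₁, h.ne_nil⟩, List.forall_mem_cons.2 ⟨h₂, h.key_eq⟩,
    List.pairwise_cons.2 ⟨h₃, h.sorted⟩⟩

theorem IsRun.merge {as bs : List (List ℕ)} (ha : IsRun key as) (hb : IsRun key bs) :
    IsRun key (merge key as bs) := by
  induction as, bs using merge.induct key with
  | case1 bs => simpa [TwoAgents.merge] using hb
  | case2 a as => simpa [TwoAgents.merge] using ha
  | case3 a as b bs h ih =>
    rw [TwoAgents.merge, if_pos h]
    refine (ih ha.tail hb).cons (ha.ne_nil _ (by simp)) (ha.key_eq _ (by simp)) fun d hd => ?_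
    obtain ⟨e, he, hde⟩ := merge_key key ha.tail.ne_nil d hd
    rw [hde]
    rcases he with he | he
    · exact (List.pairwise_cons.1 ha.sorted).1 e he
    · rcases List.mem_cons.1 he with rfl | he
      · exact h
      · exact h.trans ((List.pairwise_cons.1 hb.sorted).1 e he)
  | case4 a as b bs h h' ih =>
    rw [TwoAgents.merge, if_neg h, if_pos h']
    refine (ih ha hb.tail).cons (hb.ne_nil _ (by simp)) (hb.key_eq _ (by simp)) fun d hd => ?_
    obtain ⟨e, he, hde⟩ := merge_key key ha.ne_nil d hd
    rw [hde]
    rcases he with he | he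
    · rcases List.mem_cons.1 he with rfl | he
      · exact h'
      · exact h'.trans ((List.pairwise_cons.1 ha.sorted).1 e he)
    · exact (List.pairwise_cons.1 hb.sorted).1 e he
  | case5 a as b bs h h' ih =>
    rw [TwoAgents.merge, if_neg h, if_neg h']
    have hab : key (first a) = key (first b) := le_antisymm (not_lt.1 h') (not_lt.1 h)
    have hne := ha.ne_nil a (by simp)
    refine ih (ha.tail.cons (List.append_ne_nil_of_left_ne_nil hne _) ?_ ?_) hb.tail
    · rw [first_append hne]
      intro x hx
      rcases List.mem_append.1 hx with hx | hx
      · exact ha.key_eq a (by simp) x hx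
      · rw [hab]; exact hb.key_eq b (by simp) x hx
    · rw [first_append hne]; exact (List.pairwise_cons.1 ha.sorted).1

theorem mergePairs_forall {p : List (List ℕ) → Prop} (hm : ∀ a b, p a → p b → p (merge key a b))
    (h0 : p []) {rs z : List (List (List ℕ))} (hr : ∀ r ∈ rs, p r) (hz : ∀ r ∈ z, p r) :
    ∀ r ∈ mergePairs key rs z, p r := by
  induction rs, z using mergePairs.induct key with
  | case1 z => simpa [mergePairs] using hz
  | case2 a z =>
    simp only [mergePairs, List.forall_mem_cons]
    exact ⟨hm _ _ (hr a (by simp)) h0, hz⟩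
  | case3 a b rs z ih =>
    rw [mergePairs]
    exact ih (fun r h => hr r (by simp [h]))
      (List.forall_mem_cons.2 ⟨hm _ _ (hr a (by simp)) (hr b (by simp)), hz⟩)

theorem mergePairs_perm (rs z : List (List (List ℕ))) :
    (mergePairs key rs z).flatten.flatten.Perm (rs ++ z).flatten.flatten := by
  induction rs, z using mergePairs.induct key with
  | case1 z => simp [mergePairs]
  | case2 a z => simp [mergePairs, merge_nil]
  | case3 a b rs z ih =>
    rw [mergePairs]
    refine ih.trans (List.perm_iff_count.2 fun x => ?_)
    have := (merge_perm key a b).count_eq x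
    simp only [List.flatten_append, List.flatten_cons, List.cons_append, List.count_append] at *
    omega

theorem mergePairs_length (rs z : List (List (List ℕ))) :
    (mergePairs key rs z).length = (rs.length + 1) / 2 + z.length := by
  induction rs, z using mergePairs.induct key with
  | case1 z => simp [mergePairs]
  | case2 a z => simp [mergePairs]; omega
  | case3 a b rs z ih => rw [mergePairs, ih]; simp only [List.length_cons]; omega

end merge

/-! ### Linked lists in arrays -/

/-- Following the links `nx` from the node `h`, one passes through the nodes of the list and then
arrives at `e`. -/
def Seg (nx : ℕ → ℕ) : ℕ → List ℕ → ℕ → Prop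
  | h, [], e => h = e
  | h, x :: l, e => h = x ∧ Seg nx (nx x) l e

theorem Seg.congr {nx nx' : ℕ → ℕ} {l : List ℕ} {h e : ℕ} (hs : Seg nx h l e)
    (hx : ∀ x ∈ l, nx' x = nx x) : Seg nx' h l e := by
  induction l generalizing h with
  | nil => exact hs
  | cons x l ih =>
    refine ⟨hs.1, ?_⟩
    rw [hx x (by simp)]
    exact ih hs.2 fun y hy => hx y (List.mem_cons_of_mem _ hy)

theorem seg_append {nx : ℕ → ℕ} {l₁ l₂ : List ℕ} {h e : ℕ} :
    Seg nx h (l₁ ++ l₂) e ↔ ∃ m, Seg nx h l₁ m ∧ Seg nx m l₂ e := by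
  induction l₁ generalizing h with
  | nil => simp [Seg]
  | cons x l ih => simp [Seg, ih, and_assoc]

theorem last_cons_cons (x y : ℕ) (l : List ℕ) : last (x :: y :: l) = last (y :: l) := by
  simp [last]

theorem last_append (a : List ℕ) {b : List ℕ} (hb : b ≠ []) : last (a ++ b) = last b := by
  simp only [last, List.getLastD_eq_getLast?, List.getLast?_append]
  cases h : b.getLast? with
  | none => simp [hb] at h
  | some => simp

theorem last_mem {l : List ℕ} (hl : l ≠ []) : last l ∈ l := by
  rw [last, List.getLastD_eq_getLast?, List.getLast?_eq_some_getLast hl]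
  exact List.getLast_mem hl

theorem first_mem {l : List ℕ} (hl : l ≠ []) : first l ∈ l := by
  cases l with
  | nil => exact absurd rfl hl
  | cons => simp [first]

theorem Seg.eq_first {nx : ℕ → ℕ} {l : List ℕ} {h e : ℕ} (hs : Seg nx h l e) (hl : l ≠ []) :
    h = first l := by
  cases l with
  | nil => exact absurd rfl hl
  | cons => exact hs.1

theorem Seg.end_eq {nx : ℕ → ℕ} {l : List ℕ} {h e : ℕ} (hs : Seg nx h l e) (hl : l ≠ []) :
    nx (last l) = e := by
  induction l generalizing h with
  | nil => exact absurd rfl hl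
  | cons x l ih =>
    cases l with
    | nil => exact hs.2
    | cons y l => rw [last_cons_cons]; exact ih hs.2 (by simp)

/-- Redirecting the last link. -/
theorem Seg.redirect {nx : ℕ → ℕ} {l : List ℕ} {h e : ℕ} (hs : Seg nx h l e) (hl : l ≠ [])
    (hn : l.Nodup) (e' : ℕ) : Seg (Function.update nx (last l) e') h l e' := by
  induction l generalizing h with
  | nil => exact absurd rfl hl
  | cons x l ih =>
    cases l with
    | nil => exact ⟨hs.1, by rw [show last [x] = x from rfl, Function.update_self]; rfl⟩
    | cons y l =>
      rw [last_cons_cons]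
      refine ⟨hs.1, ?_⟩
      have hne : x ≠ last (y :: l) := fun h =>
        (List.nodup_cons.1 hn).1 (h ▸ last_mem (by simp))
      rw [Function.update_of_ne hne]
      exact ih hs.2 (by simp) (List.nodup_cons.1 hn).2

/-- The nodes of the run `r` are linked by `nx`, starting with `h` and ending with `0`, and at the
first node of each class `tl` holds the last node of the class. -/
structure RunAt (nx tl : ℕ → ℕ) (h : ℕ) (r : List (List ℕ)) : Prop where
  seg : Seg nx h r.flatten 0
  tail : ∀ c ∈ r, c ≠ [] ∧ tl (first c) = last c

theorem RunAt.congr {nx tl nx' tl' : ℕ → ℕ} {h : ℕ} {r : List (List ℕ)} (hr : RunAt nx tl h r)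
    (hx : ∀ x ∈ r.flatten, nx' x = nx x) (ht : ∀ x ∈ r.flatten, tl' x = tl x) :
    RunAt nx' tl' h r := by
  refine ⟨hr.seg.congr hx, fun c hc => ⟨(hr.tail c hc).1, ?_⟩⟩
  rw [ht _ (List.mem_flatten.2 ⟨c, hc, first_mem (hr.tail c hc).1⟩)]
  exact (hr.tail c hc).2

theorem RunAt.cons {nx tl : ℕ → ℕ} {h : ℕ} {c : List ℕ} {r : List (List ℕ)}
    (hr : RunAt nx tl h (c :: r)) :
    c ≠ [] ∧ first c = h ∧ tl h = last c ∧ Seg nx h c (nx (last c)) ∧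
      RunAt nx tl (nx (last c)) r := by
  obtain ⟨hne, ht⟩ := hr.tail c (by simp)
  obtain ⟨m, h₁, h₂⟩ := seg_append.1 (List.flatten_cons ▸ hr.seg)
  have hm := h₁.end_eq hne
  rw [hm, h₁.eq_first hne]
  exact ⟨hne, rfl, ht, (h₁.eq_first hne) ▸ h₁, h₂, fun d hd => hr.tail d (by simp [hd])⟩

theorem RunAt.nil_iff {nx tl : ℕ → ℕ} {h : ℕ} {r : List (List ℕ)} (hr : RunAt nx tl h r)
    (h0 : 0 ∉ r.flatten) : h = 0 ↔ r = [] := by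
  constructor
  · rintro rfl
    cases r with
    | nil => rfl
    | cons c r =>
      have := hr.cons
      exact absurd (this.2.1 ▸ List.mem_flatten.2 ⟨c, by simp, first_mem this.1⟩) h0
  · rintro rfl
    exact hr.seg

/-! ### Merging linked runs -/

/-- An intermediate state of a merge: the classes `done` are linked behind the sentinel `0`, with
last node `o`, and the runs `as` and `bs`, which start with the nodes `a` and `b`, remain. -/
structure Merging (nx tl : ℕ → ℕ) (o a b : ℕ) (done as bs : List (List ℕ)) : Prop where
  nodup : (0 :: (done.flatten ++ (as.flatten ++ bs.flatten))).Nodup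
  out : ∃ e, Seg nx 0 (0 :: done.flatten) e
  o_eq : o = last (0 :: done.flatten)
  tails : ∀ c ∈ done, c ≠ [] ∧ tl (first c) = last c
  left : RunAt nx tl a as
  right : RunAt nx tl b bs

section

variable {nx tl : ℕ → ℕ} {o a b : ℕ} {done as bs : List (List ℕ)} {c d : List ℕ}

theorem Merging.symm (h : Merging nx tl o a b done as bs) : Merging nx tl o b a done bs as :=
  ⟨(((List.perm_append_comm).append_left done.flatten).cons 0).nodup_iff.1 h.nodup, h.out, h.o_eq,
    h.tails, h.right, h.left⟩

theorem Merging.o_mem (h : Merging nx tl o a b done as bs) : o ∈ 0 :: done.flatten :=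
  h.o_eq ▸ last_mem (by simp)

theorem Merging.o_notMem (h : Merging nx tl o a b done as bs) :
    o ∉ as.flatten ∧ o ∉ bs.flatten := by
  have h1 : ((0 :: done.flatten) ++ (as.flatten ++ bs.flatten)).Nodup := h.nodup
  have h2 := (List.nodup_append.1 h1).2.2 o h.o_mem
  exact ⟨fun h' => h2 o (List.mem_append_left _ h') rfl,
    fun h' => h2 o (List.mem_append_right _ h') rfl⟩

theorem Merging.takeLeft (h : Merging nx tl o a b done (c :: as) bs) :
    Merging (Function.update nx o a) tl (tl a) (Function.update nx o a (tl a)) b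
      (done ++ [c]) as bs := by
  obtain ⟨ho₁, ho₂⟩ := h.o_notMem
  obtain ⟨hne, -, hta, hseg, has⟩ := h.left.cons
  have hc : ∀ x ∈ c, x ≠ o := by
    rintro x hx rfl
    exact ho₁ (by simp [hx])
  have hl : Function.update nx o a (last c) = nx (last c) :=
    Function.update_of_ne (hc _ (last_mem hne)) _ _
  have hfl : (done ++ [c]).flatten = done.flatten ++ c := by simp
  have hout : (0 :: done.flatten).Nodup := (List.nodup_append.1
    (show ((0 :: done.flatten) ++ ((c :: as).flatten ++ bs.flatten)).Nodup from h.nodup)).1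
  obtain ⟨e, he⟩ := h.out
  refine ⟨?_, ⟨nx (last c), ?_⟩, ?_, ?_, ?_, ?_⟩
  · have := h.nodup
    rw [hfl]
    simpa [List.append_assoc] using this
  · rw [hfl, ← List.cons_append, seg_append]
    refine ⟨a, ?_, hseg.congr fun x hx => Function.update_of_ne (hc x hx) _ _⟩
    rw [h.o_eq]
    exact he.redirect (by simp) hout a
  · rw [hfl, ← List.cons_append, last_append _ hne, hta]
  · intro x hx
    rcases List.mem_append.1 hx with hx | hx
    · exact h.tails x hx
    · exact h.left.tail x (by simp_all)
  · rw [hta, hl]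
    refine has.congr (fun x hx => Function.update_of_ne ?_ _ _) fun _ _ => rfl
    rintro rfl
    exact ho₁ (by simp only [List.flatten_cons, List.mem_append]; exact Or.inr hx)
  · refine h.right.congr (fun x hx => Function.update_of_ne ?_ _ _) fun _ _ => rfl
    rintro rfl
    exact ho₂ hx

theorem Merging.join (h : Merging nx tl o a b done (c :: as) (d :: bs)) :
    Merging (Function.update (Function.update nx (tl b) (nx (tl a))) (tl a) b)
      (Function.update tl a (tl b)) o a (nx (tl b)) done ((c ++ d) :: as) bs := by
  obtain ⟨hcne, hfc, hta, hsegc, has⟩ := h.left.cons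
  obtain ⟨hdne, -, htb, hsegd, hbs⟩ := h.right.cons
  have hn := h.nodup
  have hlc := last_mem hcne
  have hld := last_mem hdne
  have hac : a ∈ c := hfc ▸ first_mem hcne
  simp only [List.flatten_cons, List.nodup_cons, List.nodup_append, List.mem_append] at hn
  obtain ⟨-, -, ⟨⟨hcn, -, hcas⟩, ⟨hdn, -, hdbs⟩, hcd⟩, hdone⟩ := hn
  rw [hta, htb]
  have hne : last c ≠ last d := hcd _ (Or.inl hlc) _ (Or.inl hld)
  set nx' := Function.update (Function.update nx (last d) (nx (last c))) (last c) b with hnx'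
  set tl' := Function.update tl a (last d) with htl'
  have hnx : ∀ x, x ≠ last c → x ≠ last d → nx' x = nx x := fun x h₁ h₂ => by
    rw [hnx', Function.update_of_ne h₁, Function.update_of_ne h₂]
  have htl : ∀ x, x ≠ a → tl' x = tl x := fun x h => Function.update_of_ne h _ _
  have hdone' : ∀ x ∈ done.flatten, x ≠ last c ∧ x ≠ last d ∧ x ≠ a := fun x hx =>
    ⟨hdone x hx _ (Or.inl (Or.inl hlc)), hdone x hx _ (Or.inr (Or.inl hld)),
      hdone x hx _ (Or.inl (Or.inl hac))⟩
  have has' : ∀ x ∈ as.flatten, x ≠ last c ∧ x ≠ last d ∧ x ≠ a := fun x hx =>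
    ⟨(hcas _ hlc x hx).symm, hcd x (Or.inr hx) _ (Or.inl hld), (hcas _ hac x hx).symm⟩
  have hbs' : ∀ x ∈ bs.flatten, x ≠ last c ∧ x ≠ last d ∧ x ≠ a := fun x hx =>
    ⟨(hcd _ (Or.inl hlc) x (Or.inr hx)).symm, (hdbs _ hld x hx).symm,
      (hcd _ (Or.inl hac) x (Or.inr hx)).symm⟩
  have hn0 := h.nodup
  have h0 : 0 ∉ c ∧ 0 ∉ d := by
    simp only [List.flatten_cons, List.nodup_cons, List.mem_append] at hn0
    exact ⟨fun h => hn0.1 (Or.inr (Or.inl (Or.inl h))), fun h => hn0.1 (Or.inr (Or.inr (Or.inl h)))⟩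
  have hsegc' : Seg nx' a c b := by
    have h1 := hsegc.redirect hcne hcn b
    refine h1.congr fun x hx => ?_
    have hxd := hcd x (Or.inl hx) _ (Or.inl hld)
    simp [hnx', Function.update_apply, hxd]
  have hsegd' : Seg nx' b d (nx (last c)) := by
    refine (hsegd.redirect hdne hdn (nx (last c))).congr fun x hx => ?_
    rw [hnx', Function.update_of_ne]
    exact (hcd _ (Or.inl hlc) x (Or.inl hx)).symm
  have hcdne : c ++ d ≠ [] := List.append_ne_nil_of_left_ne_nil hcne d
  refine ⟨?_, ?_, h.o_eq, ?_, ?_, ?_⟩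
  · refine List.Perm.nodup (List.Perm.cons 0 ?_) hn0
    refine List.Perm.append_left _ (List.perm_iff_count.2 fun x => ?_)
    simp only [List.flatten_cons, List.count_append]
    omega
  · obtain ⟨e, he⟩ := h.out
    refine ⟨e, he.congr fun x hx => ?_⟩
    rcases List.mem_cons.1 hx with rfl | hx
    · exact hnx _ (fun h => h0.1 (h ▸ hlc)) fun h => h0.2 (h ▸ hld)
    · exact hnx _ (hdone' x hx).1 (hdone' x hx).2.1
  · intro x hx
    refine ⟨(h.tails x hx).1, ?_⟩
    rw [htl _ (hdone' _ (List.mem_flatten.2 ⟨x, hx, first_mem (h.tails x hx).1⟩)).2.2]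
    exact (h.tails x hx).2
  · have has'' := has.congr (nx' := nx') (tl' := tl')
      (fun x hx => hnx _ (has' x hx).1 (has' x hx).2.1) fun x hx => htl _ (has' x hx).2.2
    refine ⟨?_, List.forall_mem_cons.2 ⟨⟨hcdne, ?_⟩, has''.tail⟩⟩
    · rw [List.flatten_cons, List.append_assoc, seg_append]
      exact ⟨b, hsegc', seg_append.2 ⟨_, hsegd', has''.seg⟩⟩
    · rw [first_append hcne, hfc, last_append _ hdne, htl', Function.update_self]
  · exact hbs.congr (fun x hx => hnx _ (hbs' x hx).1 (hbs' x hx).2.1)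
      fun x hx => htl _ (hbs' x hx).2.2

theorem Merging.finish (h : Merging nx tl o a b done as []) :
    RunAt (Function.update nx o a) tl (Function.update nx o a 0) (done ++ as) := by
  obtain ⟨e, he⟩ := h.out
  have hout : (0 :: done.flatten).Nodup := (List.nodup_append.1
    (show ((0 :: done.flatten) ++ (as.flatten ++ [].flatten)).Nodup from h.nodup)).1
  have h1 := he.redirect (by simp) hout a
  rw [← h.o_eq] at h1
  have h2 := h.left.congr (nx' := Function.update nx o a) (tl' := tl)
    (fun x hx => Function.update_of_ne (fun e : x = o => h.o_notMem.1 (e ▸ hx)) _ _) fun _ _ => rfl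
  refine ⟨?_, fun x hx => ?_⟩
  · rw [List.flatten_append, seg_append]
    exact ⟨a, h1.2, h2.seg⟩
  · rcases List.mem_append.1 hx with hx | hx
    · exact h.tails x hx
    · exact h2.tail x hx

end

/-! ### The program for sorting -/

/-! Variables and arrays of programs are numbered; these are names for the numbers. The node `0`
serves as a sentinel, and as the end of all linked lists. -/

notation "vK" => 0
notation "vM" => 1
notation "vI" => 2
notation "vP" => 3
notation "vQ" => 4
notation "vHead" => 5
notation "vNew" => 6
notation "vA" => 7
notation "vB" => 8
notation "vO" => 9
notation "vT" => 10
notation "vU" => 11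
notation "vTop" => 12
notation "vSrc" => 13
notation "vCur" => 14
notation "vW" => 15
notation "aNext" => 9
notation "aTail" => 10
notation "aRun" => 11

/-- Positive if the key of `f` exceeds the key of `e`, where keys are fractions with numerators in
the array `kn` and denominators in the array `kd`. -/
def exceeds (kn kd : ℕ) (e f : Ex) : Ex :=
  .sub (.mul (.get kn f) (.get kd e)) (.mul (.get kn e) (.get kd f))

def mergeLoop (kn kd : ℕ) : Cmd :=
  .loop (.mul (.var vA) (.var vB)) <|
    .ite (exceeds kn kd (.var vA) (.var vB))
      (.put aNext (.var vO) (.var vA) ;; .set vO (.get aTail (.var vA)) ;;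
        .set vA (.get aNext (.var vO)))
      (.ite (exceeds kn kd (.var vB) (.var vA))
        (.put aNext (.var vO) (.var vB) ;; .set vO (.get aTail (.var vB)) ;;
          .set vB (.get aNext (.var vO)))
        (.set vT (.get aTail (.var vA)) ;; .set vU (.get aTail (.var vB)) ;;
          .set vW (.get aNext (.var vU)) ;; .put aNext (.var vU) (.get aNext (.var vT)) ;;
          .put aNext (.var vT) (.var vB) ;; .put aTail (.var vA) (.var vU) ;; .set vB (.var vW)))

/-- Merges the linked runs that start with the nodes in the variables `vA` and `vB`; the first node
of the result is left in the link of the sentinel `0`. -/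
def mergeCmd (kn kd : ℕ) : Cmd :=
  .set vO (.num 0) ;; mergeLoop kn kd ;;
    .ite (.var vA) (.put aNext (.var vO) (.var vA)) (.put aNext (.var vO) (.var vB))

/-- The arrays `kn` and `kd` contain fractions with the values `key`, at least for the nodes of the
set `U`. -/
def Compares (σ : Store) (kn kd : ℕ) (key : ℕ → ℚ) (U : Set ℕ) : Prop :=
  ∀ a ∈ U, ∀ b ∈ U, σ.arr kn a * σ.arr kd b < σ.arr kn b * σ.arr kd a ↔ key a < key b

theorem exceeds_ne_zero {kn kd : ℕ} {σ : Store} {key : ℕ → ℚ} {U : Set ℕ} {e f : Ex}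
    (h : Compares σ kn kd key U) (he : e.eval σ ∈ U) (hf : f.eval σ ∈ U) :
    (exceeds kn kd e f).eval σ ≠ 0 ↔ key (e.eval σ) < key (f.eval σ) := by
  rw [← h _ he _ hf]
  simp only [exceeds, Ex.eval]
  omega

theorem Frame.compares {c : Cmd} {σ τ : Store} (hF : Frame c σ τ) {kn kd : ℕ} {key : ℕ → ℚ}
    {U : Set ℕ} (h : Compares σ kn kd key U) (h₁ : c.writesArr kn = false)
    (h₂ : c.writesArr kd = false) : Compares τ kn kd key U := by
  intro a ha b hb
  rw [hF.arr _ h₁, hF.arr _ h₂]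
  exact h a ha b hb

section

variable {lim bd kn kd : ℕ} {key : ℕ → ℚ} {σ : Store}

theorem mergeLoop_spec (hkn : kn < 9) (hkd : kd < 9) {as bs : List (List ℕ)} {U : Set ℕ}
    (hU : ∀ x, x ∈ as.flatten ∨ x ∈ bs.flatten → x ∈ U)
    (hcmp : Compares σ kn kd key U)
    (h : Merging (σ.arr aNext) (σ.arr aTail) (σ.var vO) (σ.var vA) (σ.var vB) [] as bs)
    {n : ℕ} :
    wp lim bd (mergeLoop kn kd) (fun τ m => n ≤ m ∧ ∃ done as' bs',
      TwoAgents.merge key as bs = done ++ TwoAgents.merge key as' bs' ∧ (as' = [] ∨ bs' = []) ∧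
      Merging (τ.arr aNext) (τ.arr aTail) (τ.var vO) (τ.var vA) (τ.var vB) done as' bs' ∧
      ∀ x ∉ 0 :: (as.flatten ++ bs.flatten),
        τ.arr aNext x = σ.arr aNext x ∧ τ.arr aTail x = σ.arr aTail x)
      σ (n + 1 + 12 * (as.length + bs.length)) := by
  refine wp_loop (fun τ m => ∃ done as' bs', n + 1 + 12 * (as'.length + bs'.length) ≤ m ∧
      TwoAgents.merge key as bs = done ++ TwoAgents.merge key as' bs' ∧
      (done.flatten ++ (as'.flatten ++ bs'.flatten)).Perm (as.flatten ++ bs.flatten) ∧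
      Merging (τ.arr aNext) (τ.arr aTail) (τ.var vO) (τ.var vA) (τ.var vB) done as' bs' ∧
      ∀ x ∉ 0 :: (as.flatten ++ bs.flatten),
        τ.arr aNext x = σ.arr aNext x ∧ τ.arr aTail x = σ.arr aTail x)
    ⟨[], as, bs, le_rfl, rfl, by simp, h, fun _ _ => ⟨rfl, rfl⟩⟩ ?_
  rintro τ m ⟨done, as', bs', hm, hmerge, hperm, hM, hfr⟩ hF
  have hcmp' := hF.compares hcmp
    (by simp [Cmd.writesArr]; omega) (by simp [Cmd.writesArr]; omega)
  have h0 := (List.nodup_cons.1 hM.nodup).1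
  simp only [List.mem_append, not_or] at h0
  have ha0 := hM.left.nil_iff h0.2.1
  have hb0 := hM.right.nil_iff h0.2.2
  refine ⟨by omega, fun he => ⟨by omega, done, as', bs', hmerge, ?_, hM, hfr⟩, fun he => ?_⟩
  · simpa [Ex.eval, ha0, hb0] using he
  simp only [Ex.eval, ne_eq, mul_eq_zero, not_or, ha0, hb0] at he
  obtain ⟨c, as', rfl⟩ := List.exists_cons_of_ne_nil he.1
  obtain ⟨d, bs', rfl⟩ := List.exists_cons_of_ne_nil he.2
  have hcA := hM.left.cons
  have hdB := hM.right.cons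
  have hmem : ∀ x, x ∈ 0 :: (done.flatten ++ ((c :: as').flatten ++ (d :: bs').flatten)) →
      x ∈ 0 :: (as.flatten ++ bs.flatten) := fun x hx => (hperm.cons 0).subset hx
  have hac : τ.var vA ∈ c := hcA.2.1 ▸ first_mem hcA.1
  have hbd : τ.var vB ∈ d := hdB.2.1 ▸ first_mem hdB.1
  have hUA : τ.var vA ∈ U := hU _ (List.mem_append.1 (hperm.subset (by simp [hac])))
  have hUB : τ.var vB ∈ U := hU _ (List.mem_append.1 (hperm.subset (by simp [hbd])))
  have htA : τ.arr aTail (τ.var vA) ∈ c := hcA.2.2.1 ▸ last_mem hcA.1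
  have htB : τ.arr aTail (τ.var vB) ∈ d := hdB.2.2.1 ▸ last_mem hdB.1
  have hO : τ.var vO ∈ 0 :: (as.flatten ++ bs.flatten) :=
    hmem _ (by have := hM.o_mem; simp only [List.mem_cons, List.mem_append] at this ⊢; tauto)
  have hne : ∀ {x y : ℕ}, x ∉ 0 :: (as.flatten ++ bs.flatten) →
      y ∈ 0 :: (as.flatten ++ bs.flatten) → x ≠ y := fun hx hy h => hx (h ▸ hy)
  have hinA : ∀ x ∈ c, x ∈ 0 :: (as.flatten ++ bs.flatten) := fun x hx => hmem x (by simp [hx])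
  have hinB : ∀ x ∈ d, x ∈ 0 :: (as.flatten ++ bs.flatten) := fun x hx => hmem x (by simp [hx])
  simp only [List.length_cons] at hm
  have e1 := exceeds_ne_zero (e := .var vA) (f := .var vB) hcmp' hUA hUB
  have e2 := exceeds_ne_zero (e := .var vB) (f := .var vA) hcmp' hUB hUA
  rw [wp_ite]
  refine ⟨by omega, fun hlt => ?_, fun hlt => ?_⟩
  · simp only [wp_seq, wp_put, wp_set]
    refine ⟨by omega, by omega, by omega, done ++ [c], as', d :: bs', ?_, ?_, ?_, ?_, ?_⟩
    · simp only [List.length_cons]; omega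
    · have hlt' : key (first c) < key (first d) := by
        rw [hcA.2.1, hdB.2.1]; exact e1.1 hlt
      rw [hmerge, TwoAgents.merge, if_pos hlt']
      simp
    · simpa [List.append_assoc] using hperm
    · simpa [Ex.eval, Store.setVar, Store.setArr] using hM.takeLeft
    · intro x hx
      have := hne hx hO
      simpa [Ex.eval, Store.setVar, Store.setArr, this] using hfr x hx
  rw [wp_ite]
  refine ⟨by omega, fun hgt => ?_, fun hgt => ?_⟩
  · simp only [wp_seq, wp_put, wp_set]
    refine ⟨by omega, by omega, by omega, done ++ [d], c :: as', bs', ?_, ?_, ?_, ?_, ?_⟩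
    · simp only [List.length_cons]; omega
    · have h1 : ¬ key (first c) < key (first d) := by
        rw [hcA.2.1, hdB.2.1]; exact fun h => e1.2 h hlt
      have h2 : key (first d) < key (first c) := by
        rw [hcA.2.1, hdB.2.1]; exact e2.1 hgt
      rw [hmerge, TwoAgents.merge, if_neg h1, if_pos h2]
      simp
    · refine List.Perm.trans (List.perm_iff_count.2 fun x => ?_) hperm
      simp only [List.flatten_cons, List.flatten_append, List.count_append, List.flatten_nil,
        List.count_nil]
      omega
    · simpa [Ex.eval, Store.setVar, Store.setArr] using hM.symm.takeLeft.symm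
    · intro x hx
      have := hne hx hO
      simpa [Ex.eval, Store.setVar, Store.setArr, this] using hfr x hx
  · simp only [wp_seq, wp_put, wp_set]
    refine ⟨by omega, by omega, by omega, by omega, by omega, by omega, by omega,
      done, (c ++ d) :: as', bs', ?_, ?_, ?_, ?_, ?_⟩
    · simp only [List.length_cons]; omega
    · have h1 : ¬ key (first c) < key (first d) := by
        rw [hcA.2.1, hdB.2.1]; exact fun h => e1.2 h hlt
      have h2 : ¬ key (first d) < key (first c) := by
        rw [hcA.2.1, hdB.2.1]; exact fun h => e2.2 h hgt
      rw [hmerge, TwoAgents.merge, if_neg h1, if_neg h2]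
    · refine List.Perm.trans (List.perm_iff_count.2 fun x => ?_) hperm
      simp only [List.flatten_cons, List.count_append]
      omega
    · simpa [Ex.eval, Store.setVar, Store.setArr] using hM.join
    · intro x hx
      have h1 := hne hx (hinA _ htA)
      have h2 := hne hx (hinB _ htB)
      have h3 := hne hx (hinA _ hac)
      simpa [Ex.eval, Store.setVar, Store.setArr, h1, h2, h3] using hfr x hx

theorem mergeCmd_spec (hkn : kn < 9) (hkd : kd < 9) {as bs : List (List ℕ)} {U : Set ℕ}
    (hU : ∀ x, x ∈ as.flatten ∨ x ∈ bs.flatten → x ∈ U)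
    (hcmp : Compares σ kn kd key U)
    (hn : (0 :: (as.flatten ++ bs.flatten)).Nodup)
    (ha : RunAt (σ.arr aNext) (σ.arr aTail) (σ.var vA) as)
    (hb : RunAt (σ.arr aNext) (σ.arr aTail) (σ.var vB) bs) {n : ℕ} :
    wp lim bd (mergeCmd kn kd) (fun τ m => n ≤ m ∧
      RunAt (τ.arr aNext) (τ.arr aTail) (τ.arr aNext 0) (TwoAgents.merge key as bs) ∧
      ∀ x ∉ 0 :: (as.flatten ++ bs.flatten),
        τ.arr aNext x = σ.arr aNext x ∧ τ.arr aTail x = σ.arr aTail x)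
      σ (n + 4 + 12 * (as.length + bs.length)) := by
  rw [mergeCmd, wp_seq, wp_set]
  refine ⟨by omega, ?_⟩
  rw [wp_seq, show n + 4 + 12 * (as.length + bs.length) - 1 =
    (n + 2) + 1 + 12 * (as.length + bs.length) by omega]
  refine (mergeLoop_spec (n := n + 2) hkn hkd hU (σ := σ.setVar vO _) hcmp ?_).mono ?_
  · exact ⟨by simpa using hn, ⟨_, rfl, rfl⟩, by simp [Store.setVar, Ex.eval, last], by simp,
      by simpa [Store.setVar] using ha, by simpa [Store.setVar] using hb⟩
  rintro τ m - - ⟨hm, done, as', bs', hmerge, hend, hM, hfr⟩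
  have h0 := (List.nodup_cons.1 hM.nodup).1
  simp only [List.mem_append, not_or] at h0
  have ha0 := hM.left.nil_iff h0.2.1
  have hb0 := hM.right.nil_iff h0.2.2
  have hO : ∀ x ∉ 0 :: (as.flatten ++ bs.flatten), x ≠ τ.var vO := by
    rintro x hx rfl
    have h1 := hM.o_mem
    have h2 := (merge_perm key as bs).mem_iff (a := τ.var vO)
    rw [hmerge, List.flatten_append] at h2
    refine hx ?_
    rw [List.mem_cons] at h1 ⊢
    exact h1.imp_right fun h => h2.1 (List.mem_append_left _ h)
  rw [wp_ite]
  refine ⟨by omega, fun he => ?_, fun he => ?_⟩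
  · rw [wp_put]
    have : bs' = [] := hend.resolve_left fun h => he (ha0.2 h)
    subst this
    refine ⟨by omega, by omega, ?_, fun x hx => ?_⟩
    · rw [hmerge, merge_nil]
      simpa [Ex.eval, Store.setArr] using hM.finish
    · simpa [Ex.eval, Store.setArr, Store.setVar, hO x hx] using hfr x hx
  · rw [wp_put]
    have : as' = [] := ha0.1 he
    subst this
    refine ⟨by omega, by omega, ?_, fun x hx => ?_⟩
    · rw [hmerge, TwoAgents.merge]
      simpa [Ex.eval, Store.setArr] using hM.symm.finish
    · simpa [Ex.eval, Store.setArr, Store.setVar, hO x hx] using hfr x hx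

end

/-! ### The rounds of the merge sort -/

/-- One round of the merge sort: merges the runs in pairs. The first nodes of the runs are linked by
the array `aRun`, starting from the node in `vHead`. -/
def mergePairsCmd (kn kd : ℕ) : Cmd :=
  .set vNew (.num 0) ;;
  .loop (.var vHead)
    (.set vA (.var vHead) ;; .set vB (.get aRun (.var vA)) ;; .set vHead (.get aRun (.var vB)) ;;
      mergeCmd kn kd ;;
      .set vA (.get aNext (.num 0)) ;; .put aRun (.var vA) (.var vNew) ;; .set vNew (.var vA)) ;;
  .set vHead (.var vNew)

/-- The runs `rs` are stored as linked lists, and their first nodes are linked by `rn`, starting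
with `h`. -/
structure RunsAt (nx tl rn : ℕ → ℕ) (h : ℕ) (rs : List (List (List ℕ))) : Prop where
  heads : Seg rn h (rs.map fun r => first r.flatten) 0
  runs : ∀ r ∈ rs, r ≠ [] ∧ RunAt nx tl (first r.flatten) r

theorem RunAt.flatten_ne_nil {nx tl : ℕ → ℕ} {h : ℕ} {r : List (List ℕ)} (hr : RunAt nx tl h r)
    (hne : r ≠ []) : r.flatten ≠ [] := by
  obtain ⟨c, r, rfl⟩ := List.exists_cons_of_ne_nil hne
  simp [(hr.tail c (by simp)).1]

theorem RunsAt.congr {nx tl rn nx' tl' rn' : ℕ → ℕ} {h : ℕ} {rs : List (List (List ℕ))}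
    (hr : RunsAt nx tl rn h rs)
    (hx : ∀ x ∈ rs.flatten.flatten, nx' x = nx x ∧ tl' x = tl x ∧ rn' x = rn x) :
    RunsAt nx' tl' rn' h rs := by
  have hmem : ∀ r ∈ rs, ∀ x ∈ r.flatten, x ∈ rs.flatten.flatten := by
    intro r hr x hx
    obtain ⟨c, hc, hxc⟩ := List.mem_flatten.1 hx
    exact List.mem_flatten.2 ⟨c, List.mem_flatten.2 ⟨r, hr, hc⟩, hxc⟩
  refine ⟨hr.heads.congr fun x hx' => ?_, fun r h => ⟨(hr.runs r h).1, (hr.runs r h).2.congr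
    (fun x h' => (hx x (hmem r h x h')).1) (fun x h' => (hx x (hmem r h x h')).2.1)⟩⟩
  obtain ⟨r, h, rfl⟩ := List.mem_map.1 hx'
  exact (hx _ (hmem r h _ (first_mem ((hr.runs r h).2.flatten_ne_nil (hr.runs r h).1)))).2.2

/-- The first two runs of a list; the second one is empty if there is only one. -/
theorem RunsAt.split {nx tl rn : ℕ → ℕ} (h0 : rn 0 = 0) {h : ℕ} {a : List (List ℕ)}
    {rest : List (List (List ℕ))} (hr : RunsAt nx tl rn h (a :: rest)) :
    ∃ b rest', (∀ key z, mergePairs key (a :: rest) z = mergePairs key rest' (merge key a b :: z)) ∧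
      RunAt nx tl h a ∧ RunAt nx tl (rn h) b ∧ RunsAt nx tl rn (rn (rn h)) rest' ∧
      rest.flatten = b ++ rest'.flatten ∧
      rest.length ≤ rest'.length + 1 ∧ rest'.length ≤ rest.length ∧
      (rest.map List.length).sum = b.length + (rest'.map List.length).sum := by
  obtain ⟨hh, hs⟩ := hr.heads
  cases rest with
  | nil =>
    have hs' : rn h = 0 := by rw [hh]; exact hs
    refine ⟨[], [], fun _ _ => rfl, hh ▸ (hr.runs a (by simp)).2, ?_, ?_, by simp, by simp, by simp,
      by simp⟩
    · exact ⟨hs', by simp⟩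
    · exact ⟨by rw [hs']; exact h0, by simp⟩
  | cons b rest =>
    obtain ⟨hb, hs'⟩ := hs
    rw [← hh] at hb
    refine ⟨b, rest, fun _ _ => rfl, hh ▸ (hr.runs a (by simp)).2, hb ▸ (hr.runs b (by simp)).2, ?_,
      by simp, by simp, by simp, by simp⟩
    refine ⟨?_, fun r h => hr.runs r (by simp [h])⟩
    rw [hb]; exact hs'

section

variable {lim bd kn kd : ℕ} {key : ℕ → ℚ} {σ : Store}

theorem merge_ne_nil {as bs : List (List ℕ)} (ha : as.flatten ≠ []) : merge key as bs ≠ [] := by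
  intro h
  have := (merge_perm key as bs).length_eq
  rw [h] at this
  simp only [List.flatten_nil, List.length_nil, List.length_append] at this
  exact ha (List.length_eq_zero_iff.1 (by omega))

theorem mergePairsCmd_spec (hkn : kn < 9) (hkd : kd < 9) {rs : List (List (List ℕ))} {U : Set ℕ}
    (hU : ∀ x ∈ rs.flatten.flatten, x ∈ U) (hcmp : Compares σ kn kd key U)
    (hn : (0 :: rs.flatten.flatten).Nodup) (h0 : σ.arr aRun 0 = 0)
    (hrs : RunsAt (σ.arr aNext) (σ.arr aTail) (σ.arr aRun) (σ.var vHead) rs) {n : ℕ} :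
    wp lim bd (mergePairsCmd kn kd) (fun τ m => n ≤ m ∧ τ.arr aRun 0 = 0 ∧
      RunsAt (τ.arr aNext) (τ.arr aTail) (τ.arr aRun) (τ.var vHead) (mergePairs key rs []))
      σ (n + 3 + 20 * rs.length + 12 * (rs.map List.length).sum) := by
  rw [mergePairsCmd, wp_seq, wp_set]
  refine ⟨by omega, ?_⟩
  rw [wp_seq]
  refine wp_loop (fun τ m => ∃ todo z,
    n + 2 + 20 * todo.length + 12 * (todo.map List.length).sum ≤ m ∧
    mergePairs key rs [] = mergePairs key todo z ∧
    (todo ++ z).flatten.flatten.Perm rs.flatten.flatten ∧ τ.arr aRun 0 = 0 ∧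
    RunsAt (τ.arr aNext) (τ.arr aTail) (τ.arr aRun) (τ.var vHead) todo ∧
    RunsAt (τ.arr aNext) (τ.arr aTail) (τ.arr aRun) (τ.var vNew) z)
    ⟨rs, [], by omega, rfl, by simp, h0, hrs, ⟨by simp [Store.setVar, Seg, Ex.eval], by simp⟩⟩ ?_
  rintro τ m ⟨todo, z, hm, hmp, hperm, hr0, htodo, hz⟩ hF
  have hcmp' : Compares τ kn kd key U := hF.compares (σ := σ.setVar vNew _) hcmp
    (by simp [Cmd.writesArr, mergeCmd, mergeLoop]; omega)
    (by simp [Cmd.writesArr, mergeCmd, mergeLoop]; omega)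
  have hn' : (0 :: (todo ++ z).flatten.flatten).Nodup := (hperm.cons 0).nodup_iff.2 hn
  refine ⟨by omega, fun he => ?_, fun he => ?_⟩
  · rw [wp_set]
    cases todo with
    | nil => exact ⟨by omega, by omega, hr0, hmp ▸ hz⟩
    | cons a todo =>
      obtain ⟨hne, ha⟩ := htodo.runs a (by simp)
      have h1 : τ.var vHead = first a.flatten := htodo.heads.1
      have h2 := first_mem (ha.flatten_ne_nil hne)
      rw [← h1, show τ.var vHead = 0 from he] at h2
      exact absurd (by simp only [List.cons_append, List.flatten_cons, List.flatten_append,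
        List.mem_append]; exact Or.inl h2) (List.nodup_cons.1 hn').1
  cases todo with
  | nil => exact absurd htodo.heads he
  | cons a todo =>
  obtain ⟨b, rest, hmp', ha, hb, hrest, hfl, hlen, hlen', hsum⟩ := htodo.split hr0
  have hane := (htodo.runs a (by simp)).1
  have hperm' : (((a.flatten ++ b.flatten) ++ rest.flatten.flatten) ++ z.flatten.flatten).Perm
      rs.flatten.flatten := by
    refine List.Perm.trans (List.Perm.of_eq ?_) hperm
    simp [hfl]
  have hn'' :
      (0 :: (((a.flatten ++ b.flatten) ++ rest.flatten.flatten) ++ z.flatten.flatten)).Nodup :=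
    (hperm'.cons 0).nodup_iff.2 hn
  simp only [List.nodup_cons, List.nodup_append, List.mem_append, not_or] at hn''
  obtain ⟨⟨⟨⟨h0a, h0b⟩, h0r⟩, h0z⟩, ⟨⟨hna, hnb, hab⟩, -, hnr⟩, -, hnz⟩ := hn''
  simp only [List.length_cons, List.map_cons, List.sum_cons, hsum] at hm
  simp only [wp_seq, wp_set]
  refine ⟨by omega, by omega, by omega, ?_⟩
  rw [show m - 1 - 1 - 1 - 1 = (m - 8 - 12 * (a.length + b.length)) + 4 + 12 * (a.length + b.length)
    by omega]
  refine (mergeCmd_spec hkn hkd (U := U) (as := a) (bs := b) ?_ (by exact hcmp') ?_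
    (by simpa [Store.setVar, Ex.eval] using ha) (by simpa [Store.setVar, Ex.eval] using hb)).mono ?_
  · intro x hx
    exact hU x (hperm'.subset (by simp only [List.mem_append]; tauto))
  · simp only [List.nodup_cons, List.nodup_append, List.mem_append]
    exact ⟨by tauto, hna, hnb, hab⟩
  rintro υ m' - hF' ⟨hm', hrun, hfr⟩
  have ev : υ.var vHead = τ.arr aRun (τ.arr aRun (τ.var vHead)) := by
    simpa [Store.setVar, Ex.eval] using hF'.var vHead rfl
  have enew : υ.var vNew = τ.var vNew := by
    simpa [Store.setVar, Ex.eval] using hF'.var vNew rfl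
  have erun : υ.arr aRun = τ.arr aRun := hF'.arr aRun rfl
  have hmne : merge key a b ≠ [] := merge_ne_nil (ha.flatten_ne_nil hane)
  have hhead : υ.arr aNext 0 = first (merge key a b).flatten :=
    hrun.seg.eq_first (hrun.flatten_ne_nil hmne)
  have hheadmem : υ.arr aNext 0 ∈ a.flatten ++ b.flatten :=
    (merge_perm key a b).subset (hhead ▸ first_mem (hrun.flatten_ne_nil hmne))
  have hhead0 : 0 ≠ υ.arr aNext 0 := by
    intro h
    rw [← h, List.mem_append] at hheadmem
    tauto
  have frame : ∀ x, (x ∈ rest.flatten.flatten ∨ x ∈ z.flatten.flatten) →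
      υ.arr aNext x = τ.arr aNext x ∧ υ.arr aTail x = τ.arr aTail x ∧
      Function.update (υ.arr aRun) (υ.arr aNext 0) (υ.var vNew) x = τ.arr aRun x := by
    intro x hx
    have hx' : x ∉ 0 :: (a.flatten ++ b.flatten) := by
      intro h
      rcases List.mem_cons.1 h with rfl | h
      · tauto
      · rw [List.mem_append] at h
        rcases hx with hx | hx
        · exact hnr x h x hx rfl
        · exact hnz x (Or.inl h) x hx rfl
    have hx'' : x ≠ υ.arr aNext 0 := fun h => hx' (List.mem_cons_of_mem _ (h ▸ hheadmem))
    rw [Function.update_of_ne hx'', erun]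
    exact ⟨(hfr x hx').1, (hfr x hx').2, rfl⟩
  simp only [wp_seq, wp_put, wp_set]
  refine ⟨by omega, by omega, by omega, rest, merge key a b :: z, by omega, ?_, ?_, ?_, ?_, ?_⟩
  · rw [hmp, hmp']
  · refine List.Perm.trans (List.perm_iff_count.2 fun x => ?_) hperm'
    have := (merge_perm key a b).count_eq x
    simp only [List.flatten_append, List.flatten_cons, List.count_append] at *
    omega
  · simp [Store.setVar, Store.setArr, Ex.eval, hhead0, erun, hr0]
  · have := hrest.congr fun x hx => frame x (Or.inl hx)
    simpa [Store.setVar, Store.setArr, Ex.eval, ev] using this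
  · have hz' := hz.congr fun x hx => frame x (Or.inr hx)
    refine ⟨?_, List.forall_mem_cons.2 ⟨⟨hmne, ?_⟩, fun r hr => ?_⟩⟩
    · rw [List.map_cons]
      refine ⟨by simpa [Store.setVar, Store.setArr, Ex.eval] using hhead, ?_⟩
      rw [← hhead]
      have := hz'.heads
      simpa [Store.setVar, Store.setArr, Ex.eval, enew] using this
    · rw [← hhead]
      simpa [Store.setVar, Store.setArr, Ex.eval] using hrun
    · simpa [Store.setVar, Store.setArr, Ex.eval] using hz'.runs r hr

/-- Merges runs until there is only one. -/
def mergeAllCmd (kn kd : ℕ) : Cmd :=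
  .loop (.get aRun (.var vHead)) (mergePairsCmd kn kd)

/-- The number of credits for the rounds from round `j` on, when there are `M` nodes with at most
`2 ^ L` different keys. Before round `L` the runs may contain `M` classes in total; afterwards they
contain at most `2 ^ L` classes each, so that the total halves in each round. -/
def roundCredits (M L j : ℕ) : ℕ := 38 * (M * (L - j) + 4 * M / 2 ^ (j - L))

theorem roundCredits_step {M L j R S : ℕ} (hR : 2 ≤ R) (hj : (R - 1) * 2 ^ j ≤ M) (hSM : S ≤ M)
    (hS : S ≤ 2 ^ L * R) : 38 * S + roundCredits M L (j + 1) ≤ roundCredits M L j := by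
  rw [roundCredits, roundCredits, ← Nat.mul_add]
  refine Nat.mul_le_mul_left _ ?_
  rcases lt_or_ge j L with h | h
  · have e1 : L - j = L - (j + 1) + 1 := by omega
    have e2 : j + 1 - L = 0 := by omega
    have e3 : j - L = 0 := by omega
    rw [e1, e2, e3, Nat.mul_add]
    omega
  · obtain ⟨i, rfl⟩ := Nat.exists_eq_add_of_le h
    have e1 : L - (L + i) = 0 := by omega
    have e2 : L - (L + i + 1) = 0 := by omega
    have e3 : L + i + 1 - L = i + 1 := by omega
    have e4 : L + i - L = i := by omega
    rw [e1, e2, e3, e4]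
    have h1 : (R - 1) * 2 ^ L ≤ M / 2 ^ i := by
      rw [Nat.le_div_iff_mul_le (by positivity), mul_assoc, ← pow_add]; exact hj
    have h2 : S ≤ 2 * (M / 2 ^ i) := by
      calc S ≤ 2 ^ L * R := hS
        _ ≤ 2 ^ L * (2 * (R - 1)) := Nat.mul_le_mul_left _ (by omega)
        _ = 2 * ((R - 1) * 2 ^ L) := by ring
        _ ≤ _ := Nat.mul_le_mul_left _ h1
    have h3 : 4 * (M / 2 ^ i) ≤ 4 * M / 2 ^ i := Nat.mul_div_le_mul_div_assoc _ _ _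
    have h4 : 4 * M / 2 ^ (i + 1) = 4 * M / 2 ^ i / 2 := by rw [pow_succ, Nat.div_div_eq_div_mul]
    omega

theorem length_le_of_ne_nil {r : List (List ℕ)} (h : ∀ c ∈ r, c ≠ []) :
    r.length ≤ r.flatten.length := by
  induction r with
  | nil => simp
  | cons c r ih =>
    have h1 := List.length_pos_of_ne_nil (h c (by simp))
    have h2 := ih fun d hd => h d (by simp [hd])
    simp only [List.length_cons, List.flatten_cons, List.length_append]
    omega

theorem sum_length_le {rs : List (List (List ℕ))} (h : ∀ r ∈ rs, ∀ c ∈ r, c ≠ []) :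
    (rs.map List.length).sum ≤ rs.flatten.flatten.length := by
  induction rs with
  | nil => simp
  | cons r rs ih =>
    have h1 := length_le_of_ne_nil (h r (by simp))
    have h2 := ih fun d hd => h d (by simp [hd])
    simp only [List.map_cons, List.sum_cons, List.flatten_cons, List.flatten_append,
      List.length_append]
    omega

theorem length_le_sum {rs : List (List (List ℕ))} (h : ∀ r ∈ rs, r ≠ []) :
    rs.length ≤ (rs.map List.length).sum := by
  induction rs with
  | nil => simp
  | cons r rs ih =>
    have h1 := List.length_pos_of_ne_nil (h r (by simp))
    have h2 := ih fun d hd => h d (by simp [hd])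
    simp only [List.map_cons, List.sum_cons, List.length_cons]
    omega

theorem sum_le_mul {rs : List (List (List ℕ))} {D : ℕ} (h : ∀ r ∈ rs, r.length ≤ D) :
    (rs.map List.length).sum ≤ D * rs.length := by
  induction rs with
  | nil => simp
  | cons r rs ih =>
    have h1 := h r (by simp)
    have h2 := ih fun d hd => h d (by simp [hd])
    simp only [List.map_cons, List.sum_cons, List.length_cons, Nat.mul_succ]
    omega

theorem mergeAllCmd_spec (hkn : kn < 9) (hkd : kd < 9) {rs : List (List (List ℕ))} {N : List ℕ}
    {L : ℕ} (hL : ∀ l : List ℕ, (∀ x ∈ l, x ∈ N) → l.Pairwise (fun x y => key x ≠ key y) →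
      l.length ≤ 2 ^ L)
    (hcmp : Compares σ kn kd key {x | x ∈ N}) (hN : (0 :: N).Nodup) (hne : rs ≠ [])
    (hperm : rs.flatten.flatten.Perm N) (hrun : ∀ r ∈ rs, IsRun key r) (h0 : σ.arr aRun 0 = 0)
    (hrs : RunsAt (σ.arr aNext) (σ.arr aTail) (σ.arr aRun) (σ.var vHead) rs) {n : ℕ} :
    wp lim bd (mergeAllCmd kn kd) (fun τ m => n ≤ m ∧ τ.arr aRun 0 = 0 ∧ ∃ r, IsRun key r ∧
      r.flatten.Perm N ∧ RunAt (τ.arr aNext) (τ.arr aTail) (τ.var vHead) r)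
      σ (n + 1 + 38 * (N.length * (L + 4))) := by
  have hbound : ∀ rs : List (List (List ℕ)), rs.flatten.flatten.Perm N → (∀ r ∈ rs, IsRun key r) →
      (rs.map List.length).sum ≤ N.length ∧ (rs.map List.length).sum ≤ 2 ^ L * rs.length := by
    intro rs hperm hrun
    refine ⟨hperm.length_eq ▸ sum_length_le fun r hr => (hrun r hr).ne_nil,
      sum_le_mul fun r hr => ?_⟩
    have := hL (r.map first) (fun x hx => ?_) ?_
    · simpa using this
    · obtain ⟨c, hc, rfl⟩ := List.mem_map.1 hx
      exact hperm.subset (List.mem_flatten.2 ⟨c, List.mem_flatten.2 ⟨r, hr, hc⟩,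
        first_mem ((hrun r hr).ne_nil c hc)⟩)
    · rw [List.pairwise_map]
      exact (hrun r hr).sorted.imp fun h => h.ne
  refine wp_loop (fun τ m => ∃ rs j, n + 1 + roundCredits N.length L j ≤ m ∧
    (rs.length - 1) * 2 ^ j ≤ N.length ∧ rs ≠ [] ∧ rs.flatten.flatten.Perm N ∧
    (∀ r ∈ rs, IsRun key r) ∧ τ.arr aRun 0 = 0 ∧
    RunsAt (τ.arr aNext) (τ.arr aTail) (τ.arr aRun) (τ.var vHead) rs)
    ⟨rs, 0, ?_, ?_, hne, hperm, hrun, h0, hrs⟩ ?_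
  · simp only [roundCredits, Nat.sub_zero, Nat.zero_sub, pow_zero, Nat.div_one]
    nlinarith
  · have := length_le_sum fun r hr => (hrs.runs r hr).1
    have := (hbound rs hperm hrun).1
    simp only [pow_zero]
    omega
  clear hperm hrun h0 hrs hne
  rintro τ m ⟨rs, j, hm, hj, hne, hperm, hrun, h0, hrs⟩ hF
  have hcmp' := hF.compares hcmp
      (by simp [Cmd.writesArr, mergePairsCmd, mergeCmd, mergeLoop]; omega)
    (by simp [Cmd.writesArr, mergePairsCmd, mergeCmd, mergeLoop]; omega)
  have hn : (0 :: rs.flatten.flatten).Nodup := (hperm.cons 0).nodup_iff.2 hN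
  obtain ⟨a, rest, rfl⟩ := List.exists_cons_of_ne_nil hne
  have hhead : τ.var vHead = first a.flatten := hrs.heads.1
  have hrest : RunsAt (τ.arr aNext) (τ.arr aTail) (τ.arr aRun) (τ.arr aRun (τ.var vHead)) rest :=
    ⟨hhead ▸ hrs.heads.2, fun r h => hrs.runs r (by simp [h])⟩
  refine ⟨by omega, fun he => ⟨by omega, h0, a, hrun a (by simp), ?_, ?_⟩, fun he => ?_⟩
  · cases rest with
    | nil => simpa using hperm
    | cons b rest =>
      obtain ⟨hbne, hb⟩ := hrest.runs b (by simp)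
      have h1 : τ.arr aRun (τ.var vHead) = first b.flatten := hrest.heads.1
      have h2 := first_mem (hb.flatten_ne_nil hbne)
      rw [← h1, show τ.arr aRun (τ.var vHead) = 0 from he] at h2
      refine absurd ?_ (List.nodup_cons.1 hn).1
      simp only [List.flatten_cons, List.flatten_append, List.mem_append]
      exact Or.inr (Or.inl h2)
  · rw [hhead]; exact (hrs.runs a (by simp)).2
  · have hR : 2 ≤ (a :: rest).length := by
      cases rest with
      | nil => exact absurd hrest.heads he
      | cons => simp
    obtain ⟨hb₁, hb₂⟩ := hbound _ hperm hrun
    have hb₃ := length_le_sum fun r hr => (hrs.runs r hr).1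
    have hstep := roundCredits_step hR hj hb₁ hb₂
    generalize hrs' : a :: rest = rs at *
    obtain ⟨n', hn'⟩ := Nat.exists_eq_add_of_le
      (show 3 + 20 * rs.length + 12 * (rs.map List.length).sum ≤ m - 1 by omega)
    rw [show m - 1 = n' + 3 + 20 * rs.length + 12 * (rs.map List.length).sum by omega]
    refine (mergePairsCmd_spec hkn hkd (U := {x | x ∈ N}) (fun x hx => hperm.subset hx) hcmp' hn h0
      hrs).mono ?_
    rintro υ m' - - ⟨hm', h0', hrs''⟩
    have hlen : (mergePairs key rs []).length = (rs.length + 1) / 2 := by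
      rw [mergePairs_length]; rfl
    refine ⟨_, j + 1, by omega, ?_, ?_, ?_, ?_, h0', hrs''⟩
    · rw [hlen, pow_succ']
      have h1 : ((rs.length + 1) / 2 - 1) * 2 ≤ rs.length - 1 := by omega
      calc ((rs.length + 1) / 2 - 1) * (2 * 2 ^ j)
          = ((rs.length + 1) / 2 - 1) * 2 * 2 ^ j := by ring
        _ ≤ (rs.length - 1) * 2 ^ j := Nat.mul_le_mul_right _ h1
        _ ≤ _ := hj
    · exact List.ne_nil_of_length_pos (by omega)
    · exact (mergePairs_perm rs []).trans (by simpa using hperm)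
    · exact mergePairs_forall (fun _ _ h₁ h₂ => h₁.merge h₂)
        ⟨by simp, by simp, by simp⟩ hrun (by simp)

end

/-! ### Sorted lists for all groups -/

/-- The nodes `n, n - 1, …, 1`. -/
def nodes : ℕ → List ℕ
  | 0 => []
  | n + 1 => (n + 1) :: nodes n

theorem mem_nodes {n x : ℕ} : x ∈ nodes n ↔ 1 ≤ x ∧ x ≤ n := by
  induction n with
  | zero => simp [nodes]; omega
  | succ n ih => rw [nodes, List.mem_cons, ih]; omega

theorem length_nodes (n : ℕ) : (nodes n).length = n := by
  induction n with
  | zero => rfl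
  | succ n ih => rw [nodes, List.length_cons, ih]

theorem nodup_nodes (n : ℕ) : (0 :: nodes n).Nodup := by
  refine List.nodup_cons.2 ⟨by simp [mem_nodes], ?_⟩
  induction n with
  | zero => exact List.nodup_nil
  | succ n ih => exact List.nodup_cons.2 ⟨by simp [mem_nodes], ih⟩

theorem seg_nodes {rn : ℕ → ℕ} {n : ℕ} (h : ∀ x, 1 ≤ x → x ≤ n → rn x = x - 1) :
    Seg rn n (nodes n) 0 := by
  induction n with
  | zero => rfl
  | succ n ih =>
    refine ⟨rfl, ?_⟩
    rw [h (n + 1) (by omega) le_rfl]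
    exact ih fun x h1 h2 => h x h1 (by omega)

/-- Makes every node a run of its own, the runs being linked in the order of `nodes`. -/
def initRunsCmd : Cmd :=
  .set vI (.var vM) ;;
  .loop (.var vI)
    (.put aNext (.var vI) (.num 0) ;; .put aTail (.var vI) (.var vI) ;;
      .put aRun (.var vI) (.sub (.var vI) (.num 1)) ;; .set vI (.sub (.var vI) (.num 1))) ;;
  .set vHead (.var vM)

/-- Distributes the nodes of the list at `vHead` to one list for each group: `g` holds the group of
each node, `hd` the first node of each group's list, and `lk` the links. -/
def distributeCmd (g hd lk : ℕ) : Cmd :=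
  .loop (.var vHead)
    (.put lk (.var vHead) (.get hd (.get g (.var vHead))) ;;
      .put hd (.get g (.var vHead)) (.var vHead) ;;
      .set vHead (.get aNext (.var vHead)))

/-- Sorts the nodes `1, …, vM` by keys and distributes them to one list for each group. -/
def sortCmd (kn kd g hd lk : ℕ) : Cmd :=
  initRunsCmd ;; mergeAllCmd kn kd ;; distributeCmd g hd lk

/-- The list linked by `lk` and starting with `h` contains the nodes of the set `U`, in an order in
which the keys do not increase. -/
def SortedList (lk : ℕ → ℕ) (h : ℕ) (key : ℕ → ℚ) (U : Set ℕ) (l : List ℕ) : Prop :=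
  Seg lk h l 0 ∧ l.Nodup ∧ (l.Pairwise fun x y => key y ≤ key x) ∧ ∀ x, x ∈ l ↔ x ∈ U

section

variable {lim bd kn kd : ℕ} {key : ℕ → ℚ} {σ : Store}

theorem initRunsCmd_spec {M : ℕ} (hM : σ.var vM = M) (h0 : σ.arr aRun 0 = 0) {n : ℕ} :
    wp lim bd initRunsCmd (fun τ m => n ≤ m ∧ τ.arr aRun 0 = 0 ∧
      RunsAt (τ.arr aNext) (τ.arr aTail) (τ.arr aRun) (τ.var vHead) ((nodes M).map fun x => [[x]]))
      σ (n + 3 + 5 * M) := by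
  simp only [initRunsCmd, wp_seq, wp_set]
  refine ⟨by omega, ?_⟩
  refine wp_loop (fun τ m => n + 2 + 5 * τ.var vI ≤ m ∧ τ.var vI ≤ M ∧ τ.arr aRun 0 = 0 ∧
    ∀ x, τ.var vI < x → x ≤ M → τ.arr aNext x = 0 ∧ τ.arr aTail x = x ∧ τ.arr aRun x = x - 1)
    ?_ ?_
  · simp only [Store.setVar, Ex.eval, hM, Function.update_self]
    exact ⟨by omega, le_rfl, h0, fun x h1 h2 => by omega⟩
  rintro τ m ⟨hm, hi, h0', hx⟩ hF
  have hM' : τ.var vM = M := by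
    have := hF.var vM rfl
    simpa [Store.setVar, hM] using this
  refine ⟨by omega, fun he => ?_, fun he => ?_⟩
  · have he' : τ.var vI = 0 := he
    rw [wp_set]
    refine ⟨by omega, by omega, h0', ?_, fun r hr => ?_⟩
    · rw [List.map_map, show ((fun r : List (List ℕ) => first r.flatten) ∘ fun x => [[x]]) = id from
        by ext x; simp [first], List.map_id]
      simpa [Store.setVar, Ex.eval, hM'] using
        seg_nodes fun x h1 h2 => (hx x (by omega) h2).2.2
    · obtain ⟨x, hx', rfl⟩ := List.mem_map.1 hr
      rw [mem_nodes] at hx'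
      obtain ⟨h1, h2, -⟩ := hx x (by omega) hx'.2
      refine ⟨by simp, ?_, ?_⟩
      · simpa [Seg, first, Store.setVar] using h1
      · simpa [first, last, Store.setVar] using h2
  · have he' : τ.var vI ≠ 0 := he
    simp only [wp_seq, wp_put, wp_set]
    refine ⟨by omega, by omega, by omega, by omega, ?_, ?_, ?_, ?_⟩
    · simp [Store.setVar, Store.setArr, Ex.eval]; omega
    · simp [Store.setVar, Store.setArr, Ex.eval]; omega
    · simpa [Store.setVar, Store.setArr, Ex.eval, he'.symm] using h0'
    · intro x h1 h2
      simp only [Store.setVar, Store.setArr, Ex.eval, Function.update_self] at h1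
      by_cases hxi : x = τ.var vI
      · subst hxi
        simp [Store.setVar, Store.setArr, Ex.eval]
      · have := hx x (by omega) h2
        simpa [Store.setVar, Store.setArr, Ex.eval, hxi] using this

theorem distributeCmd_spec {g hd lk : ℕ} (h₁ : lk ≠ hd) (h₂ : lk ≠ g) (h₃ : hd ≠ g)
    (h₄ : lk ≠ aNext) (h₅ : hd ≠ aNext) {F : List ℕ} (hF : (0 :: F).Nodup)
    (hseg : Seg (σ.arr aNext) (σ.var vHead) F 0) (h0 : ∀ y, σ.arr hd y = 0) {n : ℕ} :
    wp lim bd (distributeCmd g hd lk) (fun τ m => n ≤ m ∧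
      ∀ y, Seg (τ.arr lk) (τ.arr hd y) (F.filter fun x => σ.arr g x = y).reverse 0)
      σ (n + 1 + 4 * F.length) := by
  refine wp_loop (fun τ m => ∃ pre suf, n + 1 + 4 * suf.length ≤ m ∧ F = pre ++ suf ∧
    Seg (τ.arr aNext) (τ.var vHead) suf 0 ∧
    ∀ y, Seg (τ.arr lk) (τ.arr hd y) (pre.filter fun x => σ.arr g x = y).reverse 0)
    ⟨[], F, le_rfl, rfl, hseg, fun y => h0 y⟩ ?_
  rintro τ m ⟨pre, suf, hm, rfl, hs, hy⟩ hFr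
  have hg : τ.arr g = σ.arr g := hFr.arr g (by simp [Cmd.writesArr, h₂, h₃])
  refine ⟨by omega, fun he => ?_, fun he => ?_⟩
  · have : suf = [] := by
      cases suf with
      | nil => rfl
      | cons x suf =>
        have : τ.var vHead = x := hs.1
        rw [show τ.var vHead = 0 from he] at this
        simp [← this] at hF
    subst this
    exact ⟨by omega, by simpa using hy⟩
  · cases suf with
    | nil => exact absurd hs he
    | cons x suf =>
      obtain ⟨hx, hs⟩ := hs
      simp only [List.length_cons] at hm
      have hxp : x ∉ pre := fun h =>
        (List.nodup_append.1 (List.nodup_cons.1 hF).2).2.2 x h x (by simp) rfl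
      simp only [wp_seq, wp_put, wp_set]
      refine ⟨by omega, by omega, by omega, pre ++ [x], suf, by omega, by simp, ?_, fun y => ?_⟩
      · simpa [Store.setVar, Store.setArr, Ex.eval, h₄.symm, h₅.symm, hx] using hs
      · have hold := (hy y).congr (nx' := Function.update (τ.arr lk) x (τ.arr hd (σ.arr g x)))
          fun z hz => Function.update_of_ne (by
            rintro rfl
            exact hxp (List.mem_filter.1 (List.mem_reverse.1 hz)).1) _ _
        by_cases hgy : σ.arr g x = y
        · subst hgy
          rw [List.filter_append, List.reverse_append]
          simpa [Store.setVar, Store.setArr, Ex.eval, h₁, h₁.symm, h₂.symm, h₃.symm, hx, hg, Seg]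
            using hold
        · rw [List.filter_append, List.reverse_append]
          simpa [Store.setVar, Store.setArr, Ex.eval, h₁, h₁.symm, h₂.symm, h₃.symm, hx, hg, hgy,
            Function.update_of_ne (Ne.symm hgy)] using hold

theorem IsRun.flatten_sorted {r : List (List ℕ)} (h : IsRun key r) :
    r.flatten.Pairwise fun x y => key x ≤ key y := by
  rw [List.pairwise_flatten]
  refine ⟨fun c hc => List.pairwise_of_forall_mem_list fun x hx y hy => ?_, ?_⟩
  · rw [h.key_eq c hc x hx, h.key_eq c hc y hy]
  · refine h.sorted.imp_of_mem fun {c d} hc hd hlt x hx y hy => ?_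
    rw [h.key_eq c hc x hx, h.key_eq d hd y hy]
    exact hlt.le

theorem sortCmd_spec {g hd lk : ℕ} (hkn : kn < 9) (hkd : kd < 9) (hhd : 11 < hd) (hlk : 11 < lk)
    (hg : g ∉ [9, 10, 11]) (h₁ : lk ≠ hd) (h₂ : lk ≠ g) (h₃ : hd ≠ g)
    {M L : ℕ} (hM : σ.var vM = M) (hM1 : 1 ≤ M)
    (hL : ∀ l : List ℕ, (∀ x ∈ l, 1 ≤ x ∧ x ≤ M) → l.Pairwise (fun x y => key x ≠ key y) →
      l.length ≤ 2 ^ L)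
    (hcmp : Compares σ kn kd key {x | 1 ≤ x ∧ x ≤ M}) (h0 : σ.arr aRun 0 = 0)
    (hhd0 : ∀ y, σ.arr hd y = 0) {n : ℕ} :
    wp lim bd (sortCmd kn kd g hd lk) (fun τ m => n ≤ m ∧ τ.arr aRun 0 = 0 ∧
      ∀ y, ∃ l, SortedList (τ.arr lk) (τ.arr hd y) key
        {x | (1 ≤ x ∧ x ≤ M) ∧ σ.arr g x = y} l)
      σ (n + 5 + M * (38 * L + 161)) := by
  have hg' : g ≠ 9 ∧ g ≠ 10 ∧ g ≠ 11 := by simpa using hg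
  rw [sortCmd, wp_seq]
  rw [show n + 5 + M * (38 * L + 161) =
    ((n + 1 + 4 * M) + 1 + 38 * (M * (L + 4))) + 3 + 5 * M by ring]
  refine (initRunsCmd_spec hM h0).mono ?_
  rintro τ m - hF ⟨hm, h0', hruns⟩
  have hcmp' : Compares τ kn kd key {x | 1 ≤ x ∧ x ≤ M} :=
    hF.compares hcmp (by simp [Cmd.writesArr, initRunsCmd]; omega)
      (by simp [Cmd.writesArr, initRunsCmd]; omega)
  have hset : {x | x ∈ nodes M} = {x | 1 ≤ x ∧ x ≤ M} := Set.ext fun x => mem_nodes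
  rw [wp_seq]
  obtain ⟨n', rfl⟩ := Nat.exists_eq_add_of_le hm
  rw [show n + 1 + 4 * M + 1 + 38 * (M * (L + 4)) + n' =
    (n + 1 + 4 * M + n') + 1 + 38 * ((nodes M).length * (L + 4)) by rw [length_nodes]; ring]
  have hflat : ((nodes M).map fun x => [[x]]).flatten.flatten = nodes M := by
    induction nodes M with
    | nil => rfl
    | cons x l ih => simpa using ih
  refine (mergeAllCmd_spec hkn hkd
    (fun l hl => hL l fun x hx => mem_nodes.1 (hl x hx)) (hset ▸ hcmp')
    (nodup_nodes M) ?_ (List.Perm.of_eq hflat) ?_ h0' hruns).mono ?_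
  · have := length_nodes M
    intro h
    rw [List.map_eq_nil_iff] at h
    simp [h] at this
    omega
  · intro r hr
    obtain ⟨x, -, rfl⟩ := List.mem_map.1 hr
    exact ⟨by simp, by simp [first], by simp⟩
  rintro υ m' - hF' ⟨hm', h0'', r, hr, hperm, hat⟩
  obtain ⟨n'', rfl⟩ := Nat.exists_eq_add_of_le hm'
  have hlen := hperm.length_eq.trans (length_nodes M)
  have hnod : (0 :: r.flatten).Nodup := (hperm.cons 0).nodup_iff.2 (nodup_nodes M)
  rw [show n + 1 + 4 * M + n' + n'' = (n + n' + n'') + 1 + 4 * r.flatten.length by rw [hlen]; ring]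
  have hgeq : υ.arr g = σ.arr g := by
    rw [hF'.arr g (by simp [Cmd.writesArr, mergeAllCmd, mergePairsCmd, mergeCmd, mergeLoop]; omega),
      hF.arr g (by simp [Cmd.writesArr, initRunsCmd]; omega)]
  refine (distributeCmd_spec h₁ h₂ h₃ (by omega) (by omega) hnod hat.seg fun y => ?_).mono ?_
  · rw [hF'.arr hd
        (by simp [Cmd.writesArr, mergeAllCmd, mergePairsCmd, mergeCmd, mergeLoop]; omega),
      hF.arr hd (by simp [Cmd.writesArr, initRunsCmd]; omega)]
    exact hhd0 y
  rintro ω m'' - hF'' ⟨hm'', hseg⟩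
  refine ⟨by omega, ?_, fun y => ⟨_, hseg y, ?_, ?_, fun x => ?_⟩⟩
  · rw [hF''.arr aRun (by simp [Cmd.writesArr, distributeCmd]; omega)]
    exact h0''
  · exact List.nodup_reverse.2 ((List.nodup_cons.1 hnod).2.filter _)
  · rw [List.pairwise_reverse]
    exact hr.flatten_sorted.filter _
  · rw [List.mem_reverse, List.mem_filter, hperm.mem_iff, mem_nodes, hgeq]
    simp

end

/-! ### Labelling by depth-first search -/

/-- The constraint digraph on the nodes `1, …, M`, given by two partitions into lines and by a key
for each of them: arcs lead to the nodes of the same line with larger keys. -/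
structure Lines where
  size : ℕ
  group₁ : ℕ → ℕ
  group₂ : ℕ → ℕ
  key₁ : ℕ → ℚ
  key₂ : ℕ → ℚ

namespace Lines

variable (G : Lines)

def nodeSet : Set ℕ := {x | 1 ≤ x ∧ x ≤ G.size}

def Edge (u w : ℕ) : Prop :=
  (u ∈ G.nodeSet ∧ w ∈ G.nodeSet) ∧ ((G.group₁ u = G.group₁ w ∧ G.key₁ u < G.key₁ w) ∨
    (G.group₂ u = G.group₂ w ∧ G.key₂ u < G.key₂ w))

/-- Every node `u` is reachable from its label, the demand does not decrease along the arcs if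
nodes are replaced by their labels, and the demand of a label is at least that of the node. -/
structure Labelled (demand : ℕ → ℚ) (lab : ℕ → ℕ) : Prop where
  reach : ∀ u ∈ G.nodeSet, lab u ∈ G.nodeSet ∧ Relation.ReflTransGen G.Edge (lab u) u
  mono : ∀ u w, G.Edge u w → demand (lab u) ≤ demand (lab w)
  le : ∀ u ∈ G.nodeSet, demand u ≤ demand (lab u)

/-- The state of the search: `S` is the stack, `T` contains the sources that remain, in the order
of decreasing demand, `cur` is the present source, `R₁` and `R₂` contain for each line the nodes
that have not been met through this line, in the order of decreasing keys, and the node `w` is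
about to be visited if it is not `0`. The label `0` marks nodes that have not been visited. -/
structure Search (demand : ℕ → ℚ) (lab : ℕ → ℕ) (cur w : ℕ) (S T : List ℕ)
    (R₁ R₂ : ℕ → List ℕ) : Prop where
  stack_mem : ∀ u ∈ S, u ∈ G.nodeSet
  stack_lab : ∀ u ∈ S, lab u = cur
  cur_mem : S ≠ [] → cur ∈ G.nodeSet
  cur_le : S ≠ [] → ∀ u ∈ G.nodeSet, lab u ≠ 0 → demand cur ≤ demand (lab u)
  reach : ∀ u ∈ G.nodeSet, lab u ≠ 0 →
    lab u ∈ G.nodeSet ∧ Relation.ReflTransGen G.Edge (lab u) u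
  sources_mem : ∀ t ∈ T, t ∈ G.nodeSet
  sources_sorted : T.Pairwise fun x y => demand y ≤ demand x
  sources_le : ∀ u ∈ G.nodeSet, lab u ≠ 0 → ∀ t ∈ T, demand t ≤ demand (lab u)
  closed : ∀ u w, lab u ≠ 0 → u ∉ S → G.Edge u w → lab w ≠ 0 ∧ demand (lab u) ≤ demand (lab w)
  done : ∀ s ∈ G.nodeSet, s ∉ T → (lab s ≠ 0 ∧ demand s ≤ demand (lab s)) ∨ (s = w ∧ cur = w)
  line₁ : ∀ x ∈ G.nodeSet, x ∉ R₁ (G.group₁ x) → lab x ≠ 0 ∨ x = w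
  line₂ : ∀ x ∈ G.nodeSet, x ∉ R₂ (G.group₂ x) → lab x ≠ 0 ∨ x = w
  line₁_mem : ∀ y, ∀ x ∈ R₁ y, x ∈ G.nodeSet ∧ G.group₁ x = y
  line₂_mem : ∀ y, ∀ x ∈ R₂ y, x ∈ G.nodeSet ∧ G.group₂ x = y
  line₁_sorted : ∀ y, (R₁ y).Pairwise fun a b => G.key₁ b ≤ G.key₁ a
  line₂_sorted : ∀ y, (R₂ y).Pairwise fun a b => G.key₂ b ≤ G.key₂ a
  next : w ≠ 0 → w ∈ G.nodeSet ∧ cur ∈ G.nodeSet ∧ Relation.ReflTransGen G.Edge cur w ∧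
    (∀ u ∈ G.nodeSet, lab u ≠ 0 → demand cur ≤ demand (lab u)) ∧ ∀ t ∈ T, demand t ≤ demand cur

variable {G} {demand : ℕ → ℚ} {lab : ℕ → ℕ} {cur w : ℕ} {S T : List ℕ} {R₁ R₂ : ℕ → List ℕ}

theorem ne_zero_of_mem {u : ℕ} (h : u ∈ G.nodeSet) : u ≠ 0 := by
  have := h.1
  omega

theorem Search.start (hT : ∀ x, x ∈ T ↔ x ∈ G.nodeSet)
    (hTs : T.Pairwise fun x y => demand y ≤ demand x) (hlab : ∀ u ∈ G.nodeSet, lab u = 0)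
    (h₁ : ∀ y x, x ∈ R₁ y ↔ x ∈ G.nodeSet ∧ G.group₁ x = y)
    (h₂ : ∀ y x, x ∈ R₂ y ↔ x ∈ G.nodeSet ∧ G.group₂ x = y)
    (h₁s : ∀ y, (R₁ y).Pairwise fun a b => G.key₁ b ≤ G.key₁ a)
    (h₂s : ∀ y, (R₂ y).Pairwise fun a b => G.key₂ b ≤ G.key₂ a) :
    G.Search demand lab cur 0 [] T R₁ R₂ where
  stack_mem := by simp
  stack_lab := by simp
  cur_mem h := absurd rfl h
  cur_le h := absurd rfl h
  reach u hu h := absurd (hlab u hu) h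
  sources_mem t ht := (hT t).1 ht
  sources_sorted := hTs
  sources_le u hu h := absurd (hlab u hu) h
  closed u w h _ he := absurd (hlab u he.1.1) h
  done s hs h := absurd ((hT s).2 hs) h
  line₁ x hx h := absurd ((h₁ _ x).2 ⟨hx, rfl⟩) h
  line₂ x hx h := absurd ((h₂ _ x).2 ⟨hx, rfl⟩) h
  line₁_mem y x := (h₁ y x).1
  line₂_mem y x := (h₂ y x).1
  line₁_sorted := h₁s
  line₂_sorted := h₂s
  next h := absurd rfl h

theorem Search.skip (h : G.Search demand lab cur w S T R₁ R₂) (hw : w ≠ 0 → lab w ≠ 0) :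
    G.Search demand lab cur 0 S T R₁ R₂ where
  __ := h
  done s hs hsT := by
    rcases h.done s hs hsT with h' | ⟨rfl, rfl⟩
    · exact Or.inl h'
    · have h0 := ne_zero_of_mem hs
      exact Or.inl ⟨hw h0, (h.next h0).2.2.2.1 _ hs (hw h0)⟩
  line₁ x hx hxR := by
    rcases h.line₁ x hx hxR with h' | rfl
    · exact Or.inl h'
    · exact Or.inl (hw (ne_zero_of_mem hx))
  line₂ x hx hxR := by
    rcases h.line₂ x hx hxR with h' | rfl
    · exact Or.inl h'
    · exact Or.inl (hw (ne_zero_of_mem hx))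
  next h := absurd rfl h

theorem Search.visit (h : G.Search demand lab cur w S T R₁ R₂) (hw : w ≠ 0) (hlab : lab w = 0) :
    G.Search demand (Function.update lab w cur) cur 0 (w :: S) T R₁ R₂ := by
  obtain ⟨hwm, hcur, hreach, hle, hT⟩ := h.next hw
  have hc0 := ne_zero_of_mem hcur
  have hself : Function.update lab w cur w = cur := Function.update_self _ _ _
  have hne : ∀ {x}, x ≠ w → Function.update lab w cur x = lab x := fun hx =>
    Function.update_of_ne hx _ _
  have hmono : ∀ {x}, lab x ≠ 0 → Function.update lab w cur x = lab x := fun hx =>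
    hne (by rintro rfl; exact hx hlab)
  have hcases : ∀ u, Function.update lab w cur u ≠ 0 → u = w ∨ lab u ≠ 0 := fun u hu => by
    by_cases huw : u = w
    · exact Or.inl huw
    · exact Or.inr (by rwa [hne huw] at hu)
  refine { h with
    stack_mem := List.forall_mem_cons.2 ⟨hwm, h.stack_mem⟩
    stack_lab := List.forall_mem_cons.2 ⟨hself, fun u hu => ?_⟩
    cur_mem := fun _ => hcur
    cur_le := fun _ u hu hl => ?_
    reach := fun u hu hl => ?_
    sources_le := fun u hu hl => ?_
    closed := fun u x hl hu he => ?_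
    done := fun s hs hsT => ?_
    line₁ := fun x hx hxR => ?_
    line₂ := fun x hx hxR => ?_
    next := fun h => absurd rfl h }
  · have hS : S ≠ [] := List.ne_nil_of_mem hu
    rw [hmono]
    · exact h.stack_lab u hu
    · rw [h.stack_lab u hu]; exact hc0
  · rcases hcases u hl with rfl | hl'
    · rw [hself]
    · rw [hmono hl']; exact hle u hu hl'
  · rcases hcases u hl with rfl | hl'
    · rw [hself]; exact ⟨hcur, hreach⟩
    · rw [hmono hl']; exact h.reach u hu hl'
  · rcases hcases u hl with rfl | hl'
    · rw [hself]; exact hT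
    · rw [hmono hl']; exact h.sources_le u hu hl'
  · rcases hcases u hl with rfl | hl'
    · exact absurd (by simp) hu
    · obtain ⟨h1, h2⟩ := h.closed u x hl' (fun h => hu (by simp [h])) he
      rw [hmono hl', hmono h1]
      exact ⟨h1, h2⟩
  · rcases h.done s hs hsT with ⟨h1, h2⟩ | ⟨rfl, rfl⟩
    · left; rw [hmono h1]; exact ⟨h1, h2⟩
    · left; rw [hself]; exact ⟨hc0, le_rfl⟩
  · rcases h.line₁ x hx hxR with h1 | rfl
    · left; rwa [hmono h1]
    · left; rwa [hself]
  · rcases h.line₂ x hx hxR with h1 | rfl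
    · left; rwa [hmono h1]
    · left; rwa [hself]

theorem Search.pop {u : ℕ} (h : G.Search demand lab cur 0 (u :: S) T R₁ R₂)
    (h₁ : ∀ x ∈ R₁ (G.group₁ u), G.key₁ x ≤ G.key₁ u)
    (h₂ : ∀ x ∈ R₂ (G.group₂ u), G.key₂ x ≤ G.key₂ u) :
    G.Search demand lab cur 0 S T R₁ R₂ where
  __ := h
  stack_mem x hx := h.stack_mem x (List.mem_cons_of_mem _ hx)
  stack_lab x hx := h.stack_lab x (List.mem_cons_of_mem _ hx)
  cur_mem _ := h.cur_mem (by simp)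
  cur_le _ := h.cur_le (by simp)
  closed x w hx hxS he := by
    by_cases hxu : x = u
    · subst hxu
      have hw : lab w ≠ 0 := by
        have hw0 := ne_zero_of_mem he.1.2
        rcases he.2 with ⟨hg, hk⟩ | ⟨hg, hk⟩
        · refine (h.line₁ w he.1.2 fun hmem => ?_).resolve_right hw0
          exact absurd hk (not_lt.2 (h₁ w (hg ▸ hmem)))
        · refine (h.line₂ w he.1.2 fun hmem => ?_).resolve_right hw0
          exact absurd hk (not_lt.2 (h₂ w (hg ▸ hmem)))
      rw [h.stack_lab x (by simp)]
      exact ⟨hw, h.cur_le (by simp) w he.1.2 hw⟩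
    · exact h.closed x w hx (by simp [hxu, hxS]) he

theorem Search.advance₁ {u p : ℕ} {R : List ℕ} (h : G.Search demand lab cur 0 (u :: S) T R₁ R₂)
    (hR : R₁ (G.group₁ u) = p :: R) (hk : G.key₁ u < G.key₁ p) :
    G.Search demand lab cur p (u :: S) T (Function.update R₁ (G.group₁ u) R) R₂ := by
  have hu := h.stack_mem u (by simp)
  have hp := h.line₁_mem (G.group₁ u) p (by simp [hR])
  have hc := h.cur_mem (by simp)
  have hl := h.stack_lab u (by simp)
  have hsub : ∀ y, ∀ x ∈ Function.update R₁ (G.group₁ u) R y, x ∈ R₁ y := by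
    intro y x hx
    rw [Function.update_apply] at hx
    split_ifs at hx with hy
    · rw [hy, hR]; exact List.mem_cons_of_mem _ hx
    · exact hx
  refine { h with
    done := fun s hs hsT => Or.inl ((h.done s hs hsT).resolve_right fun h' =>
       ne_zero_of_mem hs h'.1)
    line₁ := fun x hx hxR => ?_
    line₂ := fun x hx hxR => Or.inl ((h.line₂ x hx hxR).resolve_right (ne_zero_of_mem hx))
    line₁_mem := fun y x hx => h.line₁_mem y x (hsub y x hx)
    line₁_sorted := fun y => ?_
    next := fun _ => ⟨hp.1, hc, ?_, h.cur_le (by simp), ?_⟩ }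
  · by_cases hxp : x = p
    · exact Or.inr hxp
    · refine Or.inl ((h.line₁ x hx fun hmem => hxR ?_).resolve_right (ne_zero_of_mem hx))
      rw [Function.update_apply]
      split_ifs with hy
      · rw [hy, hR] at hmem
        exact (List.mem_cons.1 hmem).resolve_left hxp
      · exact hmem
  · have := h.line₁_sorted y
    rw [Function.update_apply]
    split_ifs with hy
    · rw [hy, hR] at this; exact this.of_cons
    · exact this
  · have := (h.reach u hu (by rw [hl]; exact ne_zero_of_mem hc)).2
    rw [hl] at this
    exact this.tail ⟨⟨hu, hp.1⟩, Or.inl ⟨hp.2.symm, hk⟩⟩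
  · intro t ht
    have := h.sources_le u hu (by rw [hl]; exact ne_zero_of_mem hc) t ht
    rwa [hl] at this

/-- Exchanging the roles of the two partitions. -/
def swap (G : Lines) : Lines := ⟨G.size, G.group₂, G.group₁, G.key₂, G.key₁⟩

theorem edge_swap (G : Lines) : G.swap.Edge = G.Edge := by
  ext u w
  exact and_congr Iff.rfl Or.comm

theorem Search.swap (h : G.Search demand lab cur w S T R₁ R₂) :
    G.swap.Search demand lab cur w S T R₂ R₁ where
  stack_mem := h.stack_mem
  stack_lab := h.stack_lab
  cur_mem := h.cur_mem
  cur_le := h.cur_le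
  reach := by rw [edge_swap]; exact h.reach
  sources_mem := h.sources_mem
  sources_sorted := h.sources_sorted
  sources_le := h.sources_le
  closed := by rw [edge_swap]; exact h.closed
  done := h.done
  line₁ := h.line₂
  line₂ := h.line₁
  line₁_mem := h.line₂_mem
  line₂_mem := h.line₁_mem
  line₁_sorted := h.line₂_sorted
  line₂_sorted := h.line₁_sorted
  next := by rw [edge_swap]; exact h.next

theorem Search.advance₂ {u p : ℕ} {R : List ℕ} (h : G.Search demand lab cur 0 (u :: S) T R₁ R₂)
    (hR : R₂ (G.group₂ u) = p :: R) (hk : G.key₂ u < G.key₂ p) :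
    G.Search demand lab cur p (u :: S) T R₁ (Function.update R₂ (G.group₂ u) R) :=
  (Search.advance₁ (G := G.swap) h.swap hR hk).swap

theorem Search.source {s : ℕ} (h : G.Search demand lab cur 0 [] (s :: T) R₁ R₂) :
    G.Search demand lab s s [] T R₁ R₂ where
  __ := h
  stack_lab := by simp
  cur_mem h := absurd rfl h
  cur_le h := absurd rfl h
  sources_mem t ht := h.sources_mem t (List.mem_cons_of_mem _ ht)
  sources_sorted := h.sources_sorted.of_cons
  sources_le u hu hl t ht := h.sources_le u hu hl t (List.mem_cons_of_mem _ ht)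
  done x hx hxT := by
    by_cases hxs : x = s
    · exact Or.inr ⟨hxs, rfl⟩
    · exact Or.inl ((h.done x hx (by simp [hxs, hxT])).resolve_right
        fun h' => ne_zero_of_mem hx h'.1)
  line₁ x hx hxR := Or.inl ((h.line₁ x hx hxR).resolve_right (ne_zero_of_mem hx))
  line₂ x hx hxR := Or.inl ((h.line₂ x hx hxR).resolve_right (ne_zero_of_mem hx))
  next _ := by
    have hs := h.sources_mem s (by simp)
    exact ⟨hs, hs, Relation.ReflTransGen.refl, fun u hu hl => h.sources_le u hu hl s (by simp),
      (List.pairwise_cons.1 h.sources_sorted).1⟩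

theorem Search.labelled (h : G.Search demand lab cur 0 [] [] R₁ R₂) : G.Labelled demand lab := by
  have hd : ∀ s ∈ G.nodeSet, lab s ≠ 0 ∧ demand s ≤ demand (lab s) := fun s hs =>
    (h.done s hs (by simp)).resolve_right fun h' => ne_zero_of_mem hs h'.1
  exact ⟨fun u hu => h.reach u hu (hd u hu).1,
    fun u w he => (h.closed u w (hd u he.1.1).1 (by simp) he).2, fun u hu => (hd u hu).2⟩

end Lines

/-! ### The program for the search -/

/-! The arrays with the data of the nodes: numerators and denominators of the two values, the lines,
and, over a common denominator, the values and their maximum. In each line the nodes are listed by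
the arrays of heads and links; the third pair lists all nodes by the losses of agent 2. -/

notation "aNum₁" => 0
notation "aDen₁" => 1
notation "aNum₂" => 2
notation "aDen₂" => 3
notation "aGroup₁" => 4
notation "aGroup₂" => 5
notation "aMax" => 6
notation "aVal₂" => 7
notation "aVal₁" => 8
notation "aHead₁" => 12
notation "aLink₁" => 13
notation "aHead₂" => 14
notation "aLink₂" => 15
notation "aHead₃" => 16
notation "aLink₃" => 17
notation "aLabel" => 18
notation "aStack" => 19
notation "aZero" => 20

/-- One step of the search: determines in `vW` the node to be visited next, if any. -/
def stepCmd : Cmd :=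
  .ite (.var vTop)
    (.set vW (.get aHead₁ (.get aGroup₁ (.var vTop))) ;;
      .ite (exceeds aNum₁ aDen₁ (.var vTop) (.var vW))
        (.put aHead₁ (.get aGroup₁ (.var vTop)) (.get aLink₁ (.var vW)))
        (.set vW (.get aHead₂ (.get aGroup₂ (.var vTop))) ;;
          .ite (exceeds aDen₂ aNum₂ (.var vTop) (.var vW))
            (.put aHead₂ (.get aGroup₂ (.var vTop)) (.get aLink₂ (.var vW)))
            (.set vW (.num 0) ;; .set vTop (.get aStack (.var vTop)))))
    (.set vW (.var vSrc) ;; .set vSrc (.get aLink₃ (.var vSrc)) ;; .set vCur (.var vW))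

/-- Labels the node in `vW`, and pushes it on the stack, unless it has a label already. -/
def visitCmd : Cmd :=
  .ite (.mul (.sub (.num 1) (.get aLabel (.var vW))) (.var vW))
    (.put aLabel (.var vW) (.var vCur) ;; .put aStack (.var vW) (.var vTop) ;;
      .set vTop (.var vW))
    (.set vW (.num 0))

/-- Depth-first search from all nodes as sources, in the order of decreasing demand. -/
def searchCmd : Cmd :=
  .set vTop (.num 0) ;; .set vSrc (.get aHead₃ (.num 0)) ;;
    .loop (.add (.var vTop) (.var vSrc)) (stepCmd ;; visitCmd)

namespace Lines

/-- The state of the search is stored in `τ`. -/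
structure SearchAt (G : Lines) (demand : ℕ → ℚ) (τ : Store) (w : ℕ) (S T : List ℕ)
    (R₁ R₂ : ℕ → List ℕ) : Prop where
  search : G.Search demand (τ.arr aLabel) (τ.var vCur) w S T R₁ R₂
  stack : Seg (τ.arr aStack) (τ.var vTop) S 0
  sources : Seg (τ.arr aLink₃) (τ.var vSrc) T 0
  list₁ : ∀ y, Seg (τ.arr aLink₁) (τ.arr aHead₁ y) (R₁ y) 0
  list₂ : ∀ y, Seg (τ.arr aLink₂) (τ.arr aHead₂ y) (R₂ y) 0

/-- The number of nodes that have no label. -/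
def unlabelled (M : ℕ) (lab : ℕ → ℕ) : ℕ := ((Finset.Icc 1 M).filter fun x => lab x = 0).card

/-- The number of nodes that remain in the lists of the lines. -/
def total (k : ℕ) (R : ℕ → List ℕ) : ℕ := ∑ y ∈ Finset.range (k + 1), (R y).length

/-- The number of steps that the search can still make. -/
def stepsLeft (k M : ℕ) (lab : ℕ → ℕ) (S T : List ℕ) (R₁ R₂ : ℕ → List ℕ) : ℕ :=
  total k R₁ + total k R₂ + T.length + S.length + unlabelled M lab

theorem total_update {k g p : ℕ} {R : ℕ → List ℕ} {l : List ℕ} (hg : g ≤ k) (hR : R g = p :: l) :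
    total k (Function.update R g l) + 1 = total k R := by
  have hmem : g ∈ Finset.range (k + 1) := by simp; omega
  rw [total, total, ← Finset.add_sum_erase _ _ hmem,
    ← Finset.add_sum_erase _ (fun y => (R y).length) hmem, Function.update_self, hR,
    Finset.sum_congr rfl fun y hy => by rw [Function.update_of_ne (Finset.ne_of_mem_erase hy)]]
  simp only [List.length_cons]
  omega

theorem total_le {k M : ℕ} {R : ℕ → List ℕ} {g : ℕ → ℕ} (hn : ∀ y, (R y).Nodup)
    (hR : ∀ y, ∀ x ∈ R y, (1 ≤ x ∧ x ≤ M) ∧ g x = y) : total k R ≤ M := by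
  have h1 : total k R = ∑ y ∈ Finset.range (k + 1), ((R y).toFinset).card :=
    Finset.sum_congr rfl fun y _ => (List.toFinset_card_of_nodup (hn y)).symm
  rw [h1, ← Finset.card_biUnion]
  · calc _ ≤ (Finset.Icc 1 M).card := Finset.card_le_card fun x hx => by
          obtain ⟨y, -, hy⟩ := Finset.mem_biUnion.1 hx
          exact Finset.mem_Icc.2 (hR y x (List.mem_toFinset.1 hy)).1
      _ = M := by simp
  · intro y _ y' _ hne
    refine Finset.disjoint_left.2 fun x hx hx' => hne ?_
    rw [← (hR y x (List.mem_toFinset.1 hx)).2, ← (hR y' x (List.mem_toFinset.1 hx')).2]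

theorem unlabelled_update {M w c : ℕ} {lab : ℕ → ℕ} (hw : 1 ≤ w ∧ w ≤ M) (h0 : lab w = 0)
    (hc : c ≠ 0) : unlabelled M (Function.update lab w c) + 1 = unlabelled M lab := by
  have hmem : w ∈ (Finset.Icc 1 M).filter fun x => lab x = 0 := by simp [hw, h0]
  have : ((Finset.Icc 1 M).filter fun x => Function.update lab w c x = 0) =
      ((Finset.Icc 1 M).filter fun x => lab x = 0).erase w := by
    ext x
    by_cases hx : x = w
    · subst hx; simp [hc]
    · simp [hx]
  rw [unlabelled, unlabelled, this, Finset.card_erase_of_mem hmem]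
  have := Finset.card_pos.2 ⟨w, hmem⟩
  omega

variable {G : Lines} {demand : ℕ → ℚ} {τ : Store} {S T : List ℕ} {R₁ R₂ : ℕ → List ℕ}
  {lim bd k n : ℕ}

theorem visitCmd_spec {w : ℕ} (h : G.SearchAt demand τ w S T R₁ R₂) (hw : τ.var vW = w) :
    wp lim bd visitCmd (fun υ m => ∃ S', G.SearchAt demand υ 0 S' T R₁ R₂ ∧
      n + 12 * stepsLeft k G.size (υ.arr aLabel) S' T R₁ R₂ ≤ m)
      τ (n + 4 + 12 * stepsLeft k G.size (τ.arr aLabel) S T R₁ R₂) := by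
  rw [visitCmd, wp_ite]
  refine ⟨by omega, fun he => ?_, fun he => ?_⟩
  · simp only [Ex.eval, ne_eq, mul_eq_zero, not_or, hw] at he
    obtain ⟨hl, hw0⟩ := he
    have hl0 : τ.arr aLabel w = 0 := by omega
    obtain ⟨hwm, hcm, -⟩ := h.search.next hw0
    have hwS : w ∉ S := fun hmem => by
      have h1 := h.search.stack_lab w hmem
      rw [hl0] at h1
      exact ne_zero_of_mem hcm h1.symm
    have hunl := unlabelled_update (M := G.size) hwm hl0 (ne_zero_of_mem hcm)
    simp only [wp_seq, wp_put, wp_set]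
    refine ⟨by omega, by omega, by omega, w :: S, ⟨?_, ?_, ?_, ?_, ?_⟩, ?_⟩
    · simpa [Store.setVar, Store.setArr, Ex.eval, hw] using h.search.visit hw0 hl0
    · have := h.stack.congr (nx' := Function.update (τ.arr aStack) w (τ.var vTop))
        fun x hx => Function.update_of_ne (fun e : x = w => hwS (e ▸ hx)) _ _
      simpa [Seg, Store.setVar, Store.setArr, Ex.eval, hw] using this
    · simpa [Store.setVar, Store.setArr, Ex.eval] using h.sources
    · simpa [Store.setVar, Store.setArr, Ex.eval] using h.list₁
    · simpa [Store.setVar, Store.setArr, Ex.eval] using h.list₂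
    · simp only [Store.setVar, Store.setArr, Ex.eval, hw, stepsLeft, List.length_cons,
        Function.update_self, ne_eq, Nat.reduceEqDiff, not_false_eq_true,
        Function.update_of_ne]
      omega
  · simp only [Ex.eval, mul_eq_zero, hw] at he
    rw [wp_set]
    refine ⟨by omega, S, ⟨h.search.skip fun hw0 hl => ?_, h.stack, h.sources, h.list₁, h.list₂⟩,
      by simp only [Store.setVar]; omega⟩
    rw [hl] at he
    omega

theorem stepCmd_spec (hg₁ : τ.arr aGroup₁ = G.group₁) (hg₂ : τ.arr aGroup₂ = G.group₂)
    (hk₁ : ∀ x ∈ G.nodeSet, G.group₁ x ≤ k) (hk₂ : ∀ x ∈ G.nodeSet, G.group₂ x ≤ k)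
    (hc₁ : Compares τ aNum₁ aDen₁ G.key₁ G.nodeSet) (hc₂ : Compares τ aDen₂ aNum₂ G.key₂ G.nodeSet)
    (h0₁ : τ.arr aNum₁ 0 = 0) (h0₂ : τ.arr aDen₂ 0 = 0)
    (h : G.SearchAt demand τ 0 S T R₁ R₂) (hne : τ.var vTop + τ.var vSrc ≠ 0) :
    wp lim bd stepCmd (fun υ m => ∃ w S' T' R₁' R₂', υ.var vW = w ∧
      G.SearchAt demand υ w S' T' R₁' R₂' ∧
      n + 5 + 12 * stepsLeft k G.size (υ.arr aLabel) S' T' R₁' R₂' ≤ m)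
      τ (n + 12 * stepsLeft k G.size (τ.arr aLabel) S T R₁ R₂) := by
  have htop : S = [] ↔ τ.var vTop = 0 := by
    cases S with
    | nil => simpa [Seg] using h.stack
    | cons u S =>
      have h1 : τ.var vTop = u := h.stack.1
      have := ne_zero_of_mem (h.search.stack_mem u (by simp))
      simp [h1, this]
  have hpos : 1 ≤ stepsLeft k G.size (τ.arr aLabel) S T R₁ R₂ := by
    cases S with
    | cons u S => simp only [stepsLeft, List.length_cons]; omega
    | nil =>
      cases T with
      | cons => simp only [stepsLeft, List.length_cons]; omega
      | nil =>
        have h1 := htop.1 rfl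
        have h2 : τ.var vSrc = 0 := h.sources
        omega
  rw [stepCmd, wp_ite]
  refine ⟨by omega, fun he => ?_, fun he => ?_⟩
  · cases S with
    | nil => exact absurd (htop.1 rfl) he
    | cons u S =>
      obtain ⟨hu, hS⟩ := h.stack
      have hum := h.search.stack_mem u (by simp)
      have hgu := hk₁ u hum
      have hgu' := hk₂ u hum
      simp only [wp_seq, wp_set]
      refine ⟨by omega, ?_⟩
      rw [wp_ite]
      have hl₁ := h.list₁ (G.group₁ u)
      have hl₂ := h.list₂ (G.group₂ u)
      refine ⟨by omega, fun hlt => ?_, fun hlt => ?_⟩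
      · simp only [Store.setVar, exceeds, Ex.eval, Function.update_self, hg₁, ne_eq,
          Nat.reduceEqDiff, not_false_eq_true, Function.update_of_ne, hu]
          at hlt
        cases hR : R₁ (G.group₁ u) with
        | nil =>
          rw [hR] at hl₁
          rw [show τ.arr aHead₁ (G.group₁ u) = 0 from hl₁, h0₁] at hlt
          simp at hlt
        | cons p R =>
          rw [hR] at hl₁
          obtain ⟨hp, hl₁⟩ := hl₁
          rw [hp] at hlt
          have hpm := (h.search.line₁_mem _ p (by rw [hR]; simp)).1
          have hkey : G.key₁ u < G.key₁ p := (hc₁ u hum p hpm).1 (by omega)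
          have htot := total_update hgu hR
          rw [wp_put]
          refine ⟨by omega, p, u :: S, T, Function.update R₁ (G.group₁ u) R, R₂, ?_,
            ⟨?_, ?_, ?_, fun y => ?_, ?_⟩, ?_⟩
          · simp [Store.setVar, Store.setArr, Ex.eval, hu, hg₁, hp]
          · exact h.search.advance₁ hR hkey
          · exact ⟨hu, hS⟩
          · exact h.sources
          · by_cases hy : y = G.group₁ u
            · subst hy
              simpa [Store.setVar, Store.setArr, Ex.eval, hu, hg₁, hp] using hl₁
            · simpa [Store.setVar, Store.setArr, Ex.eval, hu, hg₁, hy] using h.list₁ y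
          · exact h.list₂
          · simp only [Store.setVar, Store.setArr, stepsLeft] at hpos ⊢
            simp only [ne_eq, Nat.reduceEqDiff, not_false_eq_true,
              Function.update_of_ne]
            omega
      · have hle₁ : ∀ x ∈ R₁ (G.group₁ u), G.key₁ x ≤ G.key₁ u := by
          simp only [Store.setVar, exceeds, Ex.eval, Function.update_self, hg₁, ne_eq,
            Nat.reduceEqDiff, not_false_eq_true, Function.update_of_ne, hu]
            at hlt
          cases hR : R₁ (G.group₁ u) with
          | nil => simp
          | cons p R =>
            rw [hR] at hl₁
            rw [show τ.arr aHead₁ (G.group₁ u) = p from hl₁.1] at hlt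
            have hpm := (h.search.line₁_mem _ p (by rw [hR]; simp)).1
            have hkey : G.key₁ p ≤ G.key₁ u :=
              not_lt.1 fun hlt' => by have := (hc₁ u hum p hpm).2 hlt'; omega
            have hs := h.search.line₁_sorted (G.group₁ u)
            rw [hR] at hs
            exact List.forall_mem_cons.2
              ⟨hkey, fun x hx => ((List.pairwise_cons.1 hs).1 x hx).trans hkey⟩
        simp only [wp_seq, wp_set]
        refine ⟨by omega, ?_⟩
        rw [wp_ite]
        refine ⟨by omega, fun hlt => ?_, fun hlt => ?_⟩
        · simp only [Store.setVar, exceeds, Ex.eval, Function.update_self, hg₂, ne_eq,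
            Nat.reduceEqDiff, not_false_eq_true, Function.update_of_ne, hu]
            at hlt
          cases hR : R₂ (G.group₂ u) with
          | nil =>
            rw [hR] at hl₂
            rw [show τ.arr aHead₂ (G.group₂ u) = 0 from hl₂, h0₂] at hlt
            simp at hlt
          | cons p R =>
            rw [hR] at hl₂
            obtain ⟨hp, hl₂⟩ := hl₂
            rw [hp] at hlt
            have hpm := (h.search.line₂_mem _ p (by rw [hR]; simp)).1
            have hkey : G.key₂ u < G.key₂ p := (hc₂ u hum p hpm).1 (by omega)
            have htot := total_update hgu' hR
            rw [wp_put]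
            refine ⟨by omega, p, u :: S, T, R₁, Function.update R₂ (G.group₂ u) R, ?_,
              ⟨?_, ?_, ?_, ?_, fun y => ?_⟩, ?_⟩
            · simp [Store.setVar, Store.setArr, Ex.eval, hu, hg₂, hp]
            · exact h.search.advance₂ hR hkey
            · exact ⟨hu, hS⟩
            · exact h.sources
            · exact h.list₁
            · by_cases hy : y = G.group₂ u
              · subst hy
                simpa [Store.setVar, Store.setArr, Ex.eval, hu, hg₂, hp] using hl₂
              · simpa [Store.setVar, Store.setArr, Ex.eval, hu, hg₂, hy] using h.list₂ y
            · simp only [Store.setVar, Store.setArr, stepsLeft] at hpos ⊢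
              simp only [ne_eq, Nat.reduceEqDiff, not_false_eq_true,
                Function.update_of_ne]
              omega
        · have hle₂ : ∀ x ∈ R₂ (G.group₂ u), G.key₂ x ≤ G.key₂ u := by
            simp only [Store.setVar, exceeds, Ex.eval, Function.update_self, hg₂, ne_eq,
              Nat.reduceEqDiff, not_false_eq_true, Function.update_of_ne, hu]
              at hlt
            cases hR : R₂ (G.group₂ u) with
            | nil => simp
            | cons p R =>
              rw [hR] at hl₂
              rw [show τ.arr aHead₂ (G.group₂ u) = p from hl₂.1] at hlt
              have hpm := (h.search.line₂_mem _ p (by rw [hR]; simp)).1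
              have hkey : G.key₂ p ≤ G.key₂ u :=
                not_lt.1 fun hlt' => by have := (hc₂ u hum p hpm).2 hlt'; omega
              have hs := h.search.line₂_sorted (G.group₂ u)
              rw [hR] at hs
              exact List.forall_mem_cons.2
                ⟨hkey, fun x hx => ((List.pairwise_cons.1 hs).1 x hx).trans hkey⟩
          simp only [wp_seq, wp_set]
          refine ⟨by omega, by omega, 0, S, T, R₁, R₂, ?_, ⟨?_, ?_, ?_, ?_, ?_⟩, ?_⟩
          · simp [Store.setVar, Ex.eval]
          · exact h.search.pop hle₁ hle₂
          · simpa [Store.setVar, Ex.eval, hu] using hS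
          · exact h.sources
          · exact h.list₁
          · exact h.list₂
          · simp only [Store.setVar, stepsLeft, List.length_cons] at hpos ⊢
            omega
  · have hS : S = [] := htop.2 he
    subst hS
    have he' : τ.var vTop = 0 := he
    cases T with
    | nil =>
      have h2 : τ.var vSrc = 0 := h.sources
      omega
    | cons s T =>
      obtain ⟨hs, hT⟩ := h.sources
      simp only [wp_seq, wp_set]
      refine ⟨by omega, by omega, by omega, s, [], T, R₁, R₂, ?_, ⟨?_, ?_, ?_, ?_, ?_⟩, ?_⟩
      · simp [Store.setVar, Ex.eval, hs]
      · simpa [Store.setVar, Ex.eval, hs] using h.search.source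
      · exact h.stack
      · simpa [Store.setVar, Ex.eval, hs] using hT
      · exact h.list₁
      · exact h.list₂
      · simp only [Store.setVar, stepsLeft, List.length_cons] at hpos ⊢
        omega

theorem searchCmd_spec (hg₁ : τ.arr aGroup₁ = G.group₁) (hg₂ : τ.arr aGroup₂ = G.group₂)
    (hk₁ : ∀ x ∈ G.nodeSet, G.group₁ x ≤ k) (hk₂ : ∀ x ∈ G.nodeSet, G.group₂ x ≤ k)
    (hc₁ : Compares τ aNum₁ aDen₁ G.key₁ G.nodeSet) (hc₂ : Compares τ aDen₂ aNum₂ G.key₂ G.nodeSet)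
    (h0₁ : τ.arr aNum₁ 0 = 0) (h0₂ : τ.arr aDen₂ 0 = 0) (hlab : ∀ x, τ.arr aLabel x = 0)
    (hl₁ : ∀ y, ∃ l, SortedList (τ.arr aLink₁) (τ.arr aHead₁ y) G.key₁
      {x | x ∈ G.nodeSet ∧ G.group₁ x = y} l)
    (hl₂ : ∀ y, ∃ l, SortedList (τ.arr aLink₂) (τ.arr aHead₂ y) G.key₂
      {x | x ∈ G.nodeSet ∧ G.group₂ x = y} l)
    (hT : ∃ l, SortedList (τ.arr aLink₃) (τ.arr aHead₃ 0) demand G.nodeSet l) :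
    wp lim bd searchCmd (fun υ m => n ≤ m ∧ G.Labelled demand (υ.arr aLabel))
      τ (n + 7 + 48 * G.size) := by
  choose R₁ hR₁ using hl₁
  choose R₂ hR₂ using hl₂
  obtain ⟨T, hT⟩ := hT
  simp only [searchCmd, wp_seq, wp_set]
  refine ⟨by omega, by omega, ?_⟩
  refine wp_loop (fun υ m => ∃ S T R₁ R₂, G.SearchAt demand υ 0 S T R₁ R₂ ∧
    n + 5 + 12 * stepsLeft k G.size (υ.arr aLabel) S T R₁ R₂ ≤ m)
    ⟨[], T, R₁, R₂, ⟨?_, ?_, ?_, fun y => (hR₁ y).1, fun y => (hR₂ y).1⟩, ?_⟩ ?_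
  · exact Search.start hT.2.2.2 hT.2.2.1 (fun u _ => hlab u) (fun y => (hR₁ y).2.2.2)
      (fun y => (hR₂ y).2.2.2) (fun y => (hR₁ y).2.2.1) (fun y => (hR₂ y).2.2.1)
  · simp [Seg, Store.setVar, Ex.eval]
  · simpa [Store.setVar, Ex.eval] using hT.1
  · have h1 : total k R₁ ≤ G.size := total_le (g := G.group₁) (fun y => (hR₁ y).2.1)
      fun y x hx => ((hR₁ y).2.2.2 x).1 hx
    have h2 : total k R₂ ≤ G.size := total_le (g := G.group₂) (fun y => (hR₂ y).2.1)
      fun y x hx => ((hR₂ y).2.2.2 x).1 hx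
    have h3 : T.length ≤ G.size := by
      rw [← List.toFinset_card_of_nodup hT.2.1]
      refine (Finset.card_le_card (t := Finset.Icc 1 G.size) fun x hx => ?_).trans (by simp)
      exact Finset.mem_Icc.2 ((hT.2.2.2 x).1 (List.mem_toFinset.1 hx))
    have h4 : unlabelled G.size (τ.arr aLabel) ≤ G.size :=
      (Finset.card_filter_le _ _).trans (by simp)
    simp only [Store.setVar, stepsLeft, List.length_nil]
    omega
  clear hT hR₁ hR₂
  rintro υ m ⟨S, T, R₁, R₂, h, hm⟩ hF
  have hF' : ∀ j, Cmd.writesArr j (stepCmd ;; visitCmd) = false → υ.arr j = τ.arr j := hF.arr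
  refine ⟨by omega, fun he => ⟨by omega, ?_⟩, fun he => ?_⟩
  · simp only [Ex.eval, Nat.add_eq_zero_iff] at he
    have hS : S = [] := by
      cases S with
      | nil => rfl
      | cons u S =>
        exact absurd (h.stack.1.symm.trans he.1) (ne_zero_of_mem (h.search.stack_mem u (by simp)))
    have hT : T = [] := by
      cases T with
      | nil => rfl
      | cons u S =>
        exact absurd (h.sources.1.symm.trans he.2)
          (ne_zero_of_mem (h.search.sources_mem u (by simp)))
    subst hS hT
    exact h.search.labelled
  · obtain ⟨n', rfl⟩ := Nat.exists_eq_add_of_le hm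
    rw [wp_seq, show n + 5 + 12 * stepsLeft k G.size (υ.arr aLabel) S T R₁ R₂ + n' - 1 =
      (n + 4 + n') + 12 * stepsLeft k G.size (υ.arr aLabel) S T R₁ R₂ by omega]
    refine (stepCmd_spec ((hF' _ rfl).trans hg₁) ((hF' _ rfl).trans hg₂) hk₁ hk₂
      (hF.compares (σ := (τ.setVar _ _).setVar _ _) hc₁ rfl rfl)
      (hF.compares (σ := (τ.setVar _ _).setVar _ _) hc₂ rfl rfl)
      (by rw [hF' _ rfl, h0₁]) (by rw [hF' _ rfl, h0₂]) h he).mono ?_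
    rintro ω m' - - ⟨w, S', T', R₁', R₂', hw, h', hm'⟩
    obtain ⟨n'', rfl⟩ := Nat.exists_eq_add_of_le hm'
    rw [show n + 4 + n' + 5 + 12 * stepsLeft k G.size (ω.arr aLabel) S' T' R₁' R₂' + n'' =
      (n + 5 + n' + n'') + 4 + 12 * stepsLeft k G.size (ω.arr aLabel) S' T' R₁' R₂' by omega]
    refine (visitCmd_spec h' hw).mono ?_
    rintro ξ l - - ⟨S'', h'', hl⟩
    exact ⟨S'', T', R₁', R₂', h'', by omega⟩

end Lines

/-! ### Reading the input -/

/-! The variable for the number that was read last. -/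

notation "vIn" => 22

/-- Reads the values of both agents at the node in `vI`; if `sw` holds, then the numerators and
denominators are exchanged. -/
def loadNodeCmd (sw : Bool) : Cmd :=
  .inp vIn (.sub (.mul (.num 2) (.var vI)) (.num 1)) ;;
  .put (bif sw then aDen₁ else aNum₁) (.var vI) (.var vIn) ;;
  .inp vIn (.mul (.num 2) (.var vI)) ;;
  .put (bif sw then aNum₁ else aDen₁) (.var vI) (.var vIn) ;;
  .inp vIn (.sub (.add (.mul (.num 2) (.var vM)) (.mul (.num 2) (.var vI))) (.num 1)) ;;
  .put (bif sw then aDen₂ else aNum₂) (.var vI) (.var vIn) ;;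
  .inp vIn (.add (.mul (.num 2) (.var vM)) (.mul (.num 2) (.var vI))) ;;
  .put (bif sw then aNum₂ else aDen₂) (.var vI) (.var vIn) ;;
  .put aVal₁ (.var vI) (.mul (.get aNum₁ (.var vI)) (.get aDen₂ (.var vI))) ;;
  .put aVal₂ (.var vI) (.mul (.get aNum₂ (.var vI)) (.get aDen₁ (.var vI))) ;;
  .put aMax (.var vI) (.add (.get aVal₁ (.var vI))
    (.sub (.get aVal₂ (.var vI)) (.get aVal₁ (.var vI)))) ;;
  .put aGroup₁ (.var vI) (.var vQ) ;; .put aGroup₂ (.var vI) (.var vP)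

/-- Reads the number `k` of signals and the table of values. The profile `s` becomes the node
`s₁ k + s₂ + 1`; the signals of the present node plus one are kept in `vP` and `vQ`. -/
def loadCmd (sw : Bool) : Cmd :=
  .inp vK (.num 0) ;; .set vM (.mul (.var vK) (.var vK)) ;;
  .set vI (.var vM) ;; .set vP (.var vK) ;; .set vQ (.var vK) ;;
  .loop (.var vI)
    (loadNodeCmd sw ;;
      .set vI (.sub (.var vI) (.num 1)) ;; .set vQ (.sub (.var vQ) (.num 1)) ;;
      .ite (.var vQ) (.set vQ (.var vQ))
        (.set vQ (.var vK) ;; .set vP (.sub (.var vP) (.num 1))))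

/-- The entries of the arrays for the node `x` have been computed. -/
structure LoadedAt (sw : Bool) (k : ℕ) (io : ℕ → ℕ) (τ : Store) (x : ℕ) : Prop where
  num₁ : τ.arr aNum₁ x = bif sw then io (2 * x) else io (2 * x - 1)
  den₁ : τ.arr aDen₁ x = bif sw then io (2 * x - 1) else io (2 * x)
  num₂ : τ.arr aNum₂ x = bif sw then io (2 * (k * k) + 2 * x) else io (2 * (k * k) + 2 * x - 1)
  den₂ : τ.arr aDen₂ x = bif sw then io (2 * (k * k) + 2 * x - 1) else io (2 * (k * k) + 2 * x)
  val₁ : τ.arr aVal₁ x = τ.arr aNum₁ x * τ.arr aDen₂ x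
  val₂ : τ.arr aVal₂ x = τ.arr aNum₂ x * τ.arr aDen₁ x
  max : τ.arr aMax x = max (τ.arr aVal₁ x) (τ.arr aVal₂ x)
  group₁ : τ.arr aGroup₁ x = (x - 1) % k + 1
  group₂ : τ.arr aGroup₂ x = (x - 1) / k + 1

theorem LoadedAt.congr {sw : Bool} {k : ℕ} {io : ℕ → ℕ} {τ υ : Store} {x : ℕ}
    (h : LoadedAt sw k io τ x) (hx : ∀ j, υ.arr j x = τ.arr j x) : LoadedAt sw k io υ x := by
  obtain ⟨h1, h2, h3, h4, h5, h6, h7, h8, h9⟩ := h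
  constructor <;> simp only [hx] <;> assumption

theorem div_mod_pred {k j : ℕ} (hk : 1 ≤ k) (hj : 1 ≤ j) :
    (j % k = 0 → (j - 1) % k + 1 = k ∧ (j - 1) / k + 1 = j / k) ∧
    (j % k ≠ 0 → (j - 1) % k + 1 = j % k ∧ (j - 1) / k = j / k) := by
  have h1 := Nat.div_add_mod j k
  have h2 := Nat.mod_lt j hk
  constructor
  · intro h
    obtain ⟨q, hq⟩ := Nat.exists_eq_succ_of_ne_zero (show j / k ≠ 0 by
      intro h'; rw [h, h'] at h1; omega)
    rw [h, hq, Nat.mul_succ] at h1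
    rw [hq, show j - 1 = k * q + (k - 1) by omega, Nat.mul_add_mod, Nat.mod_eq_of_lt (by omega),
      Nat.mul_add_div (by omega), Nat.div_eq_of_lt (by omega : k - 1 < k)]
    omega
  · intro h
    have h3 : j - 1 = k * (j / k) + (j % k - 1) := by omega
    rw [h3, Nat.mul_add_mod, Nat.mod_eq_of_lt (by omega : j % k - 1 < k),
      Nat.mul_add_div (by omega), Nat.div_eq_of_lt (by omega : j % k - 1 < k)]
    omega

theorem loadNodeCmd_spec (sw : Bool) {k lim bd i : ℕ} {τ : Store} (hlim : 4 * (k * k) < lim)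
    (hbd : ∀ a ≤ 4 * (k * k), τ.io a ≤ bd) (hi : τ.var vI = i) (hik : i ≤ k * k)
    (hM : τ.var vM = k * k) (hQ : τ.var vQ = (i - 1) % k + 1) (hP : τ.var vP = (i - 1) / k + 1)
    {n : ℕ} :
    wp lim bd (loadNodeCmd sw) (fun υ m => n ≤ m ∧ LoadedAt sw k τ.io υ i ∧
      ∀ x ≠ i, ∀ j, υ.arr j x = τ.arr j x) τ (n + 13) := by
  have io1 := hbd (2 * i - 1) (by omega)
  have io2 := hbd (2 * i) (by omega)
  have io3 := hbd (2 * (k * k) + 2 * i - 1) (by omega)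
  have io4 := hbd (2 * (k * k) + 2 * i) (by omega)
  have upd : ∀ {υ : Store} {j j' x v : ℕ}, x ≠ i → (υ.setArr j i v).arr j' x = υ.arr j' x := by
    intro υ j j' x v hx
    by_cases hj : j' = j
    · subst hj; simp [Store.setArr, hx]
    · simp [Store.setArr, hj]
  have hv : ∀ {υ : Store} {v : ℕ}, (υ.setVar vIn v).var vI = υ.var vI := fun {υ v} => by
    simp [Store.setVar]
  have hv' : ∀ {υ : Store} {j v : ℕ}, (υ.setVar j v).arr = υ.arr := rfl
  have hv'' : ∀ {υ : Store} {j l v : ℕ}, (υ.setArr j l v).var = υ.var := rfl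
  simp only [loadNodeCmd, wp_seq, wp_inp, wp_put]
  refine ⟨?_, ?_, by omega, by omega, ?_, ?_, by omega, by omega, ?_, ?_, by omega, by omega,
    ?_, ?_, by omega, by omega, by omega, by omega, by omega, by omega, by omega, by omega, ?_,
    fun x hx j => ?_⟩
  on_goal 10 => simp only [Ex.eval, hv, hv', hv'', hi, upd hx]
  all_goals simp only [Store.setVar, Store.setArr, Ex.eval, hi, hM, Function.update_self, ne_eq,
    Nat.reduceEqDiff, not_false_eq_true, Function.update_of_ne, OfNat.one_ne_ofNat]
  on_goal 9 =>
    constructor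
    all_goals cases sw <;> simp [hQ, hP, Nat.max_def]
    all_goals split_ifs <;> omega
  all_goals omega

theorem loadCmd_spec (sw : Bool) {k bd : ℕ} (hk : 1 ≤ k) {io : ℕ → ℕ} (h0 : io 0 = k)
    (hbd : ∀ a ≤ 4 * (k * k), io a ≤ bd) {n : ℕ} :
    wp (4 * k ^ 2 + 4) bd (loadCmd sw) (fun τ m => n ≤ m ∧ τ.var vM = k * k ∧
      (∀ j, τ.arr j 0 = 0) ∧ ∀ x, 1 ≤ x → x ≤ k * k → LoadedAt sw k io τ x)
      ⟨0, 0, io⟩ (n + 6 + 20 * (k * k)) := by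
  have hkk : 1 ≤ k * k := Nat.mul_pos hk hk
  rw [pow_two]
  simp only [loadCmd, wp_seq, wp_inp, wp_set]
  refine ⟨by simp [Ex.eval], hbd _ (by simp [Ex.eval]), by omega, by omega, by omega, by omega,
    by omega, ?_⟩
  refine wp_loop (fun τ m => n + 1 + 20 * τ.var vI ≤ m ∧ τ.var vI ≤ k * k ∧ τ.var vK = k ∧
    τ.var vM = k * k ∧ τ.io = io ∧
    (1 ≤ τ.var vI → τ.var vQ = (τ.var vI - 1) % k + 1 ∧ τ.var vP = (τ.var vI - 1) / k + 1) ∧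
    (∀ j, τ.arr j 0 = 0) ∧
    ∀ x, τ.var vI < x → x ≤ k * k → LoadedAt sw k io τ x) ?_ ?_
  · simp only [Store.setVar, Ex.eval, Function.update_self, ne_eq, Nat.reduceEqDiff,
      not_false_eq_true, Function.update_of_ne, h0, OfNat.zero_ne_ofNat, OfNat.one_ne_ofNat,
      zero_ne_one]
    refine ⟨by omega, le_rfl, trivial, trivial, trivial, fun _ => ?_, fun j => rfl,
      fun x h1 h2 => by omega⟩
    have := (div_mod_pred hk hkk).1 (Nat.mul_mod_right k k)
    rw [Nat.mul_div_cancel _ hk] at this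
    omega
  rintro τ m ⟨hm, hi, hK, hM, hio, hgr, h00, hx⟩ hF
  refine ⟨by omega, fun he => ?_, fun he => ?_⟩
  · have he' : τ.var vI = 0 := he
    exact ⟨by omega, hM, h00, fun x h1 h2 => hx x (by omega) h2⟩
  have he' : τ.var vI ≠ 0 := he
  obtain ⟨hQ, hP⟩ := hgr (by omega)
  obtain ⟨n', rfl⟩ := Nat.exists_eq_add_of_le hm
  rw [wp_seq, show n + 1 + 20 * τ.var vI + n' - 1 = (n + 20 * τ.var vI + n' - 13) + 13 by omega]
  refine (loadNodeCmd_spec sw (k := k) (by omega) (by rw [hio]; exact hbd) rfl hi hM hQ hP).mono ?_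
  rintro υ m' - hF' ⟨hm', hload, hsame⟩
  rw [hio] at hload
  have eI : υ.var vI = τ.var vI := hF'.var _ rfl
  have eK : υ.var vK = k := (hF'.var _ rfl).trans hK
  have eM : υ.var vM = k * k := (hF'.var _ rfl).trans hM
  have eQ := (hF'.var vQ rfl).trans hQ
  have eP := (hF'.var vP rfl).trans hP
  have eio : υ.io = io := (hF'.io rfl).trans hio
  have hx' : ∀ x, τ.var vI - 1 < x → x ≤ k * k → LoadedAt sw k io υ x := by
    intro x h1 h2
    by_cases hxi : x = τ.var vI
    · rw [hxi]; exact hload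
    · exact (hx x (by omega) h2).congr (hsame x hxi)
  have h00' : ∀ j, υ.arr j 0 = 0 := fun j => (hsame 0 he'.symm j).trans (h00 j)
  simp only [wp_seq, wp_set]
  refine ⟨by omega, by omega, ?_⟩
  rw [wp_ite]
  refine ⟨by omega, fun hq => ?_, fun hq => ?_⟩
  · rw [wp_set]
    simp only [Store.setVar, Ex.eval, Function.update_self, ne_eq, Nat.reduceEqDiff,
      not_false_eq_true, Function.update_of_ne, OfNat.zero_ne_ofNat, OfNat.one_ne_ofNat,
      eI, eK, eM, eQ, eP, eio] at hq ⊢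
    refine ⟨by omega, by omega, by omega, trivial, trivial, trivial, fun hi1 => ?_, h00',
      fun x h1 h2 => (hx' x h1 h2).congr fun _ => rfl⟩
    have := (div_mod_pred hk hi1).2 (by omega)
    omega
  · simp only [wp_seq, wp_set]
    simp only [Store.setVar, Ex.eval, Function.update_self, ne_eq, Nat.reduceEqDiff,
      not_false_eq_true, Function.update_of_ne, OfNat.zero_ne_ofNat, OfNat.one_ne_ofNat,
      eI, eK, eM, eQ, eP, eio] at hq ⊢
    refine ⟨by omega, by omega, by omega, by omega, trivial, trivial, trivial, fun hi1 => ?_, h00',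
      fun x h1 h2 => (hx' x h1 h2).congr fun _ => rfl⟩
    have := (div_mod_pred hk hi1).1 (by omega)
    exact ⟨this.1.symm, this.2.symm⟩

/-! ### The optimal ratio and the optimal rule -/

/-! The variables for numerators and denominators of the losses, and of the probabilities. -/

notation "vRest" => 16
notation "vWeight" => 17
notation "vMax₂" => 18
notation "vVal₂" => 19
notation "vMax₁" => 20
notation "vVal₁" => 21

/-- `A' / A` is the performance ratio of agent 2 at the label, `B' / B` that of agent 1 at the node,
and `P / Q` is the optimal ratio. The expressions `on` and `od` compute numerator and denominator
of the conflict value `g`, which are both `0` if the value is `1` by convention; `we` computes a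
denominator of the probability `F` that has the numerator `A Q - A' P`. -/
structure Computes (on od we : Ex) (g F : ℝ → ℝ → ℝ) : Prop where
  value : ∀ (σ : Store) (u w : ℕ), 0 < σ.var vVal₂ → σ.var vVal₂ ≤ σ.var vMax₂ →
    0 < σ.var vVal₁ → σ.var vVal₁ ≤ σ.var vMax₁ →
    u = on.eval σ → w = od.eval (σ.setVar vU u) →
    (u = 0 ∧ w = 0 ∧ g (σ.var vMax₂ / σ.var vVal₂) (σ.var vMax₁ / σ.var vVal₁) = 1) ∨
    (0 < w ∧ g (σ.var vMax₂ / σ.var vVal₂) (σ.var vMax₁ / σ.var vVal₁) = u / w)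
  rule : ∀ (σ : Store) (X W : ℕ), 0 < σ.var vVal₂ → σ.var vVal₂ ≤ σ.var vMax₂ → 0 < σ.var vQ →
    σ.var vQ ≤ σ.var vP → X = σ.var vMax₂ * σ.var vQ - σ.var vVal₂ * σ.var vP →
    W = (if we.eval (σ.setVar vRest X) = 0 then 1 else we.eval (σ.setVar vRest X)) →
    X ≤ W ∧ (X / W : ℝ) = F (σ.var vMax₂ / σ.var vVal₂) (σ.var vP / σ.var vQ)

/-- Fetches the loss of agent 2 at the label of the present node. -/
def labelCmd : Cmd :=
  .set vMax₂ (.get aMax (.get aLabel (.var vI))) ;; .set vVal₂ (.get aVal₂ (.get aLabel (.var vI)))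

/-- Computes the maximum of `1` and the conflict values of the nodes and their labels. -/
def ratioCmd (on od : Ex) : Cmd :=
  .set vP (.num 1) ;; .set vQ (.num 1) ;; .set vI (.var vM) ;;
    .loop (.var vI)
      (labelCmd ;; .set vMax₁ (.get aMax (.var vI)) ;; .set vVal₁ (.get aVal₁ (.var vI)) ;;
        .set vU on ;; .set vW od ;;
        .ite (.sub (.mul (.var vU) (.var vQ)) (.mul (.var vP) (.var vW)))
          (.set vP (.var vU) ;; .set vQ (.var vW)) (.set vW (.var vW)) ;;
        .set vI (.sub (.var vI) (.num 1)))

/-- Writes the ratio and the rule of the labels. -/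
def ruleCmd (we : Ex) : Cmd :=
  .out (.num 0) (.var vP) ;; .out (.num 1) (.var vQ) ;; .set vI (.var vM) ;;
    .loop (.var vI)
      (labelCmd ;;
        .set vRest (.sub (.mul (.var vMax₂) (.var vQ)) (.mul (.var vVal₂) (.var vP))) ;;
        .set vWeight we ;; .ite (.var vWeight) (.set vW (.var vW)) (.set vWeight (.num 1)) ;;
        .out (.mul (.num 2) (.var vI)) (.var vRest) ;;
        .out (.add (.mul (.num 2) (.var vI)) (.num 1)) (.var vWeight) ;;
        .out (.add (.mul (.num 2) (.var vM)) (.mul (.num 2) (.var vI)))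
          (.sub (.var vWeight) (.var vRest)) ;;
        .out (.add (.add (.mul (.num 2) (.var vM)) (.mul (.num 2) (.var vI))) (.num 1))
          (.var vWeight) ;;
        .set vI (.sub (.var vI) (.num 1)))

/-- The labels are nodes, and the performance ratios of all nodes are fractions in `(0, 1]`. -/
structure Ratios (τ : Store) (M : ℕ) : Prop where
  label : ∀ x, 1 ≤ x → x ≤ M → 1 ≤ τ.arr aLabel x ∧ τ.arr aLabel x ≤ M
  val₁ : ∀ x, 1 ≤ x → x ≤ M → 0 < τ.arr aVal₁ x ∧ τ.arr aVal₁ x ≤ τ.arr aMax x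
  val₂ : ∀ x, 1 ≤ x → x ≤ M → 0 < τ.arr aVal₂ x ∧ τ.arr aVal₂ x ≤ τ.arr aMax x

/-- The loss of agent 1 at the node `x`. -/
noncomputable def nodeLoss₁ (τ : Store) (x : ℕ) : ℝ := τ.arr aMax x / τ.arr aVal₁ x

/-- The loss of agent 2 at the node `x`. -/
noncomputable def nodeLoss₂ (τ : Store) (x : ℕ) : ℝ := τ.arr aMax x / τ.arr aVal₂ x

section

variable {on od we : Ex} {g F : ℝ → ℝ → ℝ} {M lim bd n : ℕ} {τ : Store}

theorem ratioCmd_spec (hc : Computes on od we g F) (hM : τ.var vM = M) (hτ : Ratios τ M) :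
    wp lim bd (ratioCmd on od) (fun υ m => n ≤ m ∧ 0 < υ.var vQ ∧ υ.var vQ ≤ υ.var vP ∧
      (∀ x, 1 ≤ x → x ≤ M → g (nodeLoss₂ τ (τ.arr aLabel x)) (nodeLoss₁ τ x) ≤
        υ.var vP / υ.var vQ) ∧
      ((υ.var vP / υ.var vQ : ℝ) = 1 ∨ ∃ x, 1 ≤ x ∧ x ≤ M ∧
        (υ.var vP / υ.var vQ : ℝ) = g (nodeLoss₂ τ (τ.arr aLabel x)) (nodeLoss₁ τ x)))
      τ (n + 4 + 11 * M) := by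
  simp only [ratioCmd, wp_seq, wp_set]
  refine ⟨by omega, by omega, by omega, ?_⟩
  refine wp_loop (fun υ m => n + 1 + 11 * υ.var vI ≤ m ∧ υ.var vI ≤ M ∧ υ.arr = τ.arr ∧
      0 < υ.var vQ ∧ υ.var vQ ≤ υ.var vP ∧
      (∀ x, υ.var vI < x → x ≤ M → g (nodeLoss₂ τ (τ.arr aLabel x)) (nodeLoss₁ τ x) ≤
        υ.var vP / υ.var vQ) ∧
      ((υ.var vP / υ.var vQ : ℝ) = 1 ∨ ∃ x, 1 ≤ x ∧ x ≤ M ∧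
        (υ.var vP / υ.var vQ : ℝ) = g (nodeLoss₂ τ (τ.arr aLabel x)) (nodeLoss₁ τ x))) ?_ ?_
  · simp [Store.setVar, Ex.eval, hM]
    omega
  rintro υ m ⟨hm, hi, harr, hQ, hPQ, hle, hex⟩ -
  refine ⟨by omega, fun he => ?_, fun he => ?_⟩
  · have he' : υ.var vI = 0 := he
    exact ⟨by omega, hQ, hPQ, fun x h1 h2 => hle x (by omega) h2, hex⟩
  have he' : υ.var vI ≠ 0 := he
  obtain ⟨i, hi'⟩ : ∃ i, i = υ.var vI := ⟨_, rfl⟩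
  have hL := hτ.label i (by omega) (by omega)
  have hA := hτ.val₂ _ hL.1 hL.2
  have hB := hτ.val₁ i (by omega) (by omega)
  simp only [labelCmd, wp_seq, wp_set]
  refine ⟨by omega, by omega, by omega, by omega, ?_⟩
  set ω := ((((υ.setVar _ _).setVar _ _).setVar _ _).setVar _ _) with hω
  have w1 : ω.var vMax₂ = τ.arr aMax (τ.arr aLabel i) := by
    simp [hω, Store.setVar, Ex.eval, harr, hi']
  have w2 : ω.var vVal₂ = τ.arr aVal₂ (τ.arr aLabel i) := by
    simp [hω, Store.setVar, Ex.eval, harr, hi']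
  have w3 : ω.var vMax₁ = τ.arr aMax i := by simp [hω, Store.setVar, Ex.eval, harr, hi']
  have w4 : ω.var vVal₁ = τ.arr aVal₁ i := by simp [hω, Store.setVar, Ex.eval, harr, hi']
  have w5 : ω.var vP = υ.var vP := by simp [hω, Store.setVar]
  have w6 : ω.var vQ = υ.var vQ := by simp [hω, Store.setVar]
  have w7 : ω.var vI = i := by simp [hω, Store.setVar, hi']
  have w8 : ω.arr = τ.arr := harr
  obtain ⟨u, hu⟩ : ∃ u, u = on.eval ω := ⟨_, rfl⟩
  obtain ⟨w, hw⟩ : ∃ w, w = od.eval (ω.setVar vU u) := ⟨_, rfl⟩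
  have hval := hc.value ω u w (by rw [w2]; exact hA.1) (by rw [w1, w2]; exact hA.2)
    (by rw [w4]; exact hB.1) (by rw [w3, w4]; exact hB.2) hu hw
  rw [w1, w2, w3, w4] at hval
  change (_ ∧ _ ∧ g (nodeLoss₂ τ (τ.arr aLabel i)) (nodeLoss₁ τ i) = _) ∨
    (_ ∧ g (nodeLoss₂ τ (τ.arr aLabel i)) (nodeLoss₁ τ i) = _) at hval
  rw [← hu, ← hw]
  clear_value ω
  have hQ' : (0 : ℝ) < υ.var vQ := by exact_mod_cast hQ
  have hr1 : (1 : ℝ) ≤ υ.var vP / υ.var vQ := (one_le_div hQ').2 (by exact_mod_cast hPQ)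
  have hlt : ∀ x, i - 1 < x → x = i ∨ i < x := by omega
  rw [← hi'] at hm hi hle
  refine ⟨by omega, by omega, ?_⟩
  rw [wp_ite]
  refine ⟨by omega, fun hgt => ?_, fun hng => ?_⟩
  · simp only [wp_seq, wp_set]
    simp [Store.setVar, Ex.eval, w5, w6, w7, w8] at hgt ⊢
    rcases hval with ⟨rfl, rfl, -⟩ | ⟨hw0, hg⟩
    · simp at hgt
    have hw0' : (0 : ℝ) < w := by exact_mod_cast hw0
    have hlt' : (υ.var vP / υ.var vQ : ℝ) < u / w := by
      rw [div_lt_div_iff₀ hQ' hw0']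
      exact_mod_cast (show υ.var vP * w < u * υ.var vQ by omega)
    refine ⟨by omega, by omega, by omega, by omega, by omega, hw0, ?_, fun x h1 h2 => ?_,
      Or.inr ⟨i, by omega, by omega, hg.symm⟩⟩
    · by_contra! h
      have := (div_lt_one hw0').2 (by exact_mod_cast h : (u : ℝ) < w)
      linarith
    · rcases hlt x h1 with rfl | h1
      · rw [hg]
      · exact (hle x h1 h2).trans hlt'.le
  · simp only [wp_set]
    simp [Store.setVar, Ex.eval, w5, w6, w7, w8] at hng ⊢
    refine ⟨by omega, by omega, by omega, by omega, hQ, hPQ, fun x h1 h2 => ?_, hex⟩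
    rcases hlt x h1 with rfl | h1
    · rcases hval with ⟨rfl, rfl, hg⟩ | ⟨hw0, hg⟩
      · rw [hg]; exact hr1
      · rw [hg, div_le_div_iff₀ (by exact_mod_cast hw0) hQ']
        exact_mod_cast (show u * υ.var vQ ≤ υ.var vP * w by omega)
    · exact hle x h1 h2

/-- The four cells of the output for the node `x`, of which those of agent 2 are found `2 M` cells
behind those of agent 1. -/
structure Written (M : ℕ) (p : ℕ → ℝ) (io : ℕ → ℕ) (x : ℕ) : Prop where
  den_ne : io (2 * x + 1) ≠ 0
  prob₁ : (io (2 * x) / io (2 * x + 1) : ℝ) = p x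
  den_ne₂ : io (2 * M + 2 * x + 1) ≠ 0
  prob₂ : (io (2 * M + 2 * x) / io (2 * M + 2 * x + 1) : ℝ) = 1 - p x

theorem ruleCmd_spec (hc : Computes on od we g F) (hM : τ.var vM = M) (hτ : Ratios τ M)
    (hQ : 0 < τ.var vQ) (hPQ : τ.var vQ ≤ τ.var vP) (hlim : 4 * M + 1 < lim) :
    wp lim bd (ruleCmd we) (fun υ m => n ≤ m ∧ υ.io 0 = τ.var vP ∧ υ.io 1 = τ.var vQ ∧
      ∀ x, 1 ≤ x → x ≤ M → Written M
        (fun x => F (nodeLoss₂ τ (τ.arr aLabel x)) (τ.var vP / τ.var vQ)) υ.io x)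
      τ (n + 4 + 12 * M) := by
  simp only [ruleCmd, wp_seq, wp_set, wp_out]
  refine ⟨by simp [Ex.eval]; omega, by omega, by simp [Ex.eval]; omega, by omega, by omega, ?_⟩
  refine wp_loop (fun υ m => n + 1 + 12 * υ.var vI ≤ m ∧ υ.var vI ≤ M ∧ υ.arr = τ.arr ∧
      υ.io 0 = τ.var vP ∧ υ.io 1 = τ.var vQ ∧
      ∀ x, υ.var vI < x → x ≤ M → Written M
        (fun x => F (nodeLoss₂ τ (τ.arr aLabel x)) (τ.var vP / τ.var vQ)) υ.io x) ?_ ?_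
  · simp [Store.setVar, Store.setIo, Ex.eval, hM]
    omega
  rintro υ m ⟨hm, hi, harr, hio0, hio1, hwr⟩ hF
  have eP : υ.var vP = τ.var vP := hF.var _ rfl
  have eQ : υ.var vQ = τ.var vQ := hF.var _ rfl
  have eM : υ.var vM = M := (hF.var _ rfl).trans hM
  refine ⟨by omega, fun he => ?_, fun he => ?_⟩
  · have he' : υ.var vI = 0 := he
    exact ⟨by omega, hio0, hio1, fun x h1 h2 => hwr x (by omega) h2⟩
  have he' : υ.var vI ≠ 0 := he
  obtain ⟨i, hi'⟩ : ∃ i, i = υ.var vI := ⟨_, rfl⟩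
  have hL := hτ.label i (by omega) (by omega)
  have hA := hτ.val₂ _ hL.1 hL.2
  simp only [labelCmd, wp_seq, wp_set]
  refine ⟨by omega, by omega, ?_⟩
  set ω := (υ.setVar _ _).setVar _ _ with hω
  have w1 : ω.var vMax₂ = τ.arr aMax (τ.arr aLabel i) := by
    simp [hω, Store.setVar, Ex.eval, harr, hi']
  have w2 : ω.var vVal₂ = τ.arr aVal₂ (τ.arr aLabel i) := by
    simp [hω, Store.setVar, Ex.eval, harr, hi']
  have w3 : ω.var vP = τ.var vP := by simp [hω, Store.setVar, eP]
  have w4 : ω.var vQ = τ.var vQ := by simp [hω, Store.setVar, eQ]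
  have w5 : ω.var vM = M := by simp [hω, Store.setVar, eM]
  have w6 : ω.var vI = i := by simp [hω, Store.setVar, hi']
  have w7 : ω.arr = τ.arr := harr
  have w8 : ω.io = υ.io := rfl
  clear_value ω
  rw [← hi'] at hm hi hwr
  obtain ⟨X, hX⟩ : ∃ X, X = ω.var vMax₂ * ω.var vQ - ω.var vVal₂ * ω.var vP := ⟨_, rfl⟩
  have hX' : Ex.eval ω (.sub (.mul (.var vMax₂) (.var vQ)) (.mul (.var vVal₂) (.var vP))) = X :=
    hX.symm
  rw [hX']
  obtain ⟨W, hW⟩ : ∃ W, W = if we.eval (ω.setVar vRest X) = 0 then 1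
    else we.eval (ω.setVar vRest X) := ⟨_, rfl⟩
  obtain ⟨hXW, hF⟩ := hc.rule ω X W (by rw [w2]; exact hA.1) (by rw [w1, w2]; exact hA.2)
    (by rw [w4]; exact hQ) (by rw [w3, w4]; exact hPQ) hX hW
  rw [w1, w2, w3, w4] at hF
  change _ = F (nodeLoss₂ τ (τ.arr aLabel i)) _ at hF
  have hW0 : W ≠ 0 := by rw [hW]; split_ifs <;> simp_all
  refine ⟨by omega, by omega, ?_⟩
  -- `ξ` is the state in which the four cells of the node `i` are about to be written.
  have key : ∀ ξ : Store, ξ.var vRest = X → ξ.var vWeight = W → ξ.var vM = M → ξ.var vI = i →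
      ξ.arr = τ.arr → ξ.io = υ.io → ∀ m', n + 1 + 12 * (i - 1) + 5 ≤ m' →
      wp lim bd (.out (.mul (.num 2) (.var vI)) (.var vRest) ;;
        .out (.add (.mul (.num 2) (.var vI)) (.num 1)) (.var vWeight) ;;
        .out (.add (.mul (.num 2) (.var vM)) (.mul (.num 2) (.var vI)))
          (.sub (.var vWeight) (.var vRest)) ;;
        .out (.add (.add (.mul (.num 2) (.var vM)) (.mul (.num 2) (.var vI))) (.num 1))
          (.var vWeight) ;;
        .set vI (.sub (.var vI) (.num 1)))
        (fun υ m => n + 1 + 12 * υ.var vI ≤ m ∧ υ.var vI ≤ M ∧ υ.arr = τ.arr ∧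
          υ.io 0 = τ.var vP ∧ υ.io 1 = τ.var vQ ∧
          ∀ x, υ.var vI < x → x ≤ M → Written M
            (fun x => F (nodeLoss₂ τ (τ.arr aLabel x)) (τ.var vP / τ.var vQ)) υ.io x) ξ m' := by
    intro ξ x1 x2 x3 x4 x5 x6 m' hm'
    simp only [wp_seq, wp_set, wp_out]
    simp only [Store.setVar, Store.setIo, Ex.eval, x1, x2, x3, x4, x5, x6, Function.update_self]
    refine ⟨by omega, by omega, by omega, by omega, by omega, by omega, by omega, by omega,
      by omega, by omega, by omega, trivial, ?_, ?_, fun x h1 h2 => ?_⟩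
    · rw [Function.update_of_ne (by omega), Function.update_of_ne (by omega),
        Function.update_of_ne (by omega), Function.update_of_ne (by omega), hio0]
    · rw [Function.update_of_ne (by omega), Function.update_of_ne (by omega),
        Function.update_of_ne (by omega), Function.update_of_ne (by omega), hio1]
    obtain ⟨io', hio'⟩ : ∃ io', io' = Function.update (Function.update (Function.update
      (Function.update υ.io (2 * i) X) (2 * i + 1) W) (2 * M + 2 * i) (W - X))
      (2 * M + 2 * i + 1) W := ⟨_, rfl⟩
    rw [← hio']
    have y : ∀ a, a ≠ 2 * i → a ≠ 2 * i + 1 → a ≠ 2 * M + 2 * i → a ≠ 2 * M + 2 * i + 1 →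
        io' a = υ.io a := fun a h1 h2 h3 h4 => by
      rw [hio', Function.update_of_ne h4, Function.update_of_ne h3, Function.update_of_ne h2,
        Function.update_of_ne h1]
    have y1 : io' (2 * i) = X := by
      rw [hio', Function.update_of_ne (by omega), Function.update_of_ne (by omega),
        Function.update_of_ne (by omega), Function.update_self]
    have y2 : io' (2 * i + 1) = W := by
      rw [hio', Function.update_of_ne (by omega), Function.update_of_ne (by omega),
        Function.update_self]
    have y3 : io' (2 * M + 2 * i) = W - X := by
      rw [hio', Function.update_of_ne (by omega), Function.update_self]
    have y4 : io' (2 * M + 2 * i + 1) = W := by rw [hio', Function.update_self]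
    rcases (show x = i ∨ i < x by omega) with rfl | h1
    · refine ⟨by omega, ?_, by omega, ?_⟩
      · rw [y1, y2]; exact hF
      · rw [y3, y4, ← hF, Nat.cast_sub hXW, sub_div, div_self (by exact_mod_cast hW0)]
    · obtain ⟨z1, z2, z3, z4⟩ := hwr x h1 h2
      rw [← y _ (by omega) (by omega) (by omega) (by omega)] at z1 z3
      refine ⟨z1, ?_, z3, ?_⟩
      · rwa [y _ (by omega) (by omega) (by omega) (by omega),
          y _ (by omega) (by omega) (by omega) (by omega)]
      · rwa [y _ (by omega) (by omega) (by omega) (by omega),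
          y _ (by omega) (by omega) (by omega) (by omega)]
  rw [wp_ite]
  refine ⟨by omega, fun hne => ?_, fun h0 => ?_⟩
  all_goals
    simp only [wp_set, Ex.eval] at *
  · have hW' : W = we.eval (ω.setVar vRest X) := by
      rw [hW, if_neg]; simpa [Store.setVar] using hne
    refine ⟨by omega, key _ ?_ ?_ ?_ ?_ ?_ ?_ _ (by omega)⟩
    all_goals simp [Store.setVar, w5, w6, w7, w8, hW']
  · have hW' : W = 1 := by
      rw [hW, if_pos]; simpa [Store.setVar] using h0
    refine ⟨by omega, key _ ?_ ?_ ?_ ?_ ?_ ?_ _ (by omega)⟩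
    all_goals simp [Store.setVar, w5, w6, w7, w8, hW']

end

/-! ### Conflict values and rules as fractions -/

section

variable {A A' B B' P Q X : ℕ}

/-- `X` is the common numerator of the probabilities: `A / A'` is a loss, and `P / Q` a ratio. -/
theorem excess_eq (hA' : 0 < A') (hQ : 0 < Q) (hX : X = A * Q - A' * P) :
    (X : ℝ) = A' * Q * max 0 ((A / A' : ℝ) - P / Q) := by
  have h1 : (0 : ℝ) < A' := by exact_mod_cast hA'
  have h2 : (0 : ℝ) < Q := by exact_mod_cast hQ
  have h3 : (A' * Q : ℝ) * ((A / A' : ℝ) - P / Q) = A * Q - A' * P := by field_simp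
  rw [mul_max_of_nonneg _ _ (by positivity), mul_zero, h3, hX]
  rcases le_total (A * Q) (A' * P) with h | h
  · rw [Nat.sub_eq_zero_of_le h, max_eq_left]
    · simp
    · rw [sub_nonpos]; exact_mod_cast h
  · rw [Nat.cast_sub h, max_eq_right]
    · push_cast; ring
    · rw [sub_nonneg]; exact_mod_cast h

theorem excess_le (hAA : A' ≤ A) (hQP : Q ≤ P) (hX : X = A * Q - A' * P) :
    X ≤ Q * (A - A') ∧ X ≤ P * (A - A') := by
  obtain ⟨c, rfl⟩ := Nat.exists_eq_add_of_le hAA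
  obtain ⟨d, rfl⟩ := Nat.exists_eq_add_of_le hQP
  have h1 : X ≤ Q * c := by
    rw [hX, Nat.sub_le_iff_le_add]
    nlinarith [Nat.zero_le (A' * d)]
  rw [Nat.add_sub_cancel_left]
  exact ⟨h1, h1.trans (Nat.mul_le_mul_right _ (Nat.le_add_right _ _))⟩

theorem eq_of_div_eq_one (hA' : 0 < A') (h : (A / A' : ℝ) = 1) : A = A' := by
  rw [div_eq_one_iff_eq (by exact_mod_cast hA'.ne')] at h
  exact_mod_cast h

theorem mul_lt_mul_of_ratios (hA' : 0 < A') (hAA : A' ≤ A) (hB' : 0 < B') (hBB : B' ≤ B)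
    (h : ¬(A = A' ∧ B = B')) : A' * B' < A * B := by
  obtain ⟨c, rfl⟩ := Nat.exists_eq_add_of_le hAA
  obtain ⟨d, rfl⟩ := Nat.exists_eq_add_of_le hBB
  have h1 : 0 < c ∨ 0 < d := by omega
  rcases h1 with h1 | h1
  · nlinarith [Nat.mul_pos h1 hB', Nat.zero_le (A' * d), Nat.zero_le (c * d)]
  · nlinarith [Nat.mul_pos h1 hA', Nat.zero_le (c * B'), Nat.zero_le (c * d)]

end

/-- The conflict value for a good has the numerator `2 A B - A B' - A' B` and the denominator
`A B - A' B'`. -/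
theorem good_computes :
    Computes (.sub (.sub (.mul (.mul (.num 2) (.var vMax₂)) (.var vMax₁))
        (.mul (.var vMax₂) (.var vVal₁))) (.mul (.var vVal₂) (.var vMax₁)))
      (.sub (.mul (.var vMax₂) (.var vMax₁)) (.mul (.var vVal₂) (.var vVal₁)))
      (.mul (.var vP) (.sub (.var vMax₂) (.var vVal₂))) goodValue goodRule where
  value σ u w := by
    simp only [Ex.eval, Store.setVar, ne_eq, Nat.reduceEqDiff, not_false_eq_true,
      Function.update_of_ne]
    generalize σ.var vMax₂ = A, σ.var vVal₂ = A', σ.var vMax₁ = B, σ.var vVal₁ = B'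
    intro hA' hAA hB' hBB hu hw
    have a1 : (0 : ℝ) < A' := by exact_mod_cast hA'
    have b1 : (0 : ℝ) < B' := by exact_mod_cast hB'
    by_cases h : A = A' ∧ B = B'
    · obtain ⟨rfl, rfl⟩ := h
      refine Or.inl ⟨by rw [hu, mul_assoc]; omega, by rw [hw]; omega, ?_⟩
      rw [div_self a1.ne', div_self b1.ne', goodValue, div_one, conflict_left, div_one]
    · have hlt := mul_lt_mul_of_ratios hA' hAA hB' hBB h
      have hlt' : (0 : ℝ) < A * B - A' * B' := by rw [sub_pos]; exact_mod_cast hlt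
      refine Or.inr ⟨by omega, ?_⟩
      rw [goodValue_eq ((one_le_div a1).2 (by exact_mod_cast hAA))
        ((one_le_div b1).2 (by exact_mod_cast hBB))
        fun h' => h ⟨eq_of_div_eq_one hA' h'.1, eq_of_div_eq_one hB' h'.2⟩]
      have hu' : (u : ℝ) = 2 * A * B - A * B' - A' * B := by
        have h1 : A * B' ≤ A * B := Nat.mul_le_mul_left _ hBB
        have h2 : A' * B ≤ A * B := Nat.mul_le_mul_right _ hAA
        have h3 : 2 * A * B = A * B + A * B := by ring
        rw [hu, Nat.cast_sub (by omega), Nat.cast_sub (by omega)]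
        push_cast; ring
      have hw' : (w : ℝ) = A * B - A' * B' := by
        rw [hw, Nat.cast_sub hlt.le]; push_cast; ring
      rw [hu', hw']
      have h3 : (A / A' : ℝ) * (B / B') - 1 = (A * B - A' * B') / (A' * B') := by field_simp
      rw [h3, div_div_eq_mul_div]
      congr 1
      field_simp
  rule σ X W := by
    simp only [Ex.eval, Store.setVar, ne_eq, Nat.reduceEqDiff, not_false_eq_true,
      Function.update_of_ne]
    generalize σ.var vMax₂ = A, σ.var vVal₂ = A', σ.var vP = P, σ.var vQ = Q
    intro hA' hAA hQ hQP hX hW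
    have a1 : (0 : ℝ) < A' := by exact_mod_cast hA'
    have q1 : (0 : ℝ) < Q := by exact_mod_cast hQ
    have p1 : (0 : ℝ) < P := by exact_mod_cast hQ.trans_le hQP
    have hX' := excess_eq hA' hQ hX
    have hle := (excess_le hAA hQP hX).2
    rcases hAA.eq_or_lt with rfl | hAA
    · rw [Nat.sub_self, mul_zero] at hle hW
      obtain rfl : X = 0 := by omega
      simp [hW, goodRule, a1.ne']
    · have h1 : 0 < P * (A - A') := Nat.mul_pos (by omega) (by omega)
      rw [if_neg h1.ne'] at hW
      refine ⟨hle.trans hW.ge, ?_⟩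
      have h2 : (A - A' : ℝ) ≠ 0 := by
        rw [sub_ne_zero]; exact_mod_cast hAA.ne'
      rw [hX', hW, goodRule, Nat.cast_mul, Nat.cast_sub hAA.le]
      generalize max 0 ((A / A' : ℝ) - P / Q) = m
      have h3 : (A / A' : ℝ) - 1 = (A - A') / A' := by field_simp
      rw [h3]
      field_simp

/-- The conflict value for a chore has the numerator `A B - A' B'` and the denominator
`A B' + A' B - 2 A' B'`. -/
theorem chore_computes :
    Computes (.sub (.mul (.var vMax₂) (.var vMax₁)) (.mul (.var vVal₂) (.var vVal₁)))
      (.sub (.add (.mul (.var vMax₂) (.var vVal₁)) (.mul (.var vVal₂) (.var vMax₁)))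
        (.mul (.mul (.num 2) (.var vVal₂)) (.var vVal₁)))
      (.mul (.var vQ) (.sub (.var vMax₂) (.var vVal₂))) conflict choreRule where
  value σ u w := by
    simp only [Ex.eval, Store.setVar, ne_eq, Nat.reduceEqDiff, not_false_eq_true,
      Function.update_of_ne]
    generalize σ.var vMax₂ = A, σ.var vVal₂ = A', σ.var vMax₁ = B, σ.var vVal₁ = B'
    intro hA' hAA hB' hBB hu hw
    have a1 : (0 : ℝ) < A' := by exact_mod_cast hA'
    have b1 : (0 : ℝ) < B' := by exact_mod_cast hB'
    have h1 : A' * B' ≤ A * B' := Nat.mul_le_mul_right _ hAA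
    have h2 : A' * B' ≤ A' * B := Nat.mul_le_mul_left _ hBB
    have h3 : 2 * A' * B' = A' * B' + A' * B' := by ring
    by_cases h : A = A' ∧ B = B'
    · obtain ⟨rfl, rfl⟩ := h
      refine Or.inl ⟨by omega, by omega, ?_⟩
      rw [div_self a1.ne', div_self b1.ne', conflict_left]
    · have hlt : 2 * A' * B' < A * B' + A' * B := by
        rcases hAA.eq_or_lt with rfl | h4
        · have := Nat.mul_lt_mul_of_pos_left (show B' < B by omega) hA'
          omega
        · have := Nat.mul_lt_mul_of_pos_right h4 hB'
          omega
      refine Or.inr ⟨by omega, ?_⟩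
      rw [conflict_eq fun h' => h ⟨eq_of_div_eq_one hA' h'.1, eq_of_div_eq_one hB' h'.2⟩]
      have hu' : (u : ℝ) = A * B - A' * B' := by
        rw [hu, Nat.cast_sub (Nat.mul_le_mul hAA hBB)]; push_cast; ring
      have hw' : (w : ℝ) = A * B' + A' * B - 2 * A' * B' := by
        rw [hw, Nat.cast_sub hlt.le]; push_cast; ring
      have hpos : (0 : ℝ) < A * B' + A' * B - 2 * A' * B' := by
        rw [sub_pos]; exact_mod_cast hlt
      rw [hu', hw']
      have h3 : (A / A' : ℝ) * (B / B') - 1 = (A * B - A' * B') / (A' * B') := by field_simp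
      have h4 : (A / A' : ℝ) + (B / B') - 2 = (A * B' + A' * B - 2 * A' * B') / (A' * B') := by
        field_simp
      rw [h3, h4, div_div_div_cancel_right₀ (by positivity)]
  rule σ X W := by
    simp only [Ex.eval, Store.setVar, ne_eq, Nat.reduceEqDiff, not_false_eq_true,
      Function.update_of_ne]
    generalize σ.var vMax₂ = A, σ.var vVal₂ = A', σ.var vP = P, σ.var vQ = Q
    intro hA' hAA hQ hQP hX hW
    have a1 : (0 : ℝ) < A' := by exact_mod_cast hA'
    have q1 : (0 : ℝ) < Q := by exact_mod_cast hQ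
    have hX' := excess_eq hA' hQ hX
    have hle := (excess_le hAA hQP hX).1
    rcases hAA.eq_or_lt with rfl | hAA
    · rw [Nat.sub_self, mul_zero] at hle hW
      obtain rfl : X = 0 := by omega
      simp [hW, choreRule, a1.ne']
    · have h1 : 0 < Q * (A - A') := Nat.mul_pos (by omega) (by omega)
      rw [if_neg h1.ne'] at hW
      refine ⟨hle.trans hW.ge, ?_⟩
      have h2 : (A - A' : ℝ) ≠ 0 := by
        rw [sub_ne_zero]; exact_mod_cast hAA.ne'
      rw [hX', hW, choreRule, Nat.cast_mul, Nat.cast_sub hAA.le]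
      generalize max 0 ((A / A' : ℝ) - P / Q) = m
      have h3 : (A / A' : ℝ) - 1 = (A - A') / A' := by field_simp
      rw [h3]
      field_simp

/-- The conflict value of the deterministic problems has the numerator `min (A B') (A' B)` and the
denominator `A' B'`. -/
theorem det_computes :
    Computes (.sub (.mul (.var vMax₂) (.var vVal₁))
        (.sub (.mul (.var vMax₂) (.var vVal₁)) (.mul (.var vVal₂) (.var vMax₁))))
      (.mul (.var vVal₂) (.var vVal₁)) (.var vRest) min detRule where
  value σ u w := by
    simp only [Ex.eval, Store.setVar, ne_eq, Nat.reduceEqDiff, not_false_eq_true,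
      Function.update_of_ne]
    generalize σ.var vMax₂ = A, σ.var vVal₂ = A', σ.var vMax₁ = B, σ.var vVal₁ = B'
    intro hA' hAA hB' hBB hu hw
    have a1 : (0 : ℝ) < A' := by exact_mod_cast hA'
    have b1 : (0 : ℝ) < B' := by exact_mod_cast hB'
    refine Or.inr ⟨hw ▸ Nat.mul_pos hA' hB', ?_⟩
    have hu' : u = min (A * B') (A' * B) := by omega
    rw [hw, hu', Nat.cast_min, ← min_div_div_right (by positivity)]
    push_cast
    rw [mul_div_mul_right _ _ b1.ne', mul_div_mul_left _ _ a1.ne']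
  rule σ X W := by
    simp only [Ex.eval, Store.setVar, Function.update_self]
    generalize σ.var vMax₂ = A, σ.var vVal₂ = A', σ.var vP = P, σ.var vQ = Q
    intro hA' hAA hQ hQP hX hW
    have a1 : (0 : ℝ) < A' := by exact_mod_cast hA'
    have q1 : (0 : ℝ) < Q := by exact_mod_cast hQ
    have hlt : (P / Q : ℝ) < A / A' ↔ X ≠ 0 := by
      rw [div_lt_div_iff₀ q1 a1]
      norm_cast
      rw [hX, mul_comm P]
      omega
    rw [detRule]
    by_cases h : X = 0
    · rw [if_neg fun h' => hlt.1 h' h, h]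
      simp
    · rw [if_pos (hlt.2 h)]
      rw [if_neg h] at hW
      exact ⟨hW.ge, by rw [hW, div_self (by exact_mod_cast h)]⟩

/-! ### Nodes and profiles -/

section

variable {k : ℕ}

/-- The node of a profile. -/
def nodeOf (s : Profile 2 k) : ℕ := pos 0 s + 1

/-- The profile of a node. -/
def profileOf (hk : 0 < k) (x : ℕ) : Profile 2 k :=
  ![⟨(x - 1) / k % k, Nat.mod_lt _ hk⟩, ⟨(x - 1) % k, Nat.mod_lt _ hk⟩]

theorem nodeOf_eq (s : Profile 2 k) : nodeOf s = (s 0 : ℕ) * k + s 1 + 1 := by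
  simp [nodeOf, pos]

theorem pos_one_eq (s : Profile 2 k) : pos 1 s = k * k + pos 0 s := by
  simp only [pos, Fin.val_one, Fin.val_zero]
  ring

theorem one_le_nodeOf (s : Profile 2 k) : 1 ≤ nodeOf s := Nat.le_add_left _ _

theorem nodeOf_le (s : Profile 2 k) : nodeOf s ≤ k * k := by
  have h0 := (s 0).isLt
  have h1 := (s 1).isLt
  have : ((s 0 : ℕ) + 1) * k ≤ k * k := Nat.mul_le_mul_right _ h0
  rw [nodeOf_eq]
  nlinarith

theorem nodeOf_sub_div (s : Profile 2 k) : (nodeOf s - 1) / k = s 0 := by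
  have h1 := (s 1).isLt
  rw [nodeOf_eq, Nat.add_sub_cancel, mul_comm, Nat.mul_add_div (by omega), Nat.div_eq_of_lt h1,
    add_zero]

theorem nodeOf_sub_mod (s : Profile 2 k) : (nodeOf s - 1) % k = s 1 := by
  have h1 := (s 1).isLt
  rw [nodeOf_eq, Nat.add_sub_cancel, mul_comm, Nat.mul_add_mod, Nat.mod_eq_of_lt h1]

theorem profileOf_nodeOf (hk : 0 < k) (s : Profile 2 k) : profileOf hk (nodeOf s) = s := by
  funext i
  fin_cases i
  · apply Fin.ext
    simpa [profileOf, nodeOf_sub_div] using Nat.mod_eq_of_lt (s 0).isLt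
  · apply Fin.ext
    simp [profileOf, nodeOf_sub_mod]

theorem nodeOf_profileOf (hk : 0 < k) {x : ℕ} (h1 : 1 ≤ x) (h2 : x ≤ k * k) :
    nodeOf (profileOf hk x) = x := by
  have h3 : (x - 1) / k < k := (Nat.div_lt_iff_lt_mul hk).2 (by omega)
  have h4 := Nat.div_add_mod (x - 1) k
  rw [nodeOf_eq]
  simp only [profileOf, Matrix.cons_val_zero, Matrix.cons_val_one, Nat.mod_eq_of_lt h3]
  rw [mul_comm]
  omega

theorem exists_pos_eq (hk : 0 < k) {j : ℕ} (hj : j < 2 * (k * k)) :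
    ∃ i s, pos (k := k) i s = j := by
  rcases lt_or_ge j (k * k) with h | h
  · have := nodeOf_profileOf hk (x := j + 1) (by omega) (by omega)
    exact ⟨0, profileOf hk (j + 1), by rw [nodeOf] at this; omega⟩
  · have := nodeOf_profileOf hk (x := j - k * k + 1) (by omega) (by omega)
    exact ⟨1, profileOf hk (j - k * k + 1), by rw [pos_one_eq]; rw [nodeOf] at this; omega⟩

/-- The digraph on the nodes is the constraint digraph of the values `v`. -/
structure Models (G : Lines) (v : Family 2 k) : Prop where
  size : G.size = k * k
  group₁ : ∀ s : Profile 2 k, G.group₁ (nodeOf s) = s 1 + 1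
  group₂ : ∀ s : Profile 2 k, G.group₂ (nodeOf s) = s 0 + 1
  key₁ : ∀ s, (G.key₁ (nodeOf s) : ℝ) = v 0 s
  key₂ : ∀ s, (G.key₂ (nodeOf s) : ℝ) = (v 1 s)⁻¹

variable {G : Lines} {v : Family 2 k}

theorem Models.nodeOf_mem (h : Models G v) (s : Profile 2 k) : nodeOf s ∈ G.nodeSet :=
  ⟨one_le_nodeOf s, h.size ▸ nodeOf_le s⟩

theorem Models.edge_iff (h : Models G v) (hv : ∀ i s, 0 < v i s) (s s' : Profile 2 k) :
    G.Edge (nodeOf s) (nodeOf s') ↔ Arc v s s' := by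
  have h₁ : ∀ x y, G.key₁ x < G.key₁ y ↔ (G.key₁ x : ℝ) < G.key₁ y := fun x y => Rat.cast_lt.symm
  have h₂ : ∀ x y, G.key₂ x < G.key₂ y ↔ (G.key₂ x : ℝ) < G.key₂ y := fun x y => Rat.cast_lt.symm
  rw [Lines.Edge, and_iff_right ⟨h.nodeOf_mem s, h.nodeOf_mem s'⟩, h₁, h₂, h.key₁, h.key₁, h.key₂,
    h.key₂, inv_lt_inv₀ (hv 1 s) (hv 1 s'), h.group₁, h.group₁, h.group₂, h.group₂]
  refine or_congr ⟨fun ⟨h1, h2⟩ => ⟨s' 0, ?_, h2⟩, ?_⟩ ⟨fun ⟨h1, h2⟩ => ⟨s' 1, ?_, h2⟩, ?_⟩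
  · funext i
    fin_cases i
    · simp
    · simpa using Fin.ext (by omega)
  · rintro ⟨t, rfl, h2⟩
    exact ⟨by simp, h2⟩
  · funext i
    fin_cases i
    · simpa using Fin.ext (by omega)
    · simp
  · rintro ⟨t, rfl, h2⟩
    exact ⟨by simp, h2⟩

theorem Models.isLabel (h : Models G v) (hv : ∀ i s, 0 < v i s) (hk : 0 < k) {demand : ℕ → ℚ}
    {lab : ℕ → ℕ} (hd : ∀ s, (demand (nodeOf s) : ℝ) = loss v 1 s) (hl : G.Labelled demand lab) :
    IsLabel v (fun s => profileOf hk (lab (nodeOf s))) := by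
  have hnode : ∀ x ∈ G.nodeSet, nodeOf (profileOf hk x) = x := fun x hx =>
    nodeOf_profileOf hk hx.1 (h.size ▸ hx.2)
  have hdem : ∀ s, loss v 1 (profileOf hk (lab (nodeOf s))) = demand (lab (nodeOf s)) := fun s => by
    rw [← hd, hnode _ (hl.reach _ (h.nodeOf_mem s)).1]
  refine ⟨fun s => ?_, fun s s' ha => ?_, fun s => ?_⟩
  · have := (hl.reach _ (h.nodeOf_mem s)).2.lift (p := Arc v) (profileOf hk) fun a b hab => by
      rwa [Function.onFun, ← h.edge_iff hv, hnode a hab.1.1, hnode b hab.1.2]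
    rwa [Function.onFun, profileOf_nodeOf] at this
  · rw [hdem, hdem]
    exact_mod_cast hl.mono _ _ ((h.edge_iff hv s s').2 ha)
  · rw [hdem, ← hd]
    exact_mod_cast hl.le _ (h.nodeOf_mem s)

end

/-! ### Keys -/

theorem compares_div {σ : Store} {kn kd : ℕ} {U : Set ℕ} (h : ∀ x ∈ U, 0 < σ.arr kd x) :
    Compares σ kn kd (fun x => (σ.arr kn x / σ.arr kd x : ℚ)) U := by
  intro a ha b hb
  rw [div_lt_div_iff₀ (by exact_mod_cast h a ha) (by exact_mod_cast h b hb)]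
  norm_cast

/-- Fractions of numbers with at most `c` bits take at most `4 ^ c` values, and there are no more
values than nodes. -/
theorem length_le_of_keys {f g : ℕ → ℕ} {M c : ℕ} (hf : ∀ x, 1 ≤ x → x ≤ M → f x < 2 ^ c)
    (hg : ∀ x, 1 ≤ x → x ≤ M → g x < 2 ^ c) {l : List ℕ} (hl : ∀ x ∈ l, 1 ≤ x ∧ x ≤ M)
    (hp : l.Pairwise fun x y => (f x / g x : ℚ) ≠ f y / g y) :
    l.length ≤ 2 ^ min M.size (2 * c) := by
  have hn : l.Nodup := hp.imp fun h h' => h (by rw [h'])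
  have hn' : (l.map fun x => (f x, g x)).Nodup :=
    List.Pairwise.map _ (fun x y (h : (f x / g x : ℚ) ≠ f y / g y) (h' : (f x, g x) = (f y, g y)) =>
      h (by rw [(Prod.mk.inj h').1, (Prod.mk.inj h').2])) hp
  rcases min_cases M.size (2 * c) with ⟨h, -⟩ | ⟨h, -⟩
  · rw [h]
    calc l.length = l.toFinset.card := (List.toFinset_card_of_nodup hn).symm
      _ ≤ (Finset.Icc 1 M).card := Finset.card_le_card fun x hx =>
          Finset.mem_Icc.2 (hl x (List.mem_toFinset.1 hx))
      _ = M := by simp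
      _ ≤ 2 ^ M.size := (Nat.lt_size_self M).le
  · rw [h]
    calc l.length = (l.map fun x => (f x, g x)).toFinset.card := by
          rw [List.toFinset_card_of_nodup hn', List.length_map]
      _ ≤ (Finset.range (2 ^ c) ×ˢ Finset.range (2 ^ c)).card := Finset.card_le_card fun x hx => by
          obtain ⟨y, hy, rfl⟩ := List.mem_map.1 (List.mem_toFinset.1 hx)
          obtain ⟨h1, h2⟩ := hl y hy
          simp [hf y h1 h2, hg y h1 h2]
      _ = 2 ^ (2 * c) := by rw [Finset.card_product, Finset.card_range, two_mul, pow_add]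

/-! ### The program -/

/-- The program for a variant of the problem: `sw` says whether the values are the inverses of the
input, and the expressions are those of `Computes`. -/
def solveCmd (sw : Bool) (on od we : Ex) : Cmd :=
  loadCmd sw ;; sortCmd aNum₁ aDen₁ aGroup₁ aHead₁ aLink₁ ;;
    sortCmd aDen₂ aNum₂ aGroup₂ aHead₂ aLink₂ ;; sortCmd aMax aVal₂ aZero aHead₃ aLink₃ ;;
    searchCmd ;; ratioCmd on od ;; ruleCmd we

section

variable {k b : ℕ}

/-- The arrays contain the data of all profiles for the values `nu / de`. -/
structure Tabulated (τ : Store) (nu de : Fin 2 → Profile 2 k → ℕ) : Prop where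
  num₁ : ∀ s : Profile 2 k, τ.arr aNum₁ (nodeOf s) = nu 0 s
  den₁ : ∀ s : Profile 2 k, τ.arr aDen₁ (nodeOf s) = de 0 s
  num₂ : ∀ s : Profile 2 k, τ.arr aNum₂ (nodeOf s) = nu 1 s
  den₂ : ∀ s : Profile 2 k, τ.arr aDen₂ (nodeOf s) = de 1 s
  val₁ : ∀ s : Profile 2 k, τ.arr aVal₁ (nodeOf s) = nu 0 s * de 1 s
  val₂ : ∀ s : Profile 2 k, τ.arr aVal₂ (nodeOf s) = nu 1 s * de 0 s
  max : ∀ s : Profile 2 k, τ.arr aMax (nodeOf s) = max (nu 0 s * de 1 s) (nu 1 s * de 0 s)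
  group₁ : ∀ s : Profile 2 k, τ.arr aGroup₁ (nodeOf s) = s 1 + 1
  group₂ : ∀ s : Profile 2 k, τ.arr aGroup₂ (nodeOf s) = s 0 + 1

theorem tabulated_of_loadedAt {sw : Bool} {num den : Fin 2 → Profile 2 k → ℕ} {io : ℕ → ℕ}
    {τ : Store} (hio : Holds num den io) (h : ∀ x, 1 ≤ x → x ≤ k * k → LoadedAt sw k io τ x) :
    Tabulated τ (bif sw then den else num) (bif sw then num else den) := by
  have h' := fun s : Profile 2 k => h (nodeOf s) (one_le_nodeOf s) (nodeOf_le s)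
  have e1 : ∀ s : Profile 2 k, 2 * nodeOf s - 1 = 1 + 2 * pos 0 s := fun s => by
    rw [nodeOf]; omega
  have e2 : ∀ s : Profile 2 k, 2 * nodeOf s = 2 + 2 * pos 0 s := fun s => by rw [nodeOf]; omega
  have e3 : ∀ s : Profile 2 k, 2 * (k * k) + 2 * nodeOf s - 1 = 1 + 2 * pos 1 s := fun s => by
    rw [nodeOf, pos_one_eq]; omega
  have e4 : ∀ s : Profile 2 k, 2 * (k * k) + 2 * nodeOf s = 2 + 2 * pos 1 s := fun s => by
    rw [nodeOf, pos_one_eq]; omega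
  have n₁ : ∀ s, τ.arr aNum₁ (nodeOf s) = (bif sw then den else num) 0 s := fun s => by
    rw [(h' s).num₁, e1, e2, hio.num_eq, hio.den_eq]; cases sw <;> rfl
  have d₁ : ∀ s, τ.arr aDen₁ (nodeOf s) = (bif sw then num else den) 0 s := fun s => by
    rw [(h' s).den₁, e1, e2, hio.num_eq, hio.den_eq]; cases sw <;> rfl
  have n₂ : ∀ s, τ.arr aNum₂ (nodeOf s) = (bif sw then den else num) 1 s := fun s => by
    rw [(h' s).num₂, e3, e4, hio.num_eq, hio.den_eq]; cases sw <;> rfl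
  have d₂ : ∀ s, τ.arr aDen₂ (nodeOf s) = (bif sw then num else den) 1 s := fun s => by
    rw [(h' s).den₂, e3, e4, hio.num_eq, hio.den_eq]; cases sw <;> rfl
  have v₁ := fun s => ((h' s).val₁).trans (by rw [n₁, d₂])
  have v₂ := fun s => ((h' s).val₂).trans (by rw [n₂, d₁])
  exact ⟨n₁, d₁, n₂, d₂, v₁, v₂, fun s => by rw [(h' s).max, v₁, v₂],
    fun s => by rw [(h' s).group₁, nodeOf_sub_mod],
    fun s => by rw [(h' s).group₂, nodeOf_sub_div]⟩

/-- The digraph that the arrays describe. -/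
def linesOf (k : ℕ) (τ : Store) : Lines where
  size := k * k
  group₁ := τ.arr aGroup₁
  group₂ := τ.arr aGroup₂
  key₁ x := τ.arr aNum₁ x / τ.arr aDen₁ x
  key₂ x := τ.arr aDen₂ x / τ.arr aNum₂ x

variable {τ : Store} {nu de : Fin 2 → Profile 2 k → ℕ}

theorem Tabulated.models (h : Tabulated τ nu de) : Models (linesOf k τ) (fractions nu de) where
  size := rfl
  group₁ := h.group₁
  group₂ := h.group₂
  key₁ s := by simp [linesOf, fractions, h.num₁, h.den₁]
  key₂ s := by simp [linesOf, fractions, h.num₂, h.den₂]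

section

variable (h : Tabulated τ nu de) (hde : ∀ i s, 0 < de i s)
include h hde

theorem Tabulated.max_eq (s : Profile 2 k) :
    Max.max (fractions nu de 0 s) (fractions nu de 1 s) =
      (τ.arr aMax (nodeOf s) : ℝ) / (de 0 s * de 1 s) := by
  have h3 : (0 : ℝ) < de 0 s := by exact_mod_cast hde 0 s
  have h4 : (0 : ℝ) < de 1 s := by exact_mod_cast hde 1 s
  rw [h.max, Nat.cast_max, ← max_div_div_right (by positivity)]
  simp only [fractions]
  push_cast
  congr 1 <;> field_simp

variable (hnu : ∀ i s, 0 < nu i s)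
include hnu

theorem Tabulated.loss_zero (s : Profile 2 k) :
    loss (fractions nu de) 0 s = nodeLoss₁ τ (nodeOf s) := by
  have h1 : (0 : ℝ) < nu 0 s := by exact_mod_cast hnu 0 s
  have h3 : (0 : ℝ) < de 0 s := by exact_mod_cast hde 0 s
  have h4 : (0 : ℝ) < de 1 s := by exact_mod_cast hde 1 s
  rw [loss_eq, nodeLoss₁, h.max_eq hde, h.val₁]
  simp only [fractions]
  push_cast
  field_simp

theorem Tabulated.loss_one (s : Profile 2 k) :
    loss (fractions nu de) 1 s = nodeLoss₂ τ (nodeOf s) := by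
  have h2 : (0 : ℝ) < nu 1 s := by exact_mod_cast hnu 1 s
  have h3 : (0 : ℝ) < de 0 s := by exact_mod_cast hde 0 s
  have h4 : (0 : ℝ) < de 1 s := by exact_mod_cast hde 1 s
  rw [loss_eq, nodeLoss₂, h.max_eq hde, h.val₂]
  simp only [fractions]
  push_cast
  field_simp

end

theorem Written.isOutput {p : ℕ → ℝ} {io : ℕ → ℕ} {r : ℝ} (h1 : io 1 ≠ 0)
    (hr : r = (io 0 / io 1 : ℝ)) (h : ∀ x, 1 ≤ x → x ≤ k * k → Written (k * k) p io x) :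
    IsOutput (ruleOf fun s : Profile 2 k => p (nodeOf s)) r ⟨0, io⟩ := by
  have h' := fun s : Profile 2 k => h (nodeOf s) (one_le_nodeOf s) (nodeOf_le s)
  have e1 : ∀ s : Profile 2 k, 2 + 2 * pos 0 s = 2 * nodeOf s := fun s => by rw [nodeOf]; omega
  have e2 : ∀ s : Profile 2 k, 3 + 2 * pos 0 s = 2 * nodeOf s + 1 := fun s => by
    rw [nodeOf]; omega
  have e3 : ∀ s : Profile 2 k, 2 + 2 * pos 1 s = 2 * (k * k) + 2 * nodeOf s := fun s => by
    rw [nodeOf, pos_one_eq]; omega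
  have e4 : ∀ s : Profile 2 k, 3 + 2 * pos 1 s = 2 * (k * k) + 2 * nodeOf s + 1 := fun s => by
    rw [nodeOf, pos_one_eq]; omega
  refine ⟨h1, hr, fun i s => ?_, fun i s => ?_⟩
  · fin_cases i
    · simpa only [Fin.zero_eta, e2] using (h' s).den_ne
    · simpa only [Fin.mk_one, e4] using (h' s).den_ne₂
  · fin_cases i
    · simpa only [Fin.zero_eta, e1, e2, ruleOf, if_true] using (h' s).prob₁.symm
    · simpa only [Fin.mk_one, e3, e4, ruleOf, one_ne_zero, if_false] using (h' s).prob₂.symm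

theorem solveCmd_spec {sw : Bool} {on od we : Ex} {g F : ℝ → ℝ → ℝ}
    (hc : Computes on od we g F) {num den : Fin 2 → Profile 2 k → ℕ} (hk : 1 ≤ k)
    (hnum : ∀ i s, 0 < num i s) (hden : ∀ i s, 0 < den i s)
    (hsize : ∀ i s, (num i s).size + (den i s).size ≤ b) {io : ℕ → ℕ} (hio : Holds num den io)
    {S : Family 2 k → ℝ → Prop} {v : Family 2 k}
    (hv : v = fractions (bif sw then den else num) (bif sw then num else den))
    (hS : ∀ lab r, IsLabel v lab → 1 ≤ r → (∀ s, g (loss v 1 (lab s)) (loss v 0 s) ≤ r) →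
      (r = 1 ∨ ∃ s, r = g (loss v 1 (lab s)) (loss v 0 s)) →
      S (ruleOf fun s => F (loss v 1 (lab s)) r) r) :
    wp (4 * k ^ 2 + 4) (inputBound k b) (solveCmd sw on od we)
      (fun τ _ => ∃ x r, IsOutput x r ⟨0, τ.io⟩ ∧ S x r) ⟨0, 0, io⟩
      (610 * (k ^ 2 * (min (k ^ 2).size (4 * b) + 1))) := by
  have hkk : 1 ≤ k * k := Nat.mul_pos hk hk
  have hlt : ∀ i s, num i s < 2 ^ b ∧ den i s < 2 ^ b := fun i s => by
    have := hsize i s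
    exact ⟨Nat.size_le.1 (by omega), Nat.size_le.1 (by omega)⟩
  set nu := bif sw then den else num with hnu
  set de := bif sw then num else den with hde
  have hnu0 : ∀ i s, 0 < nu i s := by cases sw <;> assumption
  have hde0 : ∀ i s, 0 < de i s := by cases sw <;> assumption
  have hnub : ∀ i s, nu i s < 2 ^ b := by
    cases sw
    · exact fun i s => (hlt i s).1
    · exact fun i s => (hlt i s).2
  have hdeb : ∀ i s, de i s < 2 ^ b := by
    cases sw
    · exact fun i s => (hlt i s).2
    · exact fun i s => (hlt i s).1
  have hv0 : ∀ i s, 0 < v i s := fun i s => by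
    rw [hv]
    exact div_pos (by exact_mod_cast hnu0 i s) (by exact_mod_cast hde0 i s)
  clear_value nu de
  have hbd : ∀ a ≤ 4 * (k * k), io a ≤ inputBound k b := by
    intro a ha
    have h1 : 1 ≤ 2 ^ b := Nat.one_le_two_pow
    rw [inputBound]
    rcases Nat.eq_zero_or_pos a with rfl | ha0
    · rw [hio.signals]; nlinarith
    obtain ⟨i, s, hs⟩ := exists_pos_eq hk (j := (a - 1) / 2) (by omega)
    have h2 := hlt i s
    rcases (show a = 1 + 2 * ((a - 1) / 2) ∨ a = 2 + 2 * ((a - 1) / 2) by omega) with h | h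
    · rw [h, ← hs, hio.num_eq]; nlinarith
    · rw [h, ← hs, hio.den_eq]; nlinarith
  set L := min (k ^ 2).size (4 * b) with hL
  have hcred : 610 * (k ^ 2 * (L + 1)) =
      ((((((((k * k) * (496 * L + 36) - 36) + 4 + 12 * (k * k)) + 4 + 11 * (k * k)) + 7 +
        48 * (k * k)) + 5 + (k * k) * (38 * L + 161)) + 5 + (k * k) * (38 * L + 161)) + 5 +
        (k * k) * (38 * L + 161)) + 6 + 20 * (k * k) := by
    have : 36 ≤ (k * k) * (496 * L + 36) := by nlinarith [Nat.zero_le ((k * k) * L)]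
    obtain ⟨c, hc⟩ := Nat.exists_eq_add_of_le this
    rw [hc, Nat.add_sub_cancel_left]
    nlinarith
  rw [hcred]
  generalize (k * k) * (496 * L + 36) - 36 = n
  rw [solveCmd, wp_seq]
  refine (loadCmd_spec sw hk hio.signals hbd).mono ?_
  rintro τ m - hF ⟨hm, hM, h00, hload⟩
  have htab := tabulated_of_loadedAt hio hload
  rw [← hnu, ← hde] at htab
  have hset : (linesOf k τ).nodeSet = {x | 1 ≤ x ∧ x ≤ k * k} := rfl
  have hnode : ∀ x, 1 ≤ x → x ≤ k * k → ∃ s : Profile 2 k, x = nodeOf s := fun x h1 h2 =>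
    ⟨profileOf hk x, (nodeOf_profileOf hk h1 h2).symm⟩
  have hz : ∀ j, (loadCmd sw).writesArr j = false → ∀ x, τ.arr j x = 0 := fun j hj x => by
    rw [hF.arr j hj]; rfl
  have hpow : 2 ^ b ≤ 2 ^ (2 * b) := Nat.pow_le_pow_right (by omega) (by omega)
  have hmul : ∀ {x y : ℕ}, x < 2 ^ b → y < 2 ^ b → x * y < 2 ^ (2 * b) := fun hx hy => by
    rw [two_mul, pow_add]
    exact Nat.mul_lt_mul'' hx hy
  have hM' : (k ^ 2).size = (k * k).size := by rw [pow_two]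
  have hL' : L = min (k * k).size (2 * (2 * b)) := by
    rw [hL, hM']; congr 1; ring
  have b₁ : ∀ x, 1 ≤ x → x ≤ k * k → τ.arr aNum₁ x < 2 ^ (2 * b) ∧ τ.arr aDen₁ x < 2 ^ (2 * b) ∧
      τ.arr aNum₂ x < 2 ^ (2 * b) ∧ τ.arr aDen₂ x < 2 ^ (2 * b) ∧ τ.arr aMax x < 2 ^ (2 * b) ∧
      τ.arr aVal₂ x < 2 ^ (2 * b) := by
    intro x h1 h2
    obtain ⟨s, rfl⟩ := hnode x h1 h2
    rw [htab.num₁, htab.den₁, htab.num₂, htab.den₂, htab.max, htab.val₂]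
    exact ⟨(hnub _ _).trans_le hpow, (hdeb _ _).trans_le hpow, (hnub _ _).trans_le hpow,
      (hdeb _ _).trans_le hpow, max_lt (hmul (hnub _ _) (hdeb _ _)) (hmul (hnub _ _) (hdeb _ _)),
      hmul (hnub _ _) (hdeb _ _)⟩
  have p₁ : ∀ x ∈ {x | 1 ≤ x ∧ x ≤ k * k}, 0 < τ.arr aDen₁ x ∧ 0 < τ.arr aNum₂ x ∧
      0 < τ.arr aVal₂ x := by
    rintro x ⟨h1, h2⟩
    obtain ⟨s, rfl⟩ := hnode x h1 h2
    rw [htab.den₁, htab.num₂, htab.val₂]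
    exact ⟨hde0 _ _, hnu0 _ _, Nat.mul_pos (hnu0 _ _) (hde0 _ _)⟩
  have c₁ : Compares τ aNum₁ aDen₁ (linesOf k τ).key₁ {x | 1 ≤ x ∧ x ≤ k * k} :=
    compares_div fun x hx => (p₁ x hx).1
  have c₂ : Compares τ aDen₂ aNum₂ (linesOf k τ).key₂ {x | 1 ≤ x ∧ x ≤ k * k} :=
    compares_div fun x hx => (p₁ x hx).2.1
  have c₃ : Compares τ aMax aVal₂ (fun x => (τ.arr aMax x / τ.arr aVal₂ x : ℚ))
      {x | 1 ≤ x ∧ x ≤ k * k} := compares_div fun x hx => (p₁ x hx).2.2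
  obtain ⟨n₁, rfl⟩ : ∃ n₁, m = n₁ + 5 + k * k * (38 * L + 161) :=
    ⟨m - (5 + k * k * (38 * L + 161)), by omega⟩
  rw [wp_seq]
  refine (sortCmd_spec (L := L) (by decide) (by decide) (by decide) (by decide) (by decide)
    (by decide) (by decide) (by decide) hM hkk (fun l h1 h2 => hL' ▸ length_le_of_keys
      (fun x h1 h2 => (b₁ x h1 h2).1) (fun x h1 h2 => (b₁ x h1 h2).2.1) h1 h2) c₁
      (h00 _) (hz _ (by cases sw <;> rfl))).mono ?_
  rintro τ₁ m₁ - F₁ ⟨hm₁, h0₁, hs₁⟩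
  obtain ⟨n₂, rfl⟩ : ∃ n₂, m₁ = n₂ + 5 + k * k * (38 * L + 161) :=
    ⟨m₁ - (5 + k * k * (38 * L + 161)), by omega⟩
  rw [wp_seq]
  refine (sortCmd_spec (L := L) (by decide) (by decide) (by decide) (by decide) (by decide)
    (by decide) (by decide) (by decide) ((F₁.var _ rfl).trans hM) hkk
    (fun l h1 h2 => hL' ▸ length_le_of_keys
      (fun x h1 h2 => (b₁ x h1 h2).2.2.2.1) (fun x h1 h2 => (b₁ x h1 h2).2.2.1) h1 h2)
      (F₁.compares c₂ rfl rfl) h0₁ (fun y => by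
        rw [F₁.arr _ rfl]; exact hz _ (by cases sw <;> rfl) y)).mono ?_
  rintro τ₂ m₂ - F₂ ⟨hm₂, h0₂, hs₂⟩
  obtain ⟨n₃, rfl⟩ : ∃ n₃, m₂ = n₃ + 5 + k * k * (38 * L + 161) :=
    ⟨m₂ - (5 + k * k * (38 * L + 161)), by omega⟩
  rw [wp_seq]
  refine (sortCmd_spec (L := L) (by decide) (by decide) (by decide) (by decide) (by decide)
    (by decide) (by decide) (by decide) ((F₂.var _ rfl).trans ((F₁.var _ rfl).trans hM)) hkk
    (fun l h1 h2 => hL' ▸ length_le_of_keys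
      (fun x h1 h2 => (b₁ x h1 h2).2.2.2.2.1) (fun x h1 h2 => (b₁ x h1 h2).2.2.2.2.2) h1 h2)
      (F₂.compares (F₁.compares c₃ rfl rfl) rfl rfl) h0₂ (fun y => by
        rw [F₂.arr _ rfl, F₁.arr _ rfl]; exact hz _ (by cases sw <;> rfl) y)).mono ?_
  rintro τ₃ m₃ - F₃ ⟨hm₃, h0₃, hs₃⟩
  -- The data of the nodes have not been changed by sorting.
  have e : ∀ j, (sortCmd aNum₁ aDen₁ aGroup₁ aHead₁ aLink₁).writesArr j = false →
      (sortCmd aDen₂ aNum₂ aGroup₂ aHead₂ aLink₂).writesArr j = false →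
      (sortCmd aMax aVal₂ aZero aHead₃ aLink₃).writesArr j = false → τ₃.arr j = τ.arr j :=
    fun j h1 h2 h3 => (F₃.arr j h3).trans ((F₂.arr j h2).trans (F₁.arr j h1))
  obtain ⟨n₄, rfl⟩ : ∃ n₄, m₃ = n₄ + 7 + 48 * (linesOf k τ).size :=
    ⟨m₃ - (7 + 48 * (k * k)), by simp only [linesOf]; omega⟩
  have hsz : (linesOf k τ).size = k * k := rfl
  have hgr : ∀ x ∈ (linesOf k τ).nodeSet, (linesOf k τ).group₁ x ≤ k ∧
      (linesOf k τ).group₂ x ≤ k := by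
    rintro x ⟨h1, h2⟩
    obtain ⟨s, rfl⟩ := hnode x h1 h2
    rw [htab.models.group₁, htab.models.group₂]
    exact ⟨(s 1).isLt, (s 0).isLt⟩
  rw [wp_seq]
  refine (Lines.searchCmd_spec (G := linesOf k τ) (k := k)
    (demand := fun x => (τ.arr aMax x / τ.arr aVal₂ x : ℚ))
    (e _ rfl rfl rfl) (e _ rfl rfl rfl) (fun x hx => (hgr x hx).1) (fun x hx => (hgr x hx).2)
    (F₃.compares (F₂.compares (F₁.compares c₁ rfl rfl) rfl rfl) rfl rfl)
    (F₃.compares (F₂.compares (F₁.compares c₂ rfl rfl) rfl rfl) rfl rfl)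
    (by rw [e _ rfl rfl rfl]; exact h00 _) (by rw [e _ rfl rfl rfl]; exact h00 _)
    (fun x => by rw [e _ rfl rfl rfl]; exact hz _ (by cases sw <;> rfl) x)
    (fun y => ?_) (fun y => ?_) ?_).mono ?_
  · rw [F₃.arr aLink₁ rfl, F₂.arr aLink₁ rfl, F₃.arr aHead₁ rfl, F₂.arr aHead₁ rfl]
    exact hs₁ y
  · rw [F₃.arr aLink₂ rfl, F₃.arr aHead₂ rfl]
    have := hs₂ y
    rwa [F₁.arr aGroup₂ rfl] at this
  · have := hs₃ 0
    have h0 : ∀ x, τ₂.arr aZero x = 0 := fun x => by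
      rw [F₂.arr aZero rfl, F₁.arr aZero rfl]; exact hz _ (by cases sw <;> rfl) x
    simp only [h0, and_true] at this
    exact this
  rintro τ₄ m₄ - F₄ ⟨hm₄, hlab⟩
  have e₄ : ∀ j, (sortCmd aNum₁ aDen₁ aGroup₁ aHead₁ aLink₁).writesArr j = false →
      (sortCmd aDen₂ aNum₂ aGroup₂ aHead₂ aLink₂).writesArr j = false →
      (sortCmd aMax aVal₂ aZero aHead₃ aLink₃).writesArr j = false →
      searchCmd.writesArr j = false → τ₄.arr j = τ.arr j :=
    fun j h1 h2 h3 h4 => (F₄.arr j h4).trans (e j h1 h2 h3)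
  have hM₄ : τ₄.var vM = k * k := (F₄.var _ rfl).trans <| (F₃.var _ rfl).trans <|
    (F₂.var _ rfl).trans <| (F₁.var _ rfl).trans hM
  have hnl₁ : nodeLoss₁ τ₄ = nodeLoss₁ τ := by
    funext x
    rw [nodeLoss₁, nodeLoss₁, e₄ _ rfl rfl rfl rfl, e₄ _ rfl rfl rfl rfl]
  have hnl₂ : nodeLoss₂ τ₄ = nodeLoss₂ τ := by
    funext x
    rw [nodeLoss₂, nodeLoss₂, e₄ _ rfl rfl rfl rfl, e₄ _ rfl rfl rfl rfl]
  have hrat : Ratios τ₄ (k * k) := by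
    refine ⟨fun x h1 h2 => (hlab.reach x ⟨h1, h2⟩).1, fun x h1 h2 => ?_, fun x h1 h2 => ?_⟩
    all_goals
      obtain ⟨s, rfl⟩ := hnode x h1 h2
      rw [e₄ _ rfl rfl rfl rfl, e₄ _ rfl rfl rfl rfl, htab.max]
    · rw [htab.val₁]
      exact ⟨Nat.mul_pos (hnu0 _ _) (hde0 _ _), le_max_left _ _⟩
    · rw [htab.val₂]
      exact ⟨Nat.mul_pos (hnu0 _ _) (hde0 _ _), le_max_right _ _⟩
  obtain ⟨n₅, rfl⟩ : ∃ n₅, m₄ = n₅ + 4 + 11 * (k * k) :=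
    ⟨m₄ - (4 + 11 * (k * k)), by omega⟩
  rw [wp_seq]
  refine (ratioCmd_spec hc hM₄ hrat).mono ?_
  rintro τ₅ m₅ - F₅ ⟨hm₅, hQ, hPQ, hle, hex⟩
  have e₅ : τ₅.arr = τ₄.arr := funext fun j => F₅.arr j rfl
  have hrat₅ : Ratios τ₅ (k * k) := by
    refine ⟨?_, ?_, ?_⟩ <;> rw [e₅]
    exacts [hrat.label, hrat.val₁, hrat.val₂]
  obtain ⟨n₆, rfl⟩ : ∃ n₆, m₅ = n₆ + 4 + 12 * (k * k) :=
    ⟨m₅ - (4 + 12 * (k * k)), by omega⟩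
  refine (ruleCmd_spec hc ((F₅.var vM rfl).trans hM₄) hrat₅ hQ hPQ (by rw [pow_two]; omega)).mono ?_
  rintro τ₆ m₆ - - ⟨-, hio0, hio1, hwr⟩
  have hL₁ : ∀ s, loss v 0 s = nodeLoss₁ τ (nodeOf s) := hv ▸ htab.loss_zero hde0 hnu0
  have hL₂ : ∀ s, loss v 1 s = nodeLoss₂ τ (nodeOf s) := hv ▸ htab.loss_one hde0 hnu0
  have hil := (hv ▸ htab.models : Models (linesOf k τ) v).isLabel hv0 hk (fun s => by
    rw [hL₂, nodeLoss₂]; push_cast; rfl) hlab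
  set r : ℝ := τ₅.var vP / τ₅.var vQ with hr
  have hQ' : (0 : ℝ) < τ₅.var vQ := by exact_mod_cast hQ
  have hLl : ∀ s : Profile 2 k, loss v 1 (profileOf hk (τ₄.arr aLabel (nodeOf s))) =
      nodeLoss₂ τ (τ₄.arr aLabel (nodeOf s)) := fun s => by
    have h1 := hrat.label _ (one_le_nodeOf s) (nodeOf_le s)
    rw [hL₂, nodeOf_profileOf hk h1.1 h1.2]
  have hopt := hS _ r hil ((one_le_div hQ').2 (by exact_mod_cast hPQ)) (fun s => by
      rw [hLl, hL₁, ← hnl₁, ← hnl₂]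
      exact hle _ (one_le_nodeOf s) (nodeOf_le s)) (by
      refine hex.imp_right ?_
      rintro ⟨x, h1, h2, hx⟩
      obtain ⟨s, rfl⟩ := hnode x h1 h2
      refine ⟨s, ?_⟩
      rw [hLl, hL₁, ← hnl₁, ← hnl₂]
      exact hx)
  simp only [hLl] at hopt
  have hnl₅ : nodeLoss₂ τ₅ = nodeLoss₂ τ := by
    rw [← hnl₂]
    funext x
    rw [nodeLoss₂, nodeLoss₂, e₅]
  rw [hnl₅, e₅] at hwr
  exact ⟨_, r, Written.isOutput (by rw [hio1]; exact hQ.ne') (by rw [hio0, hio1]) hwr, hopt⟩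

end

/-- Degrees of the variables of `solveCmd`. Variables that are used by the sorting procedure get the
degree of the conflict values. -/
def varDeg : ℕ → ℕ
  | vK => 1
  | vM => 2
  | vRest | vWeight => 10
  | vMax₂ | vMax₁ => 3
  | vVal₂ | vVal₁ => 2
  | vIn => 1
  | _ => 7

/-- Degrees of the arrays of `solveCmd`. -/
def arrDeg : ℕ → ℕ
  | aNum₁ | aDen₁ | aNum₂ | aDen₂ => 1
  | aVal₁ | aVal₂ => 2
  | aMax => 3
  | _ => 7

theorem solvable_of_computes {P : ∀ {k : ℕ}, Family 2 k → Family 2 k → ℝ → Prop} (sw : Bool)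
    {on od we : Ex} {g F : ℝ → ℝ → ℝ} (hc : Computes on od we g F)
    (hok : (solveCmd sw on od we).ok varDeg arrDeg 16 50)
    (hP : ∀ {k : ℕ} (u v : Family 2 k), 1 ≤ k → (∀ i s, 0 < v i s) →
      (v = bif sw then fun i s => (u i s)⁻¹ else u) → ∀ lab r, IsLabel v lab → 1 ≤ r →
      (∀ s, g (loss v 1 (lab s)) (loss v 0 s) ≤ r) →
      (r = 1 ∨ ∃ s, r = g (loss v 1 (lab s)) (loss v 0 s)) →
      P u (ruleOf fun s => F (loss v 1 (lab s)) r) r) :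
    SolvableInQuasilinearTime P := by
  refine solvable_of_wp P _ _ _ 16 50 610 (by norm_num) hok ?_
  intro k b num den hk hnum hden hsize io hio
  refine solveCmd_spec hc hk hnum hden hsize hio rfl (hP _ _ hk (fun i s => ?_) ?_)
  · cases sw
    · exact div_pos (by exact_mod_cast hnum i s) (by exact_mod_cast hden i s)
    · exact div_pos (by exact_mod_cast hden i s) (by exact_mod_cast hnum i s)
  · cases sw
    · rfl
    · funext i s
      simp [fractions]

end TwoAgents

theorem theorem1 :
    (∀ (k : ℕ) (v : TwoAgents.Family 2 k), 1 ≤ k → (∀ i s, 0 < v i s) →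
      (∃ r : ℝ, IsLeast (TwoAgents.RV v '' TwoAgents.Truthful v) r ∧
        IsGreatest (TwoAgents.conflictValues v fun a b => 1 / TwoAgents.conflict a b) r) ∧
      (∃ r : ℝ, IsLeast (TwoAgents.RC v '' TwoAgents.Truthful v) r ∧
        IsGreatest (TwoAgents.conflictValues v fun a b => TwoAgents.conflict (1 / a) (1 / b)) r) ∧
      (∃ r : ℝ, IsLeast (TwoAgents.RV v '' TwoAgents.TruthfulDet v) r ∧
        IsLeast (TwoAgents.RC v '' TwoAgents.TruthfulDet v) r ∧
        IsGreatest (TwoAgents.conflictValues v fun a b => min (1 / a) (1 / b)) r)) ∧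
    TwoAgents.SolvableInQuasilinearTime TwoAgents.Val ∧
    TwoAgents.SolvableInQuasilinearTime TwoAgents.Cst ∧
    TwoAgents.SolvableInQuasilinearTime TwoAgents.DetVal ∧
    TwoAgents.SolvableInQuasilinearTime TwoAgents.DetCst := by
  open TwoAgents in
  refine ⟨fun k v hk hv => optimal_ratios hk hv,
    solvable_of_computes false good_computes (by decide) ?_,
    solvable_of_computes true chore_computes (by decide) ?_,
    solvable_of_computes false det_computes (by decide) ?_,
    solvable_of_computes true det_computes (by decide) ?_⟩
  · rintro k u v hk hv rfl lab r hlab hr hle hex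
    exact (good_optimal hk hv hlab hr hle hex).1
  · rintro k u v hk hv rfl lab r hlab hr hle hex
    exact (chore_optimal hk hv hlab hr hle hex).1
  · rintro k u v hk hv rfl lab r hlab hr hle hex
    exact (detGood_optimal hk hv hlab hr hle hex).1
  · rintro k u v hk hv rfl lab r hlab hr hle hex
    exact (detChore_optimal hk hv hlab hr hle hex).1
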